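/- Let $n\ge 0$ and $d\ge 1$ be integers, $\zeta=\exp(2\pi\sqrt{-1}/d)$, $V=\mathbb C^n$ with standard basis $e_1,\dots,e_n$ and dual basis $x_1,\dots,x_n$ of $V^*$, and let $W=G(d,1,n)\subseteq GL(V)$ be the group of monomial matrices whose nonzero entries are $d$-th roots of unity. Let $\mathcal A$ be the set of its reflection hyperplanes: $H_i=\operatorname{Ker}x_i$ (if $d\geq 2$) and $H_{ij;\alpha}=\operatorname{Ker}(x_i-\zeta^\alpha x_j)$ ($i<j$, $0\le\alpha<d$). For $H=H_i$ put $\alpha_H=x_i$, $v_H=e_i$, $e_H=d$ and let $w_H=t_i$ be the element multiplying $e_i$ by $\zeta$ and fixing the other $e_k$; for $H=H_{ij;\alpha}$ put $\alpha_H=x_i-\zeta^\alpha x_j$, $v_H=e_i-\zeta^{-\alpha}e_j$, $e_H=2$ and let $w_H=s_{ij;\alpha}$ be the reflection with $e_i\mapsto\zeta^{-\alpha}e_j$, $e_j\mapsto\zeta^\alpha e_i$, fixing the other $e_k$. Let $R$ be a commutative Noetherian local $\mathbb C$-algebra (so that its residue field contains $\mathbb C$), and let $\kappa_1,\dots,\kappa_{d-1},h\in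 R$. Put $\kappa_0=\kappa_d=0$, $h_1=h$, $h_0=h_2=0$, $c_{H_i,k}=\kappa_k$, $c_{H_{ij;\alpha},k}=h_k$, $\epsilon_{H,k}=\frac1{e_H}\sum_{a=0}^{e_H-1}\exp(2\pi\sqrt{-1}\,ak/e_H)\,w_H^a$ and $\gamma_H=e_H\sum_{k=0}^{e_H-1}(c_{H,k+1}-c_{H,k})\,\epsilon_{H,k}\in RW$. The rational Cherednik algebra $H_R(\underline\kappa,h)$ is the quotient of the $R$-algebra $T(V\oplus V^*)\sharp W\otimes_{\mathbb C}R$ by the two-sided ideal generated by all $$[y,\xi]-\langle\xi,y\rangle-\sum_{H\in\mathcal A}\frac{\langle\xi,v_H\rangle\langle\alpha_H,y\rangle}{\langle\alpha_H,v_H\rangle}\gamma_H,\qquad [y,y'],\qquad [\xi,\xi']\qquad (y,y'\in V,\ \xi,\xi'\in V^*).$$ Let $\mathcal O$ be the full subcategory of $H_R(\underline\kappa,h)\text{-Mod}$ of the finitely generated modules that are locally nilpotent over $S(V)$, i.e. in which every element is annihilated by some power of the augmentation ideal of $S(V)$. For an irreducible complex representation $E$ of $W$, let $\Delta(E)=H_R(\underline\kappa,h)\otimes_{S(V)\sharp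 W\otimes_{\mathbb C}R}(E\otimes_{\mathbb C}R)$ be the standard module, where $V$ acts on $E$ by $0$. **Theorem.** There is an object $P$ of $\mathcal O$ such that 1. $P$ is a progenerator of $\mathcal O$: it is a projective object of $\mathcal O$, and every object of $\mathcal O$ is a quotient of $P^{\oplus N}$ for some $N\ge 0$; 2. $P$ has a finite $\Delta$-filtration: there is a finite chain of submodules $0=F_0\subseteq F_1\subseteq\dots\subseteq F_r=P$ such that each $F_i/F_{i-1}$ is isomorphic to $\Delta(E_i)$ for some irreducible complex representation $E_i$ of $W$. -/

import Mathlib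

universe u

namespace RationalCherednik

noncomputable section

/-! ### The complex reflection group `W = G(d,1,n)` -/

/-- The space `V = ℂⁿ` with standard basis `e_k = Pi.single k 1`. -/
abbrev V (n : ℕ) : Type := Fin n → ℂ

/-- The dual space `V* = Hom_ℂ(V, ℂ)`. -/
abbrev VDual (n : ℕ) : Type := Module.Dual ℂ (V n)

/-- The monomial automorphism of `V` with `e_k ↦ u_k e_{σ(k)}`. -/
def monomialEquiv {n : ℕ} (u : Fin n → ℂˣ) (σ : Equiv.Perm (Fin n)) : V n ≃ₗ[ℂ] V n :=
  (LinearEquiv.piCongrRight fun k => LinearEquiv.smulOfUnit (u k)) ≪≫ₗ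
    LinearEquiv.funCongrLeft ℂ ℂ σ.symm

theorem monomialEquiv_apply {n : ℕ} (u : Fin n → ℂˣ) (σ : Equiv.Perm (Fin n)) (y : V n)
    (j : Fin n) : monomialEquiv u σ y j = (u (σ.symm j) : ℂ) * y (σ.symm j) := rfl

theorem monomialEquiv_single {n : ℕ} (u : Fin n → ℂˣ) (σ : Equiv.Perm (Fin n)) (k : Fin n) :
    monomialEquiv u σ (Pi.single k 1) = (u k : ℂ) • Pi.single (σ k) 1 := by
  ext j
  rw [monomialEquiv_apply]
  by_cases hj : σ.symm j = k
  · subst hj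
    simp
  · have hj' : j ≠ σ k := fun h => hj (by simp [h])
    simp [Pi.single_eq_of_ne hj, Pi.single_eq_of_ne hj']

theorem monomialEquiv_mul {n : ℕ} (u v : Fin n → ℂˣ) (σ τ : Equiv.Perm (Fin n)) :
    monomialEquiv u σ * monomialEquiv v τ =
      monomialEquiv (fun k => u (τ k) * v k) (σ * τ) := by
  apply LinearEquiv.ext
  intro y
  funext j
  simp only [LinearEquiv.mul_apply, monomialEquiv_apply]
  change (u (σ.symm j) : ℂ) * ((v (τ.symm (σ.symm j)) : ℂ) * y (τ.symm (σ.symm j))) =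
    ((u (τ (τ.symm (σ.symm j))) * v (τ.symm (σ.symm j)) : ℂˣ) : ℂ) * y (τ.symm (σ.symm j))
  simp [mul_assoc]

theorem monomialEquiv_one {n : ℕ} :
    monomialEquiv (1 : Fin n → ℂˣ) 1 = 1 := by
  apply LinearEquiv.ext
  intro y
  funext j
  simp [monomialEquiv_apply, ← Equiv.Perm.inv_def]

/-- The group `W = G(d,1,n)` of all monomial matrices whose nonzero entries are `d`-th roots
of unity, acting on `V`. -/
def W (n d : ℕ) : Subgroup (V n ≃ₗ[ℂ] V n) where
  carrier := {g | ∃ (u : Fin n → ℂˣ) (σ : Equiv.Perm (Fin n)),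
    (∀ k, u k ^ d = 1) ∧ g = monomialEquiv u σ}
  mul_mem' := by
    rintro _ _ ⟨u, σ, hu, rfl⟩ ⟨v, τ, hv, rfl⟩
    exact ⟨_, _, fun k => by rw [mul_pow, hu, hv, one_mul], monomialEquiv_mul u v σ τ⟩
  one_mem' := ⟨1, 1, fun _ => one_pow d, monomialEquiv_one.symm⟩
  inv_mem' := by
    rintro _ ⟨u, σ, hu, rfl⟩
    refine ⟨fun k => (u (σ⁻¹ k))⁻¹, σ⁻¹, fun k => by rw [inv_pow, hu, inv_one], ?_⟩
    rw [inv_eq_iff_mul_eq_one, monomialEquiv_mul, ← monomialEquiv_one, mul_inv_cancel]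
    congr 1
    funext k
    simp

/-- The contragredient action of `w` on `V*`: `⟨w(ξ), y⟩ = ⟨ξ, w⁻¹(y)⟩`. -/
def dualAct {n d : ℕ} (w : W n d) (ξ : VDual n) : VDual n :=
  ξ ∘ₗ ((w⁻¹ : W n d) : V n ≃ₗ[ℂ] V n).toLinearMap

/-- `ζ = exp(2π√-1 / d)`, as a unit of `ℂ`. -/
def zeta (d : ℕ) : ℂˣ :=
  Units.mk0 (Complex.exp (2 * Real.pi * Complex.I / d)) (Complex.exp_ne_zero _)

theorem zeta_pow (d : ℕ) [NeZero d] : zeta d ^ d = 1 := by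
  apply Units.ext
  simpa [zeta] using (Complex.isPrimitiveRoot_exp d (NeZero.ne d)).pow_eq_one

/-- `t_i`: multiplies `e_i` by `ζ` and fixes `e_k` for `k ≠ i`. -/
def tRefl {n : ℕ} (d : ℕ) [NeZero d] (i : Fin n) : W n d :=
  ⟨monomialEquiv (Function.update 1 i (zeta d)) 1, _, _, fun k => by
    by_cases hk : k = i
    · subst hk; simpa using zeta_pow d
    · simp [hk], rfl⟩

/-- `s_{ij;α}`: `e_i ↦ ζ^{-α} e_j`, `e_j ↦ ζ^α e_i`, `e_k ↦ e_k` for `k ≠ i, j`. -/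
def sRefl {n : ℕ} (d : ℕ) [NeZero d] (i j : Fin n) (α : ℕ) : W n d :=
  ⟨monomialEquiv (Function.update (Function.update 1 j (zeta d ^ α)) i (zeta d ^ α)⁻¹)
    (Equiv.swap i j), _, _, fun k => by
    have h : (zeta d ^ α) ^ d = 1 := by rw [← pow_mul, mul_comm, pow_mul, zeta_pow, one_pow]
    by_cases hk : k = i
    · subst hk; simp [h]
    · by_cases hk' : k = j
      · subst hk'; simp [hk, h]
      · simp [hk, hk'], rfl⟩

/-! ### Reflection hyperplanes and the elements `γ_H` -/

/-- The index set of the reflection arrangement: `Sum.inl i` stands for `H_i = Ker x_i`, and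
`Sum.inr (⟨(i, j), _⟩, α)`, with `i < j` and `0 ≤ α < d`, for
`H_{ij;α} = Ker (x_i - ζ^α x_j)`. For `d = 1` there is no reflection with hyperplane `H_i`;
accordingly `γ_{H_i} = 0` in that case, see `gamma_eq_zero_of_d_eq_one`. -/
abbrev Hyp (n d : ℕ) : Type := Fin n ⊕ ({p : Fin n × Fin n // p.1 < p.2} × Fin d)

/-- The coordinate function `x_i ∈ V*`. -/
def coord {n : ℕ} (i : Fin n) : VDual n := LinearMap.proj i

/-- The root `α_H`: `x_i`, resp. `x_i - ζ^α x_j`. -/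
def root {n d : ℕ} : Hyp n d → VDual n
  | Sum.inl i => coord i
  | Sum.inr (p, α) => coord p.1.1 - ((zeta d ^ (α : ℕ) : ℂˣ) : ℂ) • coord p.1.2

/-- The coroot `v_H`: `e_i`, resp. `e_i - ζ^{-α} e_j`. -/
def coroot {n d : ℕ} : Hyp n d → V n
  | Sum.inl i => Pi.single i 1
  | Sum.inr (p, α) =>
      Pi.single p.1.1 1 - (((zeta d ^ (α : ℕ))⁻¹ : ℂˣ) : ℂ) • Pi.single p.1.2 1

/-- `e_H`, the order of the pointwise stabilizer `W_H` of `H`. -/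
def stabOrder {n d : ℕ} : Hyp n d → ℕ
  | Sum.inl _ => d
  | Sum.inr _ => 2

/-- The distinguished generator `w_H` of `W_H`: `t_i`, resp. `s_{ij;α}`. -/
def stabGen {n d : ℕ} [NeZero d] : Hyp n d → W n d
  | Sum.inl i => tRefl d i
  | Sum.inr (p, α) => sRefl d p.1.1 p.1.2 α

variable {R : Type u} [CommRing R] [Algebra ℂ R]

/-- The parameters `κ_k` for `0 ≤ k ≤ d`: the value `κ i` of the given family is `κ_{i+1}`
(so that the family is `κ_1, …, κ_{d-1}`), and `κ_0 = κ_d = 0`. -/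
def kappa {d : ℕ} (κ : Fin (d - 1) → R) (k : ℕ) : R :=
  if hk : 0 < k ∧ k < d then κ ⟨k - 1, by omega⟩ else 0

/-- The parameters `c_{H,k}` for `0 ≤ k ≤ e_H`: `κ_k` if `H = H_i`, and `h_k` if
`H = H_{ij;α}`, where `h_1 = h` and `h_0 = h_2 = 0`. -/
def cParam {n d : ℕ} (κ : Fin (d - 1) → R) (h : R) : Hyp n d → ℕ → R
  | Sum.inl _, k => kappa κ k
  | Sum.inr _, k => if k = 1 then h else 0

/-- `ε_{H,k} = (1/e_H) ∑_{0 ≤ a < e_H} exp(2π√-1 a k / e_H) w_H^a`, in the group algebra `RW`. -/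
def eps {n d : ℕ} [NeZero d] (R : Type u) [CommRing R] [Algebra ℂ R] (H : Hyp n d) (k : ℕ) :
    MonoidAlgebra R (W n d) :=
  ∑ a ∈ Finset.range (stabOrder H),
    algebraMap ℂ R ((1 / (stabOrder H : ℂ)) *
      Complex.exp (2 * Real.pi * Complex.I * a * k / stabOrder H)) •
        MonoidAlgebra.of R (W n d) (stabGen H ^ a)

/-- `γ_H = e_H ∑_{0 ≤ k < e_H} (c_{H,k+1} - c_{H,k}) ε_{H,k}`, in the group algebra `RW`. -/
def gamma {n d : ℕ} [NeZero d] (κ : Fin (d - 1) → R) (h : R) (H : Hyp n d) :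
    MonoidAlgebra R (W n d) :=
  (stabOrder H : R) • ∑ k ∈ Finset.range (stabOrder H),
    (cParam κ h H (k + 1) - cParam κ h H k) • eps R H k

theorem gamma_eq_zero_of_d_eq_one {n : ℕ} (κ : Fin (1 - 1) → R) (h : R) (i : Fin n) :
    gamma (d := 1) κ h (Sum.inl i) = 0 := by
  simp [gamma, stabOrder, cParam, kappa]

/-! ### The rational Cherednik algebra `H_R(κ, h)` -/

/-- Generators of the smash product `T(V ⊕ V*) ♯ W`. -/
inductive Gen (n d : ℕ) : Type
  | vec (y : V n) : Gen n d
  | cov (ξ : VDual n) : Gen n d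
  | grp (w : W n d) : Gen n d

open FreeAlgebra in
/-- Defining relations of `T(V ⊕ V*) ♯ W ⊗_ℂ R` as an `R`-algebra: `V` and `V*` are embedded
`ℂ`-linearly, `W` multiplicatively, and `w y w⁻¹ = w(y)`, `w ξ w⁻¹ = w(ξ)`. -/
inductive SmashRel (n d : ℕ) (R : Type u) [CommRing R] [Algebra ℂ R] :
    FreeAlgebra R (Gen n d) → FreeAlgebra R (Gen n d) → Prop
  | vec_add (y y' : V n) :
      SmashRel n d R (ι R (Gen.vec (y + y'))) (ι R (Gen.vec y) + ι R (Gen.vec y'))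
  | vec_smul (c : ℂ) (y : V n) :
      SmashRel n d R (ι R (Gen.vec (c • y))) (algebraMap ℂ R c • ι R (Gen.vec y))
  | cov_add (ξ ξ' : VDual n) :
      SmashRel n d R (ι R (Gen.cov (ξ + ξ'))) (ι R (Gen.cov ξ) + ι R (Gen.cov ξ'))
  | cov_smul (c : ℂ) (ξ : VDual n) :
      SmashRel n d R (ι R (Gen.cov (c • ξ))) (algebraMap ℂ R c • ι R (Gen.cov ξ))
  | grp_one : SmashRel n d R (ι R (Gen.grp 1)) 1
  | grp_mul (w w' : W n d) :
      SmashRel n d R (ι R (Gen.grp (w * w'))) (ι R (Gen.grp w) * ι R (Gen.grp w'))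
  | grp_vec (w : W n d) (y : V n) :
      SmashRel n d R (ι R (Gen.grp w) * ι R (Gen.vec y) * ι R (Gen.grp w⁻¹))
        (ι R (Gen.vec ((w : V n ≃ₗ[ℂ] V n) y)))
  | grp_cov (w : W n d) (ξ : VDual n) :
      SmashRel n d R (ι R (Gen.grp w) * ι R (Gen.cov ξ) * ι R (Gen.grp w⁻¹))
        (ι R (Gen.cov (dualAct w ξ)))

/-- The `R`-algebra `T(V ⊕ V*) ♯ W ⊗_ℂ R`. -/
def Smash (n d : ℕ) (R : Type u) [CommRing R] [Algebra ℂ R] : Type u :=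
  RingQuot (SmashRel n d R)

instance (n d : ℕ) (R : Type u) [CommRing R] [Algebra ℂ R] : Ring (Smash n d R) :=
  inferInstanceAs (Ring (RingQuot (SmashRel n d R)))

instance (n d : ℕ) (R : Type u) [CommRing R] [Algebra ℂ R] : Algebra R (Smash n d R) :=
  inferInstanceAs (Algebra R (RingQuot (SmashRel n d R)))

namespace Smash

variable (n d : ℕ) (R : Type u) [CommRing R] [Algebra ℂ R]

/-- The quotient map from the free algebra. -/
def mk : FreeAlgebra R (Gen n d) →ₐ[R] Smash n d R :=
  RingQuot.mkAlgHom R (SmashRel n d R)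

variable {n d R} in
theorem mk_rel {a b : FreeAlgebra R (Gen n d)} (hab : SmashRel n d R a b) :
    mk n d R a = mk n d R b :=
  RingQuot.mkAlgHom_rel R hab

/-- The image of a generator. -/
def gen (g : Gen n d) : Smash n d R := mk n d R (FreeAlgebra.ι R g)

/-- The canonical homomorphism `RW → T(V ⊕ V*) ♯ W ⊗_ℂ R`. -/
def ofGroupAlgebra : MonoidAlgebra R (W n d) →ₐ[R] Smash n d R :=
  MonoidAlgebra.lift R (Smash n d R) (W n d)
    { toFun := fun w => gen n d R (Gen.grp w)
      map_one' := by
        have := mk_rel (SmashRel.grp_one (n := n) (d := d) (R := R))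
        simpa [gen] using this
      map_mul' := fun w w' => by
        have := mk_rel (SmashRel.grp_mul (R := R) w w')
        simpa [gen] using this }

end Smash

/-- The relations of the rational Cherednik algebra:
`[y, ξ] = ⟨ξ, y⟩ + ∑_H (⟨ξ, v_H⟩ ⟨α_H, y⟩ / ⟨α_H, v_H⟩) γ_H`, `[y, y'] = 0`, `[ξ, ξ'] = 0`. -/
inductive CherednikRel {n d : ℕ} [NeZero d] (κ : Fin (d - 1) → R) (h : R) :
    Smash n d R → Smash n d R → Prop
  | vec_cov (y : V n) (ξ : VDual n) : CherednikRel κ h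
      (Smash.gen n d R (Gen.vec y) * Smash.gen n d R (Gen.cov ξ) -
        Smash.gen n d R (Gen.cov ξ) * Smash.gen n d R (Gen.vec y))
      (algebraMap R (Smash n d R) (algebraMap ℂ R (ξ y)) +
        ∑ H : Hyp n d, algebraMap ℂ R (ξ (coroot H) * root H y / root H (coroot H)) •
          Smash.ofGroupAlgebra n d R (gamma κ h H))
  | vec_vec (y y' : V n) : CherednikRel κ h
      (Smash.gen n d R (Gen.vec y) * Smash.gen n d R (Gen.vec y') -
        Smash.gen n d R (Gen.vec y') * Smash.gen n d R (Gen.vec y)) 0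
  | cov_cov (ξ ξ' : VDual n) : CherednikRel κ h
      (Smash.gen n d R (Gen.cov ξ) * Smash.gen n d R (Gen.cov ξ') -
        Smash.gen n d R (Gen.cov ξ') * Smash.gen n d R (Gen.cov ξ)) 0

/-- The rational Cherednik algebra `H_R(κ, h)` of `W = G(d,1,n)`. -/
def Cherednik (n : ℕ) {d : ℕ} [NeZero d] (κ : Fin (d - 1) → R) (h : R) : Type u :=
  RingQuot (CherednikRel (n := n) κ h)

instance (n : ℕ) {d : ℕ} [NeZero d] (κ : Fin (d - 1) → R) (h : R) : Ring (Cherednik n κ h) :=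
  inferInstanceAs (Ring (RingQuot (CherednikRel (n := n) κ h)))

instance (n : ℕ) {d : ℕ} [NeZero d] (κ : Fin (d - 1) → R) (h : R) : Algebra R (Cherednik n κ h) :=
  inferInstanceAs (Algebra R (RingQuot (CherednikRel (n := n) κ h)))

namespace Cherednik

variable {n d : ℕ} [NeZero d] (κ : Fin (d - 1) → R) (h : R)

/-- The quotient map `T(V ⊕ V*) ♯ W ⊗_ℂ R → H_R(κ, h)`. -/
def mk : Smash n d R →ₐ[R] Cherednik n κ h :=
  RingQuot.mkAlgHom R (CherednikRel κ h)

/-- The image of `y ∈ V` in `H_R(κ, h)`. -/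
def vec (y : V n) : Cherednik n κ h :=
  mk κ h (Smash.gen n d R (Gen.vec y))

/-- The image of `ξ ∈ V*` in `H_R(κ, h)`. -/
def cov (ξ : VDual n) : Cherednik n κ h :=
  mk κ h (Smash.gen n d R (Gen.cov ξ))

/-- The image of `w ∈ W` in `H_R(κ, h)`. -/
def grp (w : W n d) : Cherednik n κ h :=
  mk κ h (Smash.gen n d R (Gen.grp w))

end Cherednik

/-! ### Category `𝒪`, standard modules, progenerators -/

section CategoryO

open TensorProduct

variable {n d : ℕ} [NeZero d] (κ : Fin (d - 1) → R) (h : R)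

/-- Category `𝒪`: the `H_R(κ, h)`-modules `M` that are finitely generated and locally nilpotent
over `S(V)`, that is, each `m ∈ M` is killed by a power `I^N` of the augmentation ideal of `S(V)`
(equivalently, by all products of `N` vectors of `V`). -/
def categoryO (n : ℕ) {d : ℕ} [NeZero d] (κ : Fin (d - 1) → R) (h : R) :
    CategoryTheory.ObjectProperty (ModuleCat.{u} (Cherednik n κ h)) :=
  fun M => Module.Finite (Cherednik n κ h) M ∧
    ∀ m : M, ∃ N : ℕ, ∀ l : List (V n), l.length = N →
      (l.map (Cherednik.vec κ h)).prod • m = 0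

/-- The `H_R(κ, h)`-submodule of `H_R(κ, h) ⊗_R (R ⊗_ℂ E)` spanned by all
`a w ⊗ m - a ⊗ w m` and `a y ⊗ m`, for `a ∈ H_R(κ, h)`, `w ∈ W`, `y ∈ V`, `m ∈ R ⊗_ℂ E`. -/
def deltaRel {E : Type} [AddCommGroup E] [Module ℂ E] (ρ : Representation ℂ (W n d) E) :
    Submodule (Cherednik n κ h) (Cherednik n κ h ⊗[R] (R ⊗[ℂ] E)) :=
  Submodule.span (Cherednik n κ h)
    ({z | ∃ (a : Cherednik n κ h) (w : W n d) (m : R ⊗[ℂ] E),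
        z = (a * Cherednik.grp κ h w) ⊗ₜ[R] m - a ⊗ₜ[R] ((ρ w).baseChange R m)} ∪
      {z | ∃ (a : Cherednik n κ h) (y : V n) (m : R ⊗[ℂ] E),
        z = (a * Cherednik.vec κ h y) ⊗ₜ[R] m})

/-- The standard module
`Δ(E) = H_R(κ, h) ⊗_{S(V) ♯ W ⊗_ℂ R} (E ⊗_ℂ R)`, where `V` acts on `E` by zero. The tensor product
over the noncommutative algebra `S(V) ♯ W ⊗_ℂ R`, which is generated over `R` by `V` and `W`, is
the tensor product over `R` modulo the balancing relations for these generators. -/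
abbrev Delta {E : Type} [AddCommGroup E] [Module ℂ E] (ρ : Representation ℂ (W n d) E) : Type u :=
  (Cherednik n κ h ⊗[R] (R ⊗[ℂ] E)) ⧸ deltaRel κ h ρ

/-- `M` has a finite `Δ`-filtration: a finite chain of submodules from `0` to `M` whose
successive quotients are isomorphic to standard modules `Δ(E)`, `E ∈ Irr W`. -/
def HasFiniteDeltaFiltration (n : ℕ) {d : ℕ} [NeZero d] (κ : Fin (d - 1) → R) (h : R)
    (M : Type u) [AddCommGroup M] [Module (Cherednik n κ h) M] : Prop :=
  ∃ (r : ℕ) (F : Fin (r + 1) → Submodule (Cherednik n κ h) M),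
    F 0 = ⊥ ∧ F (Fin.last r) = ⊤ ∧
    ∀ i : Fin r, F i.castSucc ≤ F i.succ ∧
      ∃ (E : Type) (_ : AddCommGroup E) (_ : Module ℂ E) (ρ : Representation ℂ (W n d) E),
        ρ.IsIrreducible ∧
        Nonempty ((F i.succ ⧸ (F i.castSucc).submoduleOf (F i.succ)) ≃ₗ[Cherednik n κ h]
          Delta κ h ρ)

/-- `P` is a progenerator of `𝒪`: a projective object of the category `𝒪` such that every object
of `𝒪` is a quotient of a finite direct sum of copies of `P`. -/
structure IsProgenerator (P : (categoryO n κ h).FullSubcategory) : Prop where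
  projective : CategoryTheory.Projective P
  exists_surjective : ∀ M : (categoryO n κ h).FullSubcategory,
    ∃ (N : ℕ) (f : (Fin N → P.obj) →ₗ[Cherednik n κ h] M.obj), Function.Surjective f

end CategoryO

end

end RationalCherednik

/-!
Everything rests on the Euler element `eu = ∑ i, x_i e_i + ∑ w, b(w) w` of the rational Cherednik
algebra, with `b(w)` the coefficients in the commutation relations. It commutes with `W` and
satisfies `[eu, y] = -y` for `y ∈ V` (`Cherednik.euler_mul_grp`, `Cherednik.euler_mul_vec`).

*Induced modules.* For a finite-dimensional representation `X` of `S(V) ♯ W`, the module induced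
from `R ⊗ X` is realized on `R ⊗ X ⊗ S(V*)` by Dunkl operators (`Ind`). That these operators satisfy
the defining relations is the only part of the Poincaré–Birkhoff–Witt theorem that is needed. It
makes induction exact in `X`, and for `V` acting by zero it gives the standard modules
(`Ind.nonempty_equiv_delta`). If `X` carries a degree operator (`BorelRep`), then `eu` corrected by
the degree on `X` is an `H_R(κ, h)`-linear endomorphism `T` of the induced module (`Ind.eulerEnd`).
On a standard module `T` is a scalar, by Schur's lemma. Along a composition series of `X` it follows
that `T` is annihilated by a polynomial with roots in `R`, and, as `R` is local, that the image of
every idempotent `p(T)` has a finite `Δ`-filtration (`Ind.eulerEnd_induction`).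

*The universal module.* For `X = S(V)/I^N ⊗ ℂW`, with `I` the augmentation ideal, the induced module
`Jet n κ h N` represents the elements annihilated by `I^N` (`Jet.exists_lift`), and on its generator
`T` acts as `eu`. Hence every locally nilpotent element of a module is annihilated by a polynomial
in `eu` with roots in `R`, and it is the sum of a part with spectrum in `S` and a part with spectrum
outside of `S`, for every set `S` of residue classes of `R` (`exists_add_hasSpectrumIn`).

*The progenerator.* Let `S` be the finite set of residue classes of the eigenvalues of `eu` on
singular vectors, that is, vectors annihilated by `V`. As `V` lowers the spectrum by one and the
residue field has characteristic zero, there is a bound `N` such that all locally nilpotent elements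
with spectrum in `S` are annihilated by `I^N` (`HasSpectrumIn.killedByAugPow`). These elements
generate every object of `𝒪`, because the quotient by the submodule that they generate has no
nonzero singular vector (`span_hasSpectrumIn`). They are represented by the summand `P` of
`Jet n κ h N` that is cut out by the projection `p(T)` to the spectrum in `S`
(`exists_universal_summand`). Taking the part with spectrum in `S` is exact on `𝒪`, so `P` is a
projective generator, and it has a finite `Δ`-filtration as the image of an idempotent `p(T)`.
-/

namespace RationalCherednik
noncomputable section

/-! ### The reflections of `W` and their parameters -/

theorem W.coe_mul_apply {n d : ℕ} (w w' : W n d) (y : V n) :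
    ((w * w' : W n d) : V n ≃ₗ[ℂ] V n) y = (w : V n ≃ₗ[ℂ] V n) ((w' : V n ≃ₗ[ℂ] V n) y) := rfl

theorem W.coe_one_apply {n d : ℕ} (y : V n) : ((1 : W n d) : V n ≃ₗ[ℂ] V n) y = y := rfl

@[simp]
theorem W.inv_apply_apply {n d : ℕ} (w : W n d) (y : V n) :
    ((w⁻¹ : W n d) : V n ≃ₗ[ℂ] V n) ((w : V n ≃ₗ[ℂ] V n) y) = y := by
  rw [← W.coe_mul_apply, inv_mul_cancel, W.coe_one_apply]

@[simp]
theorem W.apply_inv_apply {n d : ℕ} (w : W n d) (y : V n) :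
    (w : V n ≃ₗ[ℂ] V n) (((w⁻¹ : W n d) : V n ≃ₗ[ℂ] V n) y) = y := by
  rw [← W.coe_mul_apply, mul_inv_cancel, W.coe_one_apply]

theorem dualAct_apply {n d : ℕ} (w : W n d) (ξ : VDual n) (y : V n) :
    dualAct w ξ y = ξ (((w⁻¹ : W n d) : V n ≃ₗ[ℂ] V n) y) := rfl

instance W.finite (n d : ℕ) [NeZero d] : Finite (W n d) := by
  have hfin : Finite {u : ℂˣ // u ^ d = 1} := by
    have : Finite (rootsOfUnity d ℂ) := inferInstance
    exact Finite.of_injective (β := rootsOfUnity d ℂ)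
      (fun u => ⟨u.1, (mem_rootsOfUnity d u.1).2 u.2⟩)
      (fun u v huv => Subtype.ext (by simpa using huv))
  refine Finite.of_surjective
    (fun p : (Fin n → {u : ℂˣ // u ^ d = 1}) × Equiv.Perm (Fin n) =>
      (⟨monomialEquiv (fun k => (p.1 k).1) p.2, _, _, fun k => (p.1 k).2, rfl⟩ : W n d)) ?_
  rintro ⟨_, u, σ, hu, rfl⟩
  exact ⟨(fun k => ⟨u k, hu k⟩, σ), rfl⟩

instance W.fintype (n d : ℕ) [NeZero d] : Fintype (W n d) := Fintype.ofFinite _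

theorem zeta_isPrimitiveRoot (d : ℕ) [NeZero d] : IsPrimitiveRoot (zeta d) d := by
  rw [← IsPrimitiveRoot.coe_units_iff]
  exact Complex.isPrimitiveRoot_exp d (NeZero.ne d)

theorem tRefl_pow_apply {n d : ℕ} [NeZero d] (i : Fin n) (a : ℕ) (y : V n) (j : Fin n) :
    ((tRefl d i ^ a : W n d) : V n ≃ₗ[ℂ] V n) y j =
      if j = i then ((zeta d ^ a : ℂˣ) : ℂ) * y j else y j := by
  induction a generalizing y with
  | zero => simp
  | succ a ih =>
    rw [pow_succ, W.coe_mul_apply, ih]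
    have : ((tRefl d i : W n d) : V n ≃ₗ[ℂ] V n) y j =
        if j = i then (zeta d : ℂ) * y j else y j := by
      have e : ((tRefl d i : W n d) : V n ≃ₗ[ℂ] V n) y j =
          ((Function.update (1 : Fin n → ℂˣ) i (zeta d) j : ℂˣ) : ℂ) * y j := rfl
      rw [e]
      by_cases hj : j = i
      · subst hj; simp
      · simp [hj]
    rw [this]
    split_ifs
    · push_cast; ring
    · rfl

theorem tRefl_pow_inv_apply {n d : ℕ} [NeZero d] (i : Fin n) (a : ℕ) (y : V n) (j : Fin n) :
    (((tRefl d i ^ a)⁻¹ : W n d) : V n ≃ₗ[ℂ] V n) y j =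
      if j = i then (((zeta d ^ a)⁻¹ : ℂˣ) : ℂ) * y j else y j := by
  have := tRefl_pow_apply (d := d) i a ((((tRefl d i ^ a)⁻¹ : W n d) : V n ≃ₗ[ℂ] V n) y) j
  rw [W.apply_inv_apply] at this
  split_ifs at this ⊢ with hj
  · rw [this, ← mul_assoc, Units.inv_mul, one_mul]
  · exact this.symm

/-- The monomial matrix exchanging the lines of `e_i` and `e_j`, for arbitrary `i`, `j` and an
arbitrary unit `θ`; it is `s_{ij;α}` for `i < j` and `θ = ζ^α`. -/
def swapEquiv {n : ℕ} (i j : Fin n) (θ : ℂˣ) : V n ≃ₗ[ℂ] V n :=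
  monomialEquiv (Function.update (Function.update 1 j θ) i θ⁻¹) (Equiv.swap i j)

theorem swapEquiv_comm {n : ℕ} {i j : Fin n} (hij : i ≠ j) (θ : ℂˣ) :
    swapEquiv i j θ = swapEquiv j i θ⁻¹ := by
  rw [swapEquiv, swapEquiv, Function.update_comm hij, Equiv.swap_comm, inv_inv]

theorem swapEquiv_apply {n : ℕ} {i j : Fin n} (hij : i ≠ j) (θ : ℂˣ) (y : V n) :
    swapEquiv i j θ y =
      y - (y i - θ * y j) • (Pi.single i 1 - ((θ⁻¹ : ℂˣ) : ℂ) • Pi.single j 1) := by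
  ext k
  rw [swapEquiv, monomialEquiv_apply]
  by_cases hki : k = i
  · subst hki
    simp [hij, hij.symm]
  · by_cases hkj : k = j
    · subst hkj
      simp [hij]
      ring_nf
      simp
    · simp [Equiv.swap_apply_of_ne_of_ne hki hkj, hki, hkj]

theorem swapEquiv_inv_apply {n : ℕ} {i j : Fin n} (hij : i ≠ j) (θ : ℂˣ) (y : V n) :
    (swapEquiv i j θ)⁻¹ y = swapEquiv i j θ y := by
  have h : swapEquiv i j θ (swapEquiv i j θ y) = y := by
    rw [swapEquiv_apply hij θ y, map_sub, map_smul, swapEquiv_apply hij θ y,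
      swapEquiv_apply hij θ (_ - _)]
    ext k
    simp [hij, hij.symm]
    ring
  exact (LinearEquiv.symm_apply_eq _).2 h.symm

theorem monomialEquiv_mul_swapEquiv {n : ℕ} (v : Fin n → ℂˣ) (σ : Equiv.Perm (Fin n))
    {i j : Fin n} (hij : i ≠ j) (θ : ℂˣ) :
    monomialEquiv v σ * swapEquiv i j θ =
      swapEquiv (σ i) (σ j) (θ * v i * (v j)⁻¹) * monomialEquiv v σ := by
  rw [swapEquiv, swapEquiv, monomialEquiv_mul, monomialEquiv_mul, Equiv.mul_swap_eq_swap_mul]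
  congr 1
  funext k
  by_cases hki : k = i
  · subst hki
    simp [mul_comm, mul_left_comm]
  · by_cases hkj : k = j
    · subst hkj
      simp [hij.symm, mul_comm]
    · simp [Equiv.swap_apply_of_ne_of_ne hki hkj, hki, hkj]

theorem monomialEquiv_mul_tRefl {n d : ℕ} [NeZero d] (v : Fin n → ℂˣ) (σ : Equiv.Perm (Fin n))
    (i : Fin n) :
    monomialEquiv v σ * ((tRefl d i : W n d) : V n ≃ₗ[ℂ] V n) =
      ((tRefl d (σ i) : W n d) : V n ≃ₗ[ℂ] V n) * monomialEquiv v σ := by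
  rw [tRefl, tRefl, monomialEquiv_mul, monomialEquiv_mul, mul_one, one_mul]
  congr 1
  funext k
  by_cases hki : k = i
  · subst hki; simp [mul_comm]
  · simp [hki]

/-- `w` is the `a`-th power of one of the diagonal reflections `t_i`. -/
def IsDiagRefl {n d : ℕ} [NeZero d] (a : ℕ) (w : W n d) : Prop :=
  ∃ i, w = tRefl d i ^ a

/-- `w` is one of the reflections `s_{ij;α}`. -/
def IsSwapRefl {n d : ℕ} [NeZero d] (w : W n d) : Prop :=
  ∃ (p : {p : Fin n × Fin n // p.1 < p.2}) (α : Fin d), w = sRefl d p.1.1 p.1.2 α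

theorem isSwapRefl_iff {n d : ℕ} [NeZero d] (w : W n d) :
    IsSwapRefl w ↔ ∃ (i j : Fin n) (θ : ℂˣ), i ≠ j ∧ θ ^ d = 1 ∧
      (w : V n ≃ₗ[ℂ] V n) = swapEquiv i j θ := by
  have key : ∀ (i j : Fin n) (θ : ℂˣ), i < j → θ ^ d = 1 →
      (w : V n ≃ₗ[ℂ] V n) = swapEquiv i j θ → IsSwapRefl w := by
    intro i j θ hij hθ hw
    obtain ⟨α, hα, hθα⟩ := ((zeta_isPrimitiveRoot d).map_of_injective
      (f := Units.coeHom ℂ) Units.val_injective).eq_pow_of_pow_eq_one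
      (ξ := (θ : ℂ)) (by rw [← Units.val_pow_eq_pow_val, hθ, Units.val_one])
    obtain rfl : zeta d ^ α = θ := Units.ext (by simpa using hθα)
    exact ⟨⟨(i, j), hij⟩, ⟨α, hα⟩, Subtype.ext hw⟩
  constructor
  · rintro ⟨p, α, rfl⟩
    refine ⟨p.1.1, p.1.2, zeta d ^ (α : ℕ), p.2.ne, ?_, rfl⟩
    rw [← pow_mul, mul_comm, pow_mul, zeta_pow, one_pow]
  · rintro ⟨i, j, θ, hij, hθ, hw⟩
    rcases lt_or_gt_of_ne hij with h | h
    · exact key i j θ h hθ hw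
    · exact key j i θ⁻¹ h (by rw [inv_pow, hθ, inv_one]) (by rw [hw, swapEquiv_comm hij])

theorem IsDiagRefl.conj {n d : ℕ} [NeZero d] {a : ℕ} {w : W n d} (hw : IsDiagRefl a w)
    (g : W n d) : IsDiagRefl a (g * w * g⁻¹) := by
  obtain ⟨i, rfl⟩ := hw
  obtain ⟨g, v, σ, hv, rfl⟩ := g
  refine ⟨σ i, ?_⟩
  rw [← conj_pow]
  congr 1
  rw [mul_inv_eq_iff_eq_mul]
  exact Subtype.ext (monomialEquiv_mul_tRefl v σ i)

theorem IsSwapRefl.conj {n d : ℕ} [NeZero d] {w : W n d} (hw : IsSwapRefl w)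
    (g : W n d) : IsSwapRefl (g * w * g⁻¹) := by
  rw [isSwapRefl_iff] at hw ⊢
  obtain ⟨i, j, θ, hij, hθ, hw⟩ := hw
  obtain ⟨g, v, σ, hv, rfl⟩ := g
  refine ⟨σ i, σ j, θ * v i * (v j)⁻¹, σ.injective.ne hij, ?_, ?_⟩
  · rw [mul_pow, mul_pow, inv_pow, hθ, hv, hv]; simp
  · change monomialEquiv v σ * (w : V n ≃ₗ[ℂ] V n) * (monomialEquiv v σ)⁻¹ = _
    rw [mul_inv_eq_iff_eq_mul, hw, monomialEquiv_mul_swapEquiv v σ hij]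

theorem isDiagRefl_conj_iff {n d : ℕ} [NeZero d] (a : ℕ) (g w : W n d) :
    IsDiagRefl a (g * w * g⁻¹) ↔ IsDiagRefl a w := by
  refine ⟨fun h => ?_, fun h => h.conj g⟩
  simpa [mul_assoc] using h.conj g⁻¹

theorem isSwapRefl_conj_iff {n d : ℕ} [NeZero d] (g w : W n d) :
    IsSwapRefl (g * w * g⁻¹) ↔ IsSwapRefl w := by
  refine ⟨fun h => ?_, fun h => h.conj g⟩
  simpa [mul_assoc] using h.conj g⁻¹

variable {R : Type u} [CommRing R] [Algebra ℂ R]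

/-- The coefficient of `t_i^a` in `γ_{H_i}`. -/
def diagCoeff {d : ℕ} (κ : Fin (d - 1) → R) (a : ℕ) : R :=
  ∑ k ∈ Finset.range d, (kappa κ (k + 1) - kappa κ k) *
    algebraMap ℂ R (Complex.exp (2 * Real.pi * Complex.I * a * k / d))

theorem diagCoeff_zero {d : ℕ} [NeZero d] (κ : Fin (d - 1) → R) : diagCoeff κ 0 = 0 := by
  have h := Finset.sum_range_sub (kappa κ) d
  simpa [diagCoeff, kappa] using h

theorem gamma_inl {n d : ℕ} [NeZero d] (κ : Fin (d - 1) → R) (h : R) (i : Fin n) :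
    gamma κ h (Sum.inl i : Hyp n d) =
      ∑ a ∈ Finset.range d, diagCoeff κ a • MonoidAlgebra.of R (W n d) (tRefl d i ^ a) := by
  have hd : (d : ℂ) ≠ 0 := Nat.cast_ne_zero.2 (NeZero.ne d)
  have hdR : (d : R) * algebraMap ℂ R (d : ℂ)⁻¹ = 1 := by
    rw [← map_natCast (algebraMap ℂ R), ← map_mul, mul_inv_cancel₀ hd, map_one]
  simp only [gamma, eps, stabOrder, cParam, stabGen, diagCoeff, Finset.smul_sum, Finset.sum_smul]
  rw [Finset.sum_comm]
  refine Finset.sum_congr rfl fun a _ => Finset.sum_congr rfl fun k _ => ?_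
  rw [smul_smul, smul_smul, map_mul, one_div]
  congr 1
  linear_combination ((kappa κ (k + 1) - kappa κ k) *
    algebraMap ℂ R (Complex.exp (2 * Real.pi * Complex.I * a * k / d))) * hdR

theorem gamma_inr {n d : ℕ} [NeZero d] (κ : Fin (d - 1) → R) (h : R)
    (p : {p : Fin n × Fin n // p.1 < p.2}) (α : Fin d) :
    gamma κ h (Sum.inr (p, α) : Hyp n d) =
      (2 * h) • MonoidAlgebra.of R (W n d) (sRefl d p.1.1 p.1.2 α) := by
  have h1 : Complex.exp (2 * Real.pi * Complex.I / 2) = -1 := by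
    rw [← Complex.exp_pi_mul_I]; congr 1; ring
  have h2 : (algebraMap ℂ R 2⁻¹) * 2 = 1 := by
    rw [← map_ofNat (algebraMap ℂ R) 2, ← map_mul]; simp
  simp only [gamma, eps, stabOrder, cParam, stabGen, Finset.sum_range_succ, Finset.sum_range_zero]
  have h4 : (2 : ℂ)⁻¹ • (2 * h) = h := by
    rw [Algebra.smul_def]
    linear_combination h * h2
  simp [h1]
  rw [h4, two_mul, MonoidAlgebra.single_add]
  abel

/-- The coefficient `b(w)` of the reflection `w` when the commutation relation of the Cherednik
algebra is written `[y, ξ] = ⟨ξ, y⟩ + ∑_w b(w) ⟨ξ, y - w⁻¹ y⟩ w`. The power `t_i^a`, with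
`0 < a < d`, rescales `⟨ξ, v_H⟩⟨α_H, y⟩ / ⟨α_H, v_H⟩` by `1 - ζ^{-a}`, whence the denominator. -/
def reflCoeff {n d : ℕ} [NeZero d] (κ : Fin (d - 1) → R) (h : R) (w : W n d) : R :=
  open Classical in
  (∑ a ∈ Finset.Ico 1 d, if IsDiagRefl a w then
      algebraMap ℂ R (1 - (((zeta d ^ a)⁻¹ : ℂˣ) : ℂ))⁻¹ * diagCoeff κ a else 0) +
    if IsSwapRefl w then h else 0

/-- `b` is a class function. -/
theorem reflCoeff_conj {n d : ℕ} [NeZero d] (κ : Fin (d - 1) → R) (h : R) (g w : W n d) :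
    reflCoeff κ h (g * w * g⁻¹) = reflCoeff κ h w := by
  classical
  unfold reflCoeff
  exact congrArg₂ (· + ·) (Finset.sum_congr rfl fun a _ =>
    if_congr (isDiagRefl_conj_iff a g w) rfl rfl) (if_congr (isSwapRefl_conj_iff g w) rfl rfl)

/-- `b` is supported on reflections: `1 - w` has rank at most one if `b(w) ≠ 0`. -/
theorem exists_rank_one_of_reflCoeff_ne_zero {n d : ℕ} [NeZero d] {κ : Fin (d - 1) → R} {h : R}
    {w : W n d} (hw : reflCoeff κ h w ≠ 0) :
    ∃ (β : VDual n) (v : V n), ∀ y, y - (w : V n ≃ₗ[ℂ] V n) y = β y • v := by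
  by_cases hS : IsSwapRefl w
  · obtain ⟨i, j, θ, hij, -, hθ⟩ := (isSwapRefl_iff w).1 hS
    refine ⟨coord i - (θ : ℂ) • coord j,
      Pi.single i 1 - ((θ⁻¹ : ℂˣ) : ℂ) • Pi.single j 1, fun y => ?_⟩
    rw [hθ, swapEquiv_apply hij, sub_sub_cancel]
    rfl
  · by_cases hT : ∃ a, IsDiagRefl a w
    · obtain ⟨a, i, rfl⟩ := hT
      refine ⟨(1 - ((zeta d ^ a : ℂˣ) : ℂ)) • coord i, Pi.single i 1, fun y => ?_⟩
      ext j
      simp only [Pi.sub_apply, tRefl_pow_apply, LinearMap.smul_apply, coord, LinearMap.proj_apply,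
        Pi.smul_apply]
      by_cases hj : j = i
      · subst hj; simp; ring
      · simp [hj]
    · refine absurd ?_ hw
      push Not at hT
      simp [reflCoeff, hS, hT]

theorem sum_ite_range {ι α M : Type*} [Fintype ι] [Fintype α] [AddCommMonoid M] {f : ι → α}
    (hf : Function.Injective f) (F : α → M) (p : α → Prop) [DecidablePred p]
    (hp : ∀ w, p w ↔ ∃ i, w = f i) :
    ∑ w, (if p w then F w else 0) = ∑ i, F (f i) := by
  classical
  rw [← Finset.sum_filter, ← Finset.sum_image (f := F) hf.injOn]
  congr 1
  ext w
  simp [hp, eq_comm]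

theorem monomialEquiv_injective {n : ℕ} {u v : Fin n → ℂˣ} {σ τ : Equiv.Perm (Fin n)}
    (huv : monomialEquiv u σ = monomialEquiv v τ) : u = v ∧ σ = τ := by
  have key : ∀ k, u k = v k ∧ σ k = τ k := by
    intro k
    have h1 := congrArg (fun g : V n ≃ₗ[ℂ] V n => g (Pi.single k 1) (σ k)) huv
    simp only [monomialEquiv_single] at h1
    have h2 : σ k = τ k := by
      by_contra hne
      simp [hne] at h1
    refine ⟨Units.ext ?_, h2⟩
    simpa [h2] using h1
  exact ⟨funext fun k => (key k).1, Equiv.ext fun k => (key k).2⟩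

theorem tRefl_pow_injective {n d : ℕ} [NeZero d] {a : ℕ} (ha : a ∈ Finset.Ico 1 d) :
    Function.Injective fun i : Fin n => (tRefl d i ^ a : W n d) := by
  intro i j hij
  rw [Finset.mem_Ico] at ha
  by_contra hne
  have h1 := congrArg (fun g : W n d => (g : V n ≃ₗ[ℂ] V n) (Pi.single i 1) i) hij
  simp only [tRefl_pow_apply, if_neg hne] at h1
  refine (zeta_isPrimitiveRoot d).pow_ne_one_of_pos_of_lt (by omega) ha.2 (Units.ext ?_)
  simpa using h1

theorem sRefl_injective {n d : ℕ} [NeZero d] :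
    Function.Injective fun q : {p : Fin n × Fin n // p.1 < p.2} × Fin d =>
      (sRefl d q.1.1.1 q.1.1.2 q.2 : W n d) := by
  rintro ⟨⟨⟨i, j⟩, hij⟩, α⟩ ⟨⟨⟨i', j'⟩, hij'⟩, α'⟩ heq
  have h0 := congrArg (fun g : W n d => (g : V n ≃ₗ[ℂ] V n)) heq
  obtain ⟨hu, hσ⟩ := monomialEquiv_injective h0
  simp only at hij hij' hu hσ
  have h1 : Equiv.swap i' j' i = j := by rw [← hσ, Equiv.swap_apply_left]
  obtain rfl : i' = i := by
    by_contra hne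
    by_cases hj : i = j'
    · subst hj
      rw [Equiv.swap_apply_right] at h1
      subst h1
      exact lt_asymm hij hij'
    · rw [Equiv.swap_apply_of_ne_of_ne (Ne.symm hne) hj] at h1
      exact hij.ne h1
  rw [Equiv.swap_apply_left] at h1
  subst h1
  have h2 := congrFun hu i'
  simp only [Function.update_self, inv_inj] at h2
  have h3 := (zeta_isPrimitiveRoot d).pow_inj α.2 α'.2 h2
  simp [Fin.ext_iff, h3]

/-- The right-hand side of the commutation relation of `y` and `ξ`, rewritten as a sum over
`W` with the coefficients `b(w)`. -/
theorem sum_gamma_eq {n d : ℕ} [NeZero d] (κ : Fin (d - 1) → R) (h : R) (y : V n) (ξ : VDual n) :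
    ∑ H : Hyp n d, algebraMap ℂ R (ξ (coroot H) * root H y / root H (coroot H)) • gamma κ h H =
      ∑ w : W n d, (reflCoeff κ h w *
        algebraMap ℂ R (ξ (y - ((w⁻¹ : W n d) : V n ≃ₗ[ℂ] V n) y))) •
          MonoidAlgebra.of R (W n d) w := by
  classical
  simp only [reflCoeff, add_mul, add_smul, Finset.sum_add_distrib]
  rw [Fintype.sum_sum_type]
  congr 1
  · simp only [Finset.sum_mul, Finset.sum_smul]
    rw [Finset.sum_comm]
    have h1 : ∀ i : Fin n, gamma κ h (Sum.inl i : Hyp n d) = ∑ a ∈ Finset.Ico 1 d,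
        diagCoeff κ a • MonoidAlgebra.of R (W n d) (tRefl d i ^ a) := by
      intro i
      rw [gamma_inl, Finset.range_eq_Ico,
        Finset.sum_eq_sum_Ico_succ_bot (Nat.pos_of_ne_zero (NeZero.ne d)), diagCoeff_zero,
          zero_smul,
        zero_add]
    simp only [h1, Finset.smul_sum]
    rw [Finset.sum_comm]
    refine Finset.sum_congr rfl fun a ha => ?_
    simp only [ite_mul, zero_mul, ite_smul, zero_smul]
    rw [sum_ite_range (tRefl_pow_injective ha) _ (IsDiagRefl a) fun w => Iff.rfl]
    refine Finset.sum_congr rfl fun i _ => ?_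
    rw [smul_smul]
    congr 1
    have hy : y - (((tRefl d i ^ a)⁻¹ : W n d) : V n ≃ₗ[ℂ] V n) y =
        ((1 - (((zeta d ^ a)⁻¹ : ℂˣ) : ℂ)) * y i) • Pi.single i 1 := by
      ext j
      simp only [Pi.sub_apply, tRefl_pow_inv_apply, Pi.smul_apply]
      by_cases hj : j = i
      · subst hj; simp; ring
      · simp [hj]
    have hne : (1 - (((zeta d ^ a)⁻¹ : ℂˣ) : ℂ)) ≠ 0 := by
      rw [Finset.mem_Ico] at ha
      refine sub_ne_zero.2 fun h0 => ?_
      refine (zeta_isPrimitiveRoot d).pow_ne_one_of_pos_of_lt (by omega) ha.2 (Units.ext ?_)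
      rw [Units.val_inv_eq_inv_val, eq_comm, inv_eq_one] at h0
      exact h0
    have e1 : ξ (coroot (Sum.inl i : Hyp n d)) * root (Sum.inl i : Hyp n d) y /
        root (Sum.inl i : Hyp n d) (coroot (Sum.inl i : Hyp n d)) =
        (1 - (((zeta d ^ a)⁻¹ : ℂˣ) : ℂ))⁻¹ *
          (((1 - (((zeta d ^ a)⁻¹ : ℂˣ) : ℂ)) * y i) • ξ (Pi.single i 1)) := by
      rw [smul_eq_mul, mul_assoc, inv_mul_cancel_left₀ hne]
      simp [coroot, root, coord, mul_comm]
    rw [hy, map_smul, e1, map_mul]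
    ring
  · simp only [ite_mul, zero_mul, ite_smul, zero_smul]
    rw [sum_ite_range sRefl_injective _ IsSwapRefl fun w => by simp only [IsSwapRefl, Prod.exists]]
    refine Finset.sum_congr rfl fun q _ => ?_
    obtain ⟨p, α⟩ := q
    have hp := p.2.ne
    rw [gamma_inr, smul_smul]
    congr 1
    have hy : (((sRefl d p.1.1 p.1.2 α)⁻¹ : W n d) : V n ≃ₗ[ℂ] V n) y =
        swapEquiv p.1.1 p.1.2 (zeta d ^ (α : ℕ)) y := by
      rw [← swapEquiv_inv_apply hp]; rfl
    have hroot : root (Sum.inr (p, α) : Hyp n d) (coroot (Sum.inr (p, α) : Hyp n d)) = 2 := by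
      simp [root, coroot, coord, hp, hp.symm]
      norm_num
    have h2 : (algebraMap ℂ R 2⁻¹) * 2 = 1 := by
      rw [← map_ofNat (algebraMap ℂ R) 2, ← map_mul]; simp
    rw [hy, swapEquiv_apply hp, sub_sub_cancel, map_smul, hroot, div_eq_mul_inv, map_mul]
    have h3 : ξ (coroot (Sum.inr (p, α) : Hyp n d)) * root (Sum.inr (p, α) : Hyp n d) y =
        (y p.1.1 - ((zeta d ^ (α : ℕ) : ℂˣ) : ℂ) * y p.1.2) •
          ξ (Pi.single p.1.1 1 - (((zeta d ^ (α : ℕ))⁻¹ : ℂˣ) : ℂ) • Pi.single p.1.2 1) :=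
      mul_comm _ _
    rw [h3]
    linear_combination (h * algebraMap ℂ R ((y p.1.1 - ((zeta d ^ (α : ℕ) : ℂˣ) : ℂ) * y p.1.2) •
          ξ (Pi.single p.1.1 1 - (((zeta d ^ (α : ℕ))⁻¹ : ℂˣ) : ℂ) • Pi.single p.1.2 1))) * h2

end
end RationalCherednik

namespace RationalCherednik
noncomputable section

/-! ### Presentation of the Cherednik algebra by class functions -/

namespace Cherednik

variable {R : Type u} [CommRing R] [Algebra ℂ R]
variable {n d : ℕ} [NeZero d] (κ : Fin (d - 1) → R) (h : R)

theorem mk_smash_rel {a b : FreeAlgebra R (Gen n d)} (hab : SmashRel n d R a b) :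
    mk κ h (Smash.mk n d R a) = mk κ h (Smash.mk n d R b) := by
  rw [Smash.mk_rel hab]

theorem mk_rel {a b : Smash n d R} (hab : CherednikRel κ h a b) : mk κ h a = mk κ h b :=
  RingQuot.mkAlgHom_rel R hab

theorem vec_add (y y' : V n) : vec (d := d) κ h (y + y') = vec κ h y + vec κ h y' := by
  simpa [vec, Smash.gen] using mk_smash_rel κ h (SmashRel.vec_add y y')

theorem vec_smul (c : ℂ) (y : V n) : vec (d := d) κ h (c • y) = algebraMap ℂ R c • vec κ h y := by
  have := mk_smash_rel κ h (SmashRel.vec_smul (d := d) c y)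
  rwa [map_smul, map_smul] at this

theorem cov_add (ξ ξ' : VDual n) : cov (d := d) κ h (ξ + ξ') = cov κ h ξ + cov κ h ξ' := by
  simpa [cov, Smash.gen] using mk_smash_rel κ h (SmashRel.cov_add ξ ξ')

theorem cov_smul (c : ℂ) (ξ : VDual n) :
    cov (d := d) κ h (c • ξ) = algebraMap ℂ R c • cov κ h ξ := by
  have := mk_smash_rel κ h (SmashRel.cov_smul (d := d) c ξ)
  rwa [map_smul, map_smul] at this

theorem grp_one : grp (n := n) κ h 1 = 1 := by
  simpa [grp, Smash.gen] using mk_smash_rel κ h (SmashRel.grp_one (n := n))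

theorem grp_mul (w w' : W n d) : grp κ h (w * w') = grp κ h w * grp κ h w' := by
  simpa [grp, Smash.gen] using mk_smash_rel κ h (SmashRel.grp_mul w w')

theorem grp_inv_mul_grp (w : W n d) : grp κ h w⁻¹ * grp κ h w = 1 := by
  rw [← grp_mul, inv_mul_cancel, grp_one]

theorem grp_mul_vec (w : W n d) (y : V n) :
    grp κ h w * vec κ h y = vec κ h ((w : V n ≃ₗ[ℂ] V n) y) * grp κ h w := by
  have := mk_smash_rel κ h (SmashRel.grp_vec w y)
  simp only [map_mul] at this
  change grp κ h w * vec κ h y * grp κ h w⁻¹ = vec κ h _ at this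
  rw [← this, mul_assoc _ (grp κ h w⁻¹), grp_inv_mul_grp, mul_one]

theorem grp_mul_cov (w : W n d) (ξ : VDual n) :
    grp κ h w * cov κ h ξ = cov κ h (dualAct w ξ) * grp κ h w := by
  have := mk_smash_rel κ h (SmashRel.grp_cov w ξ)
  simp only [map_mul] at this
  change grp κ h w * cov κ h ξ * grp κ h w⁻¹ = cov κ h _ at this
  rw [← this, mul_assoc _ (grp κ h w⁻¹), grp_inv_mul_grp, mul_one]

theorem vec_comm (y y' : V n) : vec (d := d) κ h y * vec κ h y' = vec κ h y' * vec κ h y := by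
  rw [← sub_eq_zero]
  simpa [vec] using mk_rel κ h (CherednikRel.vec_vec y y')

theorem cov_comm (ξ ξ' : VDual n) : cov (d := d) κ h ξ * cov κ h ξ' = cov κ h ξ' * cov κ h ξ := by
  rw [← sub_eq_zero]
  simpa [cov] using mk_rel κ h (CherednikRel.cov_cov ξ ξ')

theorem mk_ofGroupAlgebra_of (w : W n d) :
    mk κ h (Smash.ofGroupAlgebra n d R (MonoidAlgebra.of R (W n d) w)) = grp κ h w := by
  rw [Smash.ofGroupAlgebra, MonoidAlgebra.lift_of]
  rfl

/-- The defining commutation relation of `y` and `ξ` in terms of the class function `b`. -/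
theorem vec_mul_cov (y : V n) (ξ : VDual n) :
    vec κ h y * cov κ h ξ = cov κ h ξ * vec κ h y + (algebraMap R _ (algebraMap ℂ R (ξ y)) +
      ∑ w : W n d, (reflCoeff κ h w *
        algebraMap ℂ R (ξ (y - ((w⁻¹ : W n d) : V n ≃ₗ[ℂ] V n) y))) • grp κ h w) := by
  have h1 := mk_rel κ h (CherednikRel.vec_cov (n := n) (d := d) y ξ)
  simp only [← map_smul, ← map_sum, sum_gamma_eq] at h1
  rw [map_sub] at h1
  simp only [map_mul (mk κ h), map_add (mk κ h), map_sum, map_smul, mk_ofGroupAlgebra_of,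
    AlgHom.commutes] at h1
  rw [← h1]
  simp [vec, cov]

/-- To verify a statement closed under the ring operations for all elements of the Cherednik
algebra, it suffices to verify it on scalars and on the generators `y`, `ξ`, `w`. -/
theorem induction {p : Cherednik n κ h → Prop} (hR : ∀ r : R, p (algebraMap R _ r))
    (hvec : ∀ y, p (vec κ h y)) (hcov : ∀ ξ, p (cov κ h ξ)) (hgrp : ∀ w, p (grp κ h w))
    (hadd : ∀ a b, p a → p b → p (a + b)) (hmul : ∀ a b, p a → p b → p (a * b))
    (a : Cherednik n κ h) : p a := by
  obtain ⟨a, rfl⟩ := RingQuot.mkAlgHom_surjective R (CherednikRel (n := n) κ h) a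
  obtain ⟨a, rfl⟩ := RingQuot.mkAlgHom_surjective R (SmashRel n d R) a
  change p (mk κ h (Smash.mk n d R a))
  induction a using FreeAlgebra.induction with
  | grade0 r => simpa using hR r
  | grade1 g =>
    cases g with
    | vec y => exact hvec y
    | cov ξ => exact hcov ξ
    | grp w => exact hgrp w
  | mul a b ha hb => rw [map_mul, map_mul]; exact hmul _ _ ha hb
  | add a b ha hb => rw [map_add, map_add]; exact hadd _ _ ha hb

/-- Operators satisfying the relations of the Cherednik algebra define a homomorphism. -/
theorem exists_lift {A : Type*} [Ring A] [Algebra R A] (v : V n → A) (c : VDual n → A)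
    (g : W n d → A)
    (hva : ∀ y y', v (y + y') = v y + v y')
    (hvs : ∀ (r : ℂ) y, v (r • y) = algebraMap ℂ R r • v y)
    (hca : ∀ ξ ξ', c (ξ + ξ') = c ξ + c ξ')
    (hcs : ∀ (r : ℂ) ξ, c (r • ξ) = algebraMap ℂ R r • c ξ)
    (hg1 : g 1 = 1) (hgm : ∀ w w', g (w * w') = g w * g w')
    (hgv : ∀ w y, g w * v y = v ((w : V n ≃ₗ[ℂ] V n) y) * g w)
    (hgc : ∀ w ξ, g w * c ξ = c (dualAct w ξ) * g w)
    (hvv : ∀ y y', v y * v y' = v y' * v y)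
    (hcc : ∀ ξ ξ', c ξ * c ξ' = c ξ' * c ξ)
    (hvc : ∀ y ξ, v y * c ξ = c ξ * v y + (algebraMap R A (algebraMap ℂ R (ξ y)) +
      ∑ w : W n d, (reflCoeff κ h w *
        algebraMap ℂ R (ξ (y - ((w⁻¹ : W n d) : V n ≃ₗ[ℂ] V n) y))) • g w)) :
    ∃ F : Cherednik n κ h →ₐ[R] A, (∀ y, F (vec κ h y) = v y) ∧ (∀ ξ, F (cov κ h ξ) = c ξ) ∧
      ∀ w, F (grp κ h w) = g w := by
  let f0 : FreeAlgebra R (Gen n d) →ₐ[R] A := FreeAlgebra.lift R fun x =>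
    match x with
    | Gen.vec y => v y
    | Gen.cov ξ => c ξ
    | Gen.grp w => g w
  have f0v : ∀ y, f0 (FreeAlgebra.ι R (Gen.vec y)) = v y := fun y => FreeAlgebra.lift_ι_apply _ _
  have f0c : ∀ y, f0 (FreeAlgebra.ι R (Gen.cov y)) = c y := fun y => FreeAlgebra.lift_ι_apply _ _
  have f0g : ∀ y, f0 (FreeAlgebra.ι R (Gen.grp y)) = g y := fun y => FreeAlgebra.lift_ι_apply _ _
  have hgi : ∀ w, g w * g w⁻¹ = 1 := fun w => by rw [← hgm, mul_inv_cancel, hg1]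
  have hf0 : ∀ ⦃a b⦄, SmashRel n d R a b → f0 a = f0 b := by
    intro a b hab
    cases hab with
    | vec_add y y' => simp [f0v, hva]
    | vec_smul r y => rw [map_smul, f0v, f0v, hvs]
    | cov_add y y' => simp [f0c, hca]
    | cov_smul r y => rw [map_smul, f0c, f0c, hcs]
    | grp_one => simp [f0g, hg1]
    | grp_mul w w' => simp [f0g, hgm]
    | grp_vec w y =>
      rw [map_mul, map_mul, f0g, f0v, f0g, f0v, hgv, mul_assoc, hgi, mul_one]
    | grp_cov w y =>
      rw [map_mul, map_mul, f0g, f0c, f0g, f0c, hgc, mul_assoc, hgi, mul_one]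
  let f1 : Smash n d R →ₐ[R] A := RingQuot.liftAlgHom R ⟨f0, hf0⟩
  have f1g : ∀ x, f1 (Smash.gen n d R x) = f0 (FreeAlgebra.ι R x) := fun x =>
    RingQuot.liftAlgHom_mkAlgHom_apply _ _ _ _
  have f1o : ∀ w, f1 (Smash.ofGroupAlgebra n d R (MonoidAlgebra.of R (W n d) w)) = g w := by
    intro w
    rw [Smash.ofGroupAlgebra, MonoidAlgebra.lift_of]
    exact (f1g _).trans (f0g w)
  have hf1 : ∀ ⦃a b⦄, CherednikRel κ h a b → f1 a = f1 b := by
    intro a b hab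
    cases hab with
    | vec_cov y ξ =>
      simp only [← map_smul, ← map_sum, sum_gamma_eq]
      rw [map_sub]
      simp only [map_mul f1, map_add f1, map_sum, map_smul, f1o, f1g, f0v, f0c,
        AlgHom.commutes]
      rw [hvc, add_sub_cancel_left]
    | vec_vec y y' => simp [f1g, f0v, hvv y y']
    | cov_cov y y' => simp [f1g, f0c, hcc y y']
  refine ⟨RingQuot.liftAlgHom R ⟨f1, hf1⟩, fun y => ?_, fun y => ?_, fun y => ?_⟩
  · exact (RingQuot.liftAlgHom_mkAlgHom_apply _ _ _ _).trans ((f1g _).trans (f0v y))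
  · exact (RingQuot.liftAlgHom_mkAlgHom_apply _ _ _ _).trans ((f1g _).trans (f0c y))
  · exact (RingQuot.liftAlgHom_mkAlgHom_apply _ _ _ _).trans ((f1g _).trans (f0g y))

/-! ### The Euler element -/

/-- The Euler element `eu = ∑_i x_i e_i + ∑_w b(w) w`. -/
def euler (n : ℕ) {d : ℕ} [NeZero d] (κ : Fin (d - 1) → R) (h : R) : Cherednik n κ h :=
  ∑ i : Fin n, cov κ h (coord i) * vec κ h (Pi.single i 1) +
    ∑ w : W n d, reflCoeff κ h w • grp κ h w

theorem vec_sum {ι : Type*} (s : Finset ι) (f : ι → V n) :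
    vec (d := d) κ h (∑ i ∈ s, f i) = ∑ i ∈ s, vec κ h (f i) :=
  map_sum (AddMonoidHom.mk' (vec (d := d) κ h) (vec_add κ h)) f s

theorem cov_sum {ι : Type*} (s : Finset ι) (f : ι → VDual n) :
    cov (d := d) κ h (∑ i ∈ s, f i) = ∑ i ∈ s, cov κ h (f i) :=
  map_sum (AddMonoidHom.mk' (cov (d := d) κ h) (cov_add κ h)) f s

theorem vec_sub (y y' : V n) : vec (d := d) κ h (y - y') = vec κ h y - vec κ h y' :=
  map_sub (AddMonoidHom.mk' (vec (d := d) κ h) (vec_add κ h)) y y'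

theorem eq_sum_single {n : ℕ} (y : V n) : y = ∑ i, y i • (Pi.single i 1 : V n) := by
  ext j; simp [Finset.sum_apply, Pi.single_apply]

theorem dual_eq_sum_coord {n : ℕ} (ξ : VDual n) : ξ = ∑ i, ξ (Pi.single i 1) • coord i := by
  ext j; simp [coord, Pi.single_apply]

theorem vec_eq_sum (y : V n) :
    vec (d := d) κ h y = ∑ i, algebraMap ℂ R (y i) • vec κ h (Pi.single i 1) := by
  conv_lhs => rw [eq_sum_single y, vec_sum]
  simp only [vec_smul]

theorem cov_eq_sum (ξ : VDual n) :
    cov (d := d) κ h ξ = ∑ i, algebraMap ℂ R (ξ (Pi.single i 1)) • cov κ h (coord i) := by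
  conv_lhs => rw [dual_eq_sum_coord ξ, cov_sum]
  simp only [cov_smul]

/-- `[eu, y] = -y`. -/
theorem euler_mul_vec (y : V n) :
    (euler n κ h + 1) * vec κ h y = vec κ h y * euler n κ h := by
  have h1 : ∀ i : Fin n, vec κ h y * (cov κ h (coord i) * vec κ h (Pi.single i 1)) =
      cov κ h (coord i) * vec κ h (Pi.single i 1) * vec κ h y +
        algebraMap ℂ R (y i) • vec κ h (Pi.single i 1) +
        ∑ w : W n d, (reflCoeff κ h w * algebraMap ℂ R
          ((y - ((w⁻¹ : W n d) : V n ≃ₗ[ℂ] V n) y) i)) •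
            (grp κ h w * vec κ h (Pi.single i 1)) := by
    intro i
    rw [← mul_assoc, vec_mul_cov, add_mul, add_mul, mul_assoc, vec_comm κ h y, ← mul_assoc,
      ← Algebra.smul_def, Finset.sum_mul, add_assoc]
    simp only [smul_mul_assoc]
    rfl
  have h2 : ∀ w : W n d, vec κ h y * (reflCoeff κ h w • grp κ h w) =
      (reflCoeff κ h w • grp κ h w) * vec κ h y -
        reflCoeff κ h w • (grp κ h w * vec κ h (y - ((w⁻¹ : W n d) : V n ≃ₗ[ℂ] V n) y)) := by
    intro w
    rw [vec_sub, mul_sub, grp_mul_vec κ h w (((w⁻¹ : W n d) : V n ≃ₗ[ℂ] V n) y),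
      W.apply_inv_apply, smul_sub, smul_mul_assoc, sub_sub_cancel, mul_smul_comm]
  have h3 : ∑ i : Fin n, ∑ w : W n d, (reflCoeff κ h w * algebraMap ℂ R
          ((y - ((w⁻¹ : W n d) : V n ≃ₗ[ℂ] V n) y) i)) •
            (grp κ h w * vec κ h (Pi.single i 1)) =
      ∑ w : W n d, reflCoeff κ h w •
        (grp κ h w * vec κ h (y - ((w⁻¹ : W n d) : V n ≃ₗ[ℂ] V n) y)) := by
    rw [Finset.sum_comm]
    refine Finset.sum_congr rfl fun w _ => ?_
    rw [vec_eq_sum κ h (y - _), Finset.mul_sum, Finset.smul_sum]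
    simp only [mul_smul_comm, smul_smul]
  rw [euler, mul_add, Finset.mul_sum, Finset.mul_sum]
  simp only [h1, h2, Finset.sum_add_distrib, Finset.sum_sub_distrib, h3]
  rw [← vec_eq_sum, add_mul, add_mul, Finset.sum_mul, Finset.sum_mul, one_mul]
  abel

/-- `eu` commutes with `W`. -/
theorem euler_mul_grp (g : W n d) :
    euler n κ h * grp κ h g = grp κ h g * euler n κ h := by
  have h1 : grp κ h g * ∑ i : Fin n, cov κ h (coord i) * vec κ h (Pi.single i 1) =
      (∑ i : Fin n, cov κ h (coord i) * vec κ h (Pi.single i 1)) * grp κ h g := by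
    have h2 : ∀ i : Fin n, grp κ h g * (cov κ h (coord i) * vec κ h (Pi.single i 1)) =
        ∑ j : Fin n, algebraMap ℂ R (dualAct g (coord i) (Pi.single j 1)) •
          (cov κ h (coord j) * vec κ h ((g : V n ≃ₗ[ℂ] V n) (Pi.single i 1)) * grp κ h g) := by
      intro i
      rw [← mul_assoc, grp_mul_cov, mul_assoc, grp_mul_vec, ← mul_assoc,
        cov_eq_sum κ h (dualAct _ _),
        Finset.sum_mul, Finset.sum_mul]
      simp only [smul_mul_assoc]
    have h3 : ∀ j : Fin n, ∑ i : Fin n, algebraMap ℂ R (dualAct g (coord i) (Pi.single j 1)) •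
          vec κ h ((g : V n ≃ₗ[ℂ] V n) (Pi.single i 1)) = vec κ h (Pi.single j 1) := by
      intro j
      simp only [← vec_smul, ← vec_sum, ← map_smul, ← map_sum]
      congr 1
      conv_rhs => rw [← W.apply_inv_apply g (Pi.single j 1)]
      congr 1
      exact (eq_sum_single _).symm
    rw [Finset.mul_sum, Finset.sum_mul, Finset.sum_congr rfl fun i _ => h2 i, Finset.sum_comm]
    refine Finset.sum_congr rfl fun j _ => ?_
    rw [← h3 j, Finset.mul_sum, Finset.sum_mul]
    simp only [mul_smul_comm, smul_mul_assoc]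
  have h4 : grp κ h g * ∑ w : W n d, reflCoeff κ h w • grp κ h w =
      (∑ w : W n d, reflCoeff κ h w • grp κ h w) * grp κ h g := by
    rw [Finset.mul_sum, Finset.sum_mul]
    refine Fintype.sum_equiv (MulAut.conj g).toEquiv _ _ fun w => ?_
    have : (MulAut.conj g).toEquiv w = g * w * g⁻¹ := rfl
    rw [this, reflCoeff_conj, mul_smul_comm, smul_mul_assoc, ← grp_mul, ← grp_mul,
      inv_mul_cancel_right]
  rw [euler, mul_add, add_mul, h1, h4]

end Cherednik

end
end RationalCherednik

namespace RationalCherednik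
noncomputable section

open TensorProduct

/-! ### Polynomial functions on `V` and divided differences -/

/-- The algebra `S(V*)` of polynomial functions on `V`, with the variable `X i` for `x_i`. -/
abbrev Poly (n : ℕ) : Type := MvPolynomial (Fin n) ℂ

/-- The inclusion `V* ⊆ S(V*)`. -/
def covPoly {n : ℕ} : VDual n →ₗ[ℂ] Poly n :=
  ∑ i, (LinearMap.applyₗ (Pi.single i 1 : V n)).smulRight (MvPolynomial.X i)

theorem covPoly_apply {n : ℕ} (ξ : VDual n) :
    covPoly ξ = ∑ i, ξ (Pi.single i 1) • (MvPolynomial.X i : Poly n) := by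
  simp [covPoly]

theorem covPoly_coord {n : ℕ} (i : Fin n) : covPoly (coord i) = MvPolynomial.X i := by
  simp [covPoly_apply, coord, Pi.single_apply]

theorem covPoly_ne_zero {n : ℕ} {ξ : VDual n} (hξ : ξ ≠ 0) : covPoly ξ ≠ 0 := by
  intro h0
  refine hξ (LinearMap.pi_ext' fun i => LinearMap.ext_ring ?_)
  have h1 := congrArg (MvPolynomial.aeval (R := ℂ) (Pi.single i 1 : Fin n → ℂ)) h0
  simpa [covPoly_apply, Pi.single_apply] using h1

/-- The action of `W` on `S(V*)` by algebra automorphisms. -/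
def polyAct {n d : ℕ} (w : W n d) : Poly n →ₐ[ℂ] Poly n :=
  MvPolynomial.aeval fun i => covPoly (dualAct w (coord i))

theorem dualAct_add {n d : ℕ} (w : W n d) (ξ ξ' : VDual n) :
    dualAct w (ξ + ξ') = dualAct w ξ + dualAct w ξ' := rfl

theorem dualAct_smul {n d : ℕ} (w : W n d) (c : ℂ) (ξ : VDual n) :
    dualAct w (c • ξ) = c • dualAct w ξ := rfl

theorem dualAct_sum {n d : ℕ} (w : W n d) {ι : Type*} (s : Finset ι) (f : ι → VDual n) :
    dualAct w (∑ i ∈ s, f i) = ∑ i ∈ s, dualAct w (f i) :=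
  map_sum (AddMonoidHom.mk' (dualAct w) (dualAct_add w)) f s

theorem dualAct_mul {n d : ℕ} (w w' : W n d) (ξ : VDual n) :
    dualAct (w * w') ξ = dualAct w (dualAct w' ξ) := by
  ext i
  simp only [LinearMap.comp_apply, dualAct_apply, mul_inv_rev, W.coe_mul_apply]

theorem dualAct_one {n d : ℕ} (ξ : VDual n) : dualAct (1 : W n d) ξ = ξ := by
  ext i
  simp only [LinearMap.comp_apply, dualAct_apply, inv_one, W.coe_one_apply]

theorem polyAct_covPoly {n d : ℕ} (w : W n d) (ξ : VDual n) :
    polyAct w (covPoly ξ) = covPoly (dualAct w ξ) := by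
  conv_rhs => rw [Cherednik.dual_eq_sum_coord ξ, dualAct_sum, map_sum]
  rw [covPoly_apply, map_sum]
  refine Finset.sum_congr rfl fun i _ => ?_
  rw [map_smul, dualAct_smul, map_smul, polyAct, MvPolynomial.aeval_X]

theorem polyAct_one {n d : ℕ} (f : Poly n) : polyAct (1 : W n d) f = f := by
  have : polyAct (1 : W n d) = AlgHom.id ℂ (Poly n) := by
    refine MvPolynomial.algHom_ext fun i => ?_
    rw [← covPoly_coord, polyAct_covPoly, dualAct_one]; rfl
  rw [this]; rfl

theorem polyAct_mul {n d : ℕ} (w w' : W n d) (f : Poly n) :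
    polyAct (w * w') f = polyAct w (polyAct w' f) := by
  have : polyAct (w * w') = (polyAct w).comp (polyAct w') := by
    refine MvPolynomial.algHom_ext fun i => ?_
    rw [AlgHom.comp_apply, ← covPoly_coord, polyAct_covPoly, polyAct_covPoly, polyAct_covPoly,
      dualAct_mul]
  rw [this]; rfl

theorem dvd_sub_polyAct {n d : ℕ} (w : W n d) (L : Poly n)
    (hL : ∀ ξ : VDual n, L ∣ covPoly ξ - covPoly (dualAct w ξ)) (f : Poly n) :
    L ∣ f - polyAct w f := by
  have h1 : (Ideal.Quotient.mkₐ ℂ (Ideal.span {L})) =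
      (Ideal.Quotient.mkₐ ℂ (Ideal.span {L})).comp (polyAct w) := by
    refine MvPolynomial.algHom_ext fun i => ?_
    rw [AlgHom.comp_apply, ← covPoly_coord, polyAct_covPoly]
    exact Ideal.Quotient.eq.2 (Ideal.mem_span_singleton.2 (hL _))
  exact Ideal.mem_span_singleton.1 (Ideal.Quotient.eq.1 (DFunLike.congr_fun h1 f))

/-- `T` is a divided difference operator for `w` in the direction `y`: a twisted derivation
of `S(V*)` with `T(ξ) = ⟨ξ, y - w⁻¹ y⟩`. -/
def IsDividedDiff {n d : ℕ} (w : W n d) (y : V n) (T : Module.End ℂ (Poly n)) : Prop :=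
  T 1 = 0 ∧ ∀ (ξ : VDual n) (f : Poly n), T (covPoly ξ * f) =
    covPoly ξ * T f + ξ (y - ((w⁻¹ : W n d) : V n ≃ₗ[ℂ] V n) y) • polyAct w f

/-- If `1 - w` has rank at most one, then `f - w(f)` is divisible by the linear form `β` that
cuts out the fixed space, and `f ↦ β(y) (f - w(f)) / β` is a divided difference operator. -/
theorem exists_isDividedDiff {n d : ℕ} {w : W n d} {β : VDual n} {v : V n}
    (hw : ∀ y, y - (w : V n ≃ₗ[ℂ] V n) y = β y • v) (y : V n) :
    ∃ T, IsDividedDiff w y T := by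
  have hinv : ∀ y, y - ((w⁻¹ : W n d) : V n ≃ₗ[ℂ] V n) y =
      β y • -(((w⁻¹ : W n d) : V n ≃ₗ[ℂ] V n) v) := by
    intro y
    rw [smul_neg, ← map_smul, ← hw, map_sub, W.inv_apply_apply, neg_sub]
  by_cases hβ : β = 0
  · refine ⟨0, rfl, fun ξ f => ?_⟩
    rw [hinv, hβ]
    simp
  have hξ : ∀ ξ : VDual n, covPoly ξ - covPoly (dualAct w ξ) =
      ξ (-(((w⁻¹ : W n d) : V n ≃ₗ[ℂ] V n) v)) • covPoly β := by
    intro ξ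
    rw [← map_sub, ← map_smul]
    congr 1
    refine LinearMap.ext fun y => ?_
    rw [LinearMap.sub_apply, dualAct_apply, ← map_sub, hinv, map_smul, LinearMap.smul_apply,
      smul_eq_mul, smul_eq_mul, mul_comm]
  have hL : covPoly β ≠ 0 := covPoly_ne_zero hβ
  have hinj : Function.Injective (LinearMap.mulLeft ℂ (covPoly β)) := fun a b hab =>
    mul_left_cancel₀ hL hab
  have hdvd : ∀ f, (LinearMap.id - (polyAct w).toLinearMap : Module.End ℂ (Poly n)) f ∈
      LinearMap.range (LinearMap.mulLeft ℂ (covPoly β)) := by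
    intro f
    obtain ⟨g, hg⟩ := dvd_sub_polyAct w (covPoly β)
      (fun ξ => by rw [hξ]; exact dvd_smul_of_dvd _ dvd_rfl) f
    exact ⟨g, hg.symm⟩
  let D : Module.End ℂ (Poly n) := (LinearEquiv.ofInjective _ hinj).symm.toLinearMap ∘ₗ
    LinearMap.codRestrict _ (LinearMap.id - (polyAct w).toLinearMap) hdvd
  have hD : ∀ f, covPoly β * D f = f - polyAct w f := by
    intro f
    have := congrArg Subtype.val ((LinearEquiv.ofInjective _ hinj).apply_symm_apply
      (LinearMap.codRestrict _ (LinearMap.id - (polyAct w).toLinearMap) hdvd f))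
    exact this
  refine ⟨β y • D, ?_, fun ξ f => ?_⟩
  · refine mul_left_cancel₀ hL ?_
    rw [LinearMap.smul_apply, mul_smul_comm, hD, map_one, sub_self, smul_zero, mul_zero]
  · refine mul_left_cancel₀ hL ?_
    rw [LinearMap.smul_apply, LinearMap.smul_apply, mul_smul_comm, hD, map_mul, polyAct_covPoly,
      mul_add, mul_smul_comm, mul_smul_comm, mul_smul_comm, mul_left_comm, hD, hinv, map_smul,
      smul_eq_mul, mul_smul, ← smul_add, ← smul_mul_assoc, ← hξ]
    congr 1
    ring

open Classical in
/-- A divided difference operator for `w` in the direction `y`, if there is one. -/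
def dividedDiff {n d : ℕ} (w : W n d) (y : V n) : Module.End ℂ (Poly n) :=
  if hT : ∃ T, IsDividedDiff w y T then hT.choose else 0

variable {R : Type u} [CommRing R] [Algebra ℂ R]

theorem isDividedDiff_dividedDiff {n d : ℕ} [NeZero d] {κ : Fin (d - 1) → R} {h : R}
    {w : W n d} (hw : reflCoeff κ h w ≠ 0) (y : V n) : IsDividedDiff w y (dividedDiff w y) := by
  obtain ⟨β, v, hβ⟩ := exists_rank_one_of_reflCoeff_ne_zero hw
  have hT := exists_isDividedDiff hβ y
  rw [dividedDiff, dif_pos hT]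
  exact hT.choose_spec

/-- The derivative in the direction `y`. -/
def dirDeriv {n : ℕ} (y : V n) : Derivation ℂ (Poly n) (Poly n) :=
  MvPolynomial.mkDerivation ℂ fun i => MvPolynomial.C (y i)

theorem dirDeriv_covPoly {n : ℕ} (y : V n) (ξ : VDual n) :
    dirDeriv y (covPoly ξ) = MvPolynomial.C (ξ y) := by
  conv_rhs => rw [Cherednik.dual_eq_sum_coord ξ]
  rw [covPoly_apply, map_sum, LinearMap.sum_apply, map_sum]
  refine Finset.sum_congr rfl fun i _ => ?_
  rw [Derivation.map_smul, dirDeriv, MvPolynomial.mkDerivation_X, MvPolynomial.smul_eq_C_mul,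
    ← map_mul]
  rfl

end
end RationalCherednik

namespace RationalCherednik
noncomputable section

open TensorProduct

/-! ### Dunkl operators on induced modules -/

/-- A complex representation of `S(V) ♯ W` with a compatible degree operator: commuting operators
`act y` for `y ∈ V`, a `W`-equivariant family, and an operator `deg` commuting with `W` and
satisfying `[deg, act y] = act y`. -/
structure BorelRep (n d : ℕ) (X : Type) [AddCommGroup X] [Module ℂ X] where
  /-- The action of `W`. -/
  ρ : Representation ℂ (W n d) X
  /-- The action of `V`. -/
  act : V n →ₗ[ℂ] Module.End ℂ X
  /-- The degree operator. -/
  deg : Module.End ℂ X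
  act_comm : ∀ y y' u, act y (act y' u) = act y' (act y u)
  ρ_act : ∀ w y u, ρ w (act y u) = act ((w : V n ≃ₗ[ℂ] V n) y) (ρ w u)
  ρ_deg : ∀ w u, ρ w (deg u) = deg (ρ w u)
  deg_act : ∀ y u, deg (act y u) = act y (deg u) + act y u

variable {R : Type u} [CommRing R] [Algebra ℂ R]
variable {n d : ℕ} (κ : Fin (d - 1) → R) (h : R)
variable {X : Type} [AddCommGroup X] [Module ℂ X] (D : BorelRep n d X)

/-- The `R`-module `R ⊗ X ⊗ S(V*)` underlying an induced module. -/
def PolyTensor (R : Type u) [CommRing R] [Algebra ℂ R] (n : ℕ) (X : Type) [AddCommGroup X]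
    [Module ℂ X] : Type u :=
  R ⊗[ℂ] (X ⊗[ℂ] Poly n)

instance : AddCommGroup (PolyTensor R n X) :=
  inferInstanceAs (AddCommGroup (R ⊗[ℂ] (X ⊗[ℂ] Poly n)))

instance : Module R (PolyTensor R n X) :=
  inferInstanceAs (Module R (R ⊗[ℂ] (X ⊗[ℂ] Poly n)))

namespace PolyTensor

/-- The pure tensor `r ⊗ u ⊗ f`. -/
def mk (r : R) (u : X) (f : Poly n) : PolyTensor R n X := r ⊗ₜ[ℂ] (u ⊗ₜ[ℂ] f)

theorem mk_add_left (r : R) (u u' : X) (f : Poly n) :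
    mk r (u + u') f = mk r u f + mk r u' f := by
  simp only [mk, add_tmul, tmul_add]; rfl

theorem mk_add_right (r : R) (u : X) (f f' : Poly n) :
    mk r u (f + f') = mk r u f + mk r u f' := by
  simp only [mk, tmul_add]; rfl

theorem smul_mk (s r : R) (u : X) (f : Poly n) : s • mk r u f = mk (s * r) u f := rfl

theorem mk_smul_right (c : ℂ) (r : R) (u : X) (f : Poly n) :
    mk r u (c • f) = algebraMap ℂ R c • mk r u f := by
  rw [smul_mk, ← Algebra.smul_def, mk, mk, tmul_smul, tmul_smul]
  rfl

theorem mk_smul_left (c : ℂ) (r : R) (u : X) (f : Poly n) :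
    mk r (c • u) f = algebraMap ℂ R c • mk r u f := by
  rw [← mk_smul_right, mk, mk, smul_tmul]

theorem mk_zero_right (r : R) (u : X) : mk r u (0 : Poly n) = 0 := by
  simpa using mk_smul_right 0 r u (0 : Poly n)

theorem induction {p : PolyTensor R n X → Prop} (h0 : p 0) (hadd : ∀ x y, p x → p y → p (x + y))
    (hmk : ∀ r u f, p (mk r u f)) (m : PolyTensor R n X) : p m := by
  refine TensorProduct.induction_on (motive := p) m h0 (fun r k => ?_) hadd
  refine TensorProduct.induction_on (motive := fun k => p (r ⊗ₜ[ℂ] k)) k ?_ (hmk r) ?_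
  · rw [tmul_zero]; exact h0
  · intro x y hx hy
    rw [tmul_add]
    exact hadd _ _ hx hy

theorem hom_ext_mk {M : Type*} [AddCommGroup M] [Module R M] {F G : PolyTensor R n X →ₗ[R] M}
    (hFG : ∀ r u f, F (mk r u f) = G (mk r u f)) : F = G :=
  LinearMap.ext fun m => induction (p := fun m => F m = G m) (by simp)
    (fun x y hx hy => by rw [map_add, map_add, hx, hy]) hFG m

variable (R) in
/-- The operator `1 ⊗ a ⊗ b`. -/
def op (a : Module.End ℂ X) (b : Module.End ℂ (Poly n)) : Module.End R (PolyTensor R n X) :=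
  LinearMap.baseChange R (TensorProduct.map a b)

theorem op_mk (a : Module.End ℂ X) (b : Module.End ℂ (Poly n)) (r : R) (u : X) (f : Poly n) :
    op R a b (mk r u f) = mk r (a u) (b f) := rfl

end PolyTensor

open PolyTensor

variable (R X) in
/-- Multiplication by `ξ ∈ V*` on `R ⊗ X ⊗ S(V*)`. -/
def mulOp (ξ : VDual n) : Module.End R (PolyTensor R n X) :=
  op R 1 (LinearMap.mulLeft ℂ (covPoly ξ))

variable (R) in
/-- The diagonal action of `w ∈ W` on `R ⊗ X ⊗ S(V*)`. -/
def grpOp (w : W n d) : Module.End R (PolyTensor R n X) :=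
  op R (D.ρ w) (polyAct w).toLinearMap

theorem mulOp_mk (ξ : VDual n) (r : R) (u : X) (f : Poly n) :
    mulOp R X ξ (mk r u f) = mk r u (covPoly ξ * f) := rfl

theorem grpOp_mk (w : W n d) (r : R) (u : X) (f : Poly n) :
    grpOp R D w (mk r u f) = mk r (D.ρ w u) (polyAct w f) := rfl

/-- Two `R`-linear maps on `R ⊗ X ⊗ S(V*)` that are intertwined in the same way with the
multiplications by the variables agree if they agree on `1 ⊗ X ⊗ 1`. -/
theorem polyTensor_hom_ext {M : Type*} [AddCommGroup M] [Module R M]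
    {F G : PolyTensor R n X →ₗ[R] M} (a : Fin n → M → M)
    (hF : ∀ i m, F (mulOp R X (coord i) m) = a i (F m))
    (hG : ∀ i m, G (mulOp R X (coord i) m) = a i (G m))
    (h1 : ∀ u : X, F (mk 1 u 1) = G (mk 1 u 1)) : F = G := by
  have key : ∀ (f : Poly n) (u : X), F (mk 1 u f) = G (mk 1 u f) := by
    intro f
    induction f using MvPolynomial.induction_on with
    | C c =>
      intro u
      have : (MvPolynomial.C c : Poly n) = c • 1 := by
        rw [MvPolynomial.smul_eq_C_mul, mul_one]
      rw [this, mk_smul_right, map_smul, map_smul, h1]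
    | add p q hp hq => intro u; simp only [mk_add_right, map_add, hp, hq]
    | mul_X p i hp =>
      intro u
      have : mk (1 : R) u (p * MvPolynomial.X i) = mulOp R X (coord i) (mk 1 u p) := by
        rw [mulOp_mk, covPoly_coord, mul_comm]
      rw [this, hF, hG, hp]
  refine hom_ext_mk fun r u f => ?_
  rw [← mul_one r, ← smul_mk, map_smul, map_smul, key]

/-- An operator on `R ⊗ X ⊗ S(V*)` that vanishes on `1 ⊗ X ⊗ 1` and is intertwined with the
multiplications by the variables is zero. -/
theorem polyTensor_end_eq_zero {Z : Module.End R (PolyTensor R n X)}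
    (c : Fin n → Module.End R (PolyTensor R n X))
    (hc : ∀ i, Z * mulOp R X (coord i) = c i * Z) (h1 : ∀ u : X, Z (mk 1 u 1) = 0) :
    Z = 0 := by
  refine polyTensor_hom_ext (fun i => c i) (fun i m => ?_) (fun i m => ?_) (fun u => ?_)
  · exact LinearMap.congr_fun (hc i) m
  · simp
  · simpa using h1 u

theorem mulOp_add (ξ ξ' : VDual n) : mulOp R X (ξ + ξ') = mulOp R X ξ + mulOp R X ξ' :=
  hom_ext_mk fun r u f => by
    rw [LinearMap.add_apply, mulOp_mk, mulOp_mk, mulOp_mk, map_add, add_mul, mk_add_right]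

theorem mulOp_smul (c : ℂ) (ξ : VDual n) :
    mulOp R X (c • ξ) = algebraMap ℂ R c • mulOp R X ξ :=
  hom_ext_mk fun r u f => by
    rw [LinearMap.smul_apply, mulOp_mk, mulOp_mk, map_smul, smul_mul_assoc, mk_smul_right]

theorem mulOp_comm (ξ ξ' : VDual n) :
    mulOp R X ξ * mulOp R X ξ' = mulOp R X ξ' * mulOp R X ξ :=
  hom_ext_mk fun r u f => by
    simp only [Module.End.mul_apply, mulOp_mk, mul_left_comm]

theorem grpOp_one : grpOp R D 1 = 1 :=
  hom_ext_mk fun r u f => by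
    rw [grpOp_mk, map_one, polyAct_one]; rfl

theorem grpOp_mul (w w' : W n d) : grpOp R D (w * w') = grpOp R D w * grpOp R D w' :=
  hom_ext_mk fun r u f => by
    rw [Module.End.mul_apply, grpOp_mk, grpOp_mk, grpOp_mk, map_mul, polyAct_mul]; rfl

theorem grpOp_mul_mulOp (w : W n d) (ξ : VDual n) :
    grpOp R D w * mulOp R X ξ = mulOp R X (dualAct w ξ) * grpOp R D w :=
  hom_ext_mk fun r u f => by
    simp only [Module.End.mul_apply, mulOp_mk, grpOp_mk, map_mul, polyAct_covPoly]

theorem grpOp_mk_one (w : W n d) (r : R) (u : X) :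
    grpOp R D w (mk r u 1) = mk r (D.ρ w u) 1 := by
  rw [grpOp_mk, map_one]

variable [NeZero d]

/-- The Dunkl operator of `y ∈ V` on `R ⊗ X ⊗ S(V*)`. -/
def vecOp (y : V n) : Module.End R (PolyTensor R n X) :=
  op R (D.act y) 1 + op R 1 (dirDeriv y).toLinearMap +
    ∑ w : W n d, reflCoeff κ h w • op R (D.ρ w) (dividedDiff w y)

theorem vecOp_mk (y : V n) (r : R) (u : X) (f : Poly n) :
    vecOp κ h D y (mk r u f) = mk r (D.act y u) f + mk r u (dirDeriv y f) +
      ∑ w : W n d, reflCoeff κ h w • (mk r (D.ρ w u) (dividedDiff w y f)) := by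
  simp [vecOp, LinearMap.sum_apply, op_mk]

/-- The value `⟨ξ, y⟩ + ∑_w b(w) ⟨ξ, y - w⁻¹ y⟩ w` of the commutator of `y` and `ξ`. -/
def commOp (y : V n) (ξ : VDual n) : Module.End R (PolyTensor R n X) :=
  algebraMap R _ (algebraMap ℂ R (ξ y)) +
      ∑ w : W n d, (reflCoeff κ h w *
        algebraMap ℂ R (ξ (y - ((w⁻¹ : W n d) : V n ≃ₗ[ℂ] V n) y))) • grpOp R D w

theorem vecOp_mul_mulOp (y : V n) (ξ : VDual n) :
    vecOp κ h D y * mulOp R X ξ = mulOp R X ξ * vecOp κ h D y + commOp κ h D y ξ := by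
  refine hom_ext_mk fun r u f => ?_
  have hw : ∀ w : W n d, reflCoeff κ h w • (mk r (D.ρ w u)
      (dividedDiff w y (covPoly ξ * f))) =
      reflCoeff κ h w • (mk r (D.ρ w u) (covPoly ξ * dividedDiff w y f)) +
      (reflCoeff κ h w * algebraMap ℂ R (ξ (y - ((w⁻¹ : W n d) : V n ≃ₗ[ℂ] V n) y))) •
        (mk r (D.ρ w u) (polyAct w f)) := by
    intro w
    by_cases hb : reflCoeff κ h w = 0
    · simp [hb]
    · rw [(isDividedDiff_dividedDiff hb y).2, mk_add_right, smul_add, mk_smul_right,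
        smul_smul]
  simp only [Module.End.mul_apply, LinearMap.add_apply, mulOp_mk, vecOp_mk, commOp, map_add,
    map_sum, map_smul, LinearMap.sum_apply, LinearMap.smul_apply, grpOp_mk, hw,
    Finset.sum_add_distrib, Derivation.leibniz, dirDeriv_covPoly, Module.algebraMap_end_apply,
    mk_add_right, smul_eq_mul]
  have h1 : mk r u (f * MvPolynomial.C (ξ y)) =
      algebraMap ℂ R (ξ y) • mk r u f := by
    rw [← mk_smul_right, MvPolynomial.smul_eq_C_mul, mul_comm]
  rw [h1]
  abel

theorem vecOp_mk_one (y : V n) (r : R) (u : X) :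
    vecOp κ h D y (mk r u 1) = mk r (D.act y u) 1 := by
  have hw : ∀ w : W n d, reflCoeff κ h w • (mk r (D.ρ w u) (dividedDiff w y 1)) = 0 := by
    intro w
    by_cases hb : reflCoeff κ h w = 0
    · simp [hb]
    · rw [(isDividedDiff_dividedDiff hb y).1, mk_zero_right, smul_zero]
  rw [vecOp_mk, Finset.sum_congr rfl fun w _ => hw w]
  simp [mk_zero_right]

theorem vecOp_add (y y' : V n) : vecOp κ h D (y + y') = vecOp κ h D y + vecOp κ h D y' := by
  rw [← sub_eq_zero]
  refine polyTensor_end_eq_zero (fun i => mulOp R X (coord i)) (fun i => ?_) (fun u => ?_)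
  · have : commOp κ h D (y + y') (coord i) = commOp κ h D y (coord i) +
        commOp κ h D y' (coord i) := by
      have hy : ∀ w : W n d, y + y' - ((w⁻¹ : W n d) : V n ≃ₗ[ℂ] V n) (y + y') =
          (y - ((w⁻¹ : W n d) : V n ≃ₗ[ℂ] V n) y) +
          (y' - ((w⁻¹ : W n d) : V n ≃ₗ[ℂ] V n) y') := fun w => by rw [map_add]; abel
      simp only [commOp, hy, map_add (coord i), map_add (algebraMap ℂ R), mul_add, add_smul,
        Finset.sum_add_distrib, map_add (algebraMap R _)]
      abel
    simp only [sub_mul, add_mul, vecOp_mul_mulOp, this]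
    noncomm_ring
  · simp only [LinearMap.sub_apply, LinearMap.add_apply, vecOp_mk_one, map_add, mk_add_left,
      sub_self]

theorem vecOp_smul (c : ℂ) (y : V n) :
    vecOp κ h D (c • y) = algebraMap ℂ R c • vecOp κ h D y := by
  rw [← sub_eq_zero]
  refine polyTensor_end_eq_zero (fun i => mulOp R X (coord i)) (fun i => ?_) (fun u => ?_)
  · have : commOp κ h D (c • y) (coord i) = algebraMap ℂ R c • commOp κ h D y (coord i) := by
      have hy : ∀ w : W n d, c • y - ((w⁻¹ : W n d) : V n ≃ₗ[ℂ] V n) (c • y) =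
          c • (y - ((w⁻¹ : W n d) : V n ≃ₗ[ℂ] V n) y) := fun w => by rw [map_smul, smul_sub]
      simp only [commOp, hy, map_smul (coord i), smul_eq_mul, map_mul (algebraMap ℂ R), smul_add,
        Finset.smul_sum, smul_smul, Algebra.algebraMap_eq_smul_one (A := Module.End R _)]
      congr 1
      exact Finset.sum_congr rfl fun w _ => by rw [mul_left_comm]
    simp only [sub_mul, smul_mul_assoc, vecOp_mul_mulOp, this, smul_add, mul_sub, mul_smul_comm]
    abel
  · simp only [LinearMap.sub_apply, LinearMap.smul_apply, vecOp_mk_one, map_smul]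
    rw [mk_smul_left, sub_self]

theorem grpOp_mul_commOp (g : W n d) (y : V n) (ξ : VDual n) :
    grpOp R D g * commOp κ h D y ξ =
      commOp κ h D ((g : V n ≃ₗ[ℂ] V n) y) (dualAct g ξ) * grpOp R D g := by
  rw [commOp, commOp, mul_add, add_mul, dualAct_apply, W.inv_apply_apply, ← Algebra.commutes,
    Finset.mul_sum, Finset.sum_mul]
  congr 1
  refine Fintype.sum_equiv (MulAut.conj g).toEquiv _ _ fun w => ?_
  have hc : (MulAut.conj g).toEquiv w = g * w * g⁻¹ := rfl
  rw [hc, reflCoeff_conj, mul_smul_comm, smul_mul_assoc, ← grpOp_mul, ← grpOp_mul,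
    inv_mul_cancel_right, dualAct_apply]
  congr 4
  simp [mul_assoc]

theorem grpOp_mul_vecOp (g : W n d) (y : V n) :
    grpOp R D g * vecOp κ h D y = vecOp κ h D ((g : V n ≃ₗ[ℂ] V n) y) * grpOp R D g := by
  rw [← sub_eq_zero]
  refine polyTensor_end_eq_zero (fun i => mulOp R X (dualAct g (coord i))) (fun i => ?_)
    (fun u => ?_)
  · rw [sub_mul, mul_assoc, vecOp_mul_mulOp, mul_add, ← mul_assoc, grpOp_mul_mulOp,
      grpOp_mul_commOp, mul_assoc (vecOp _ _ _ _), grpOp_mul_mulOp, ← mul_assoc (vecOp _ _ _ _),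
      vecOp_mul_mulOp]
    noncomm_ring
  · simp only [LinearMap.sub_apply, Module.End.mul_apply, vecOp_mk_one, grpOp_mk_one,
      D.ρ_act, sub_self]

/-- The symmetry in `y` and `y'` that makes the Dunkl operators commute: since `1 - w` has
rank one, `⟨ξ, y' - w⁻¹ y'⟩ (y - w y)` is symmetric in `y` and `y'`. -/
theorem vecOp_commOp_symm (y y' : V n) (ξ : VDual n) :
    vecOp κ h D y * commOp κ h D y' ξ + commOp κ h D y ξ * vecOp κ h D y' =
      vecOp κ h D y' * commOp κ h D y ξ + commOp κ h D y' ξ * vecOp κ h D y := by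
  have hterm : ∀ w : W n d, ∀ y y' : V n, (reflCoeff κ h w *
      algebraMap ℂ R (ξ (y' - ((w⁻¹ : W n d) : V n ≃ₗ[ℂ] V n) y'))) •
        (vecOp κ h D y * grpOp R D w - grpOp R D w * vecOp κ h D y) =
      (reflCoeff κ h w * algebraMap ℂ R (ξ (y - ((w⁻¹ : W n d) : V n ≃ₗ[ℂ] V n) y))) •
        (vecOp κ h D y' * grpOp R D w - grpOp R D w * vecOp κ h D y') := by
    intro w y y'
    by_cases hb : reflCoeff κ h w = 0
    · simp [hb]
    obtain ⟨β, v, hβ⟩ := exists_rank_one_of_reflCoeff_ne_zero hb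
    have hinv : ∀ y, y - ((w⁻¹ : W n d) : V n ≃ₗ[ℂ] V n) y =
        β y • -(((w⁻¹ : W n d) : V n ≃ₗ[ℂ] V n) v) := by
      intro y
      rw [smul_neg, ← map_smul, ← hβ, map_sub, W.inv_apply_apply, neg_sub]
    have hcomm : ∀ y, vecOp κ h D y * grpOp R D w - grpOp R D w * vecOp κ h D y =
        algebraMap ℂ R (β y) • (vecOp κ h D v * grpOp R D w) := by
      intro y
      have hy : y = (w : V n ≃ₗ[ℂ] V n) y + β y • v := by rw [← hβ]; abel
      have hv : vecOp κ h D y = vecOp κ h D ((w : V n ≃ₗ[ℂ] V n) y) +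
          algebraMap ℂ R (β y) • vecOp κ h D v := by
        rw [← vecOp_smul, ← vecOp_add, ← hy]
      rw [grpOp_mul_vecOp, hv, add_mul, add_sub_cancel_left, smul_mul_assoc]
    rw [hcomm, hcomm, hinv, hinv, map_smul ξ, map_smul ξ, smul_smul, smul_smul, smul_eq_mul,
      smul_eq_mul, map_mul, map_mul]
    congr 1
    ring
  have hsum : ∀ y y' : V n, vecOp κ h D y * commOp κ h D y' ξ - commOp κ h D y' ξ * vecOp κ h D y =
      ∑ w : W n d, (reflCoeff κ h w *
        algebraMap ℂ R (ξ (y' - ((w⁻¹ : W n d) : V n ≃ₗ[ℂ] V n) y'))) •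
        (vecOp κ h D y * grpOp R D w - grpOp R D w * vecOp κ h D y) := by
    intro y y'
    rw [commOp, mul_add, add_mul, Algebra.commutes, add_sub_add_left_eq_sub, Finset.mul_sum,
      Finset.sum_mul, ← Finset.sum_sub_distrib]
    simp only [mul_smul_comm, smul_mul_assoc, smul_sub]
  have := (hsum y y').trans ((Finset.sum_congr rfl fun w _ => hterm w y y').trans (hsum y' y).symm)
  rw [sub_eq_sub_iff_add_eq_add] at this
  rw [this]

theorem vecOp_comm (y y' : V n) :
    vecOp κ h D y * vecOp κ h D y' = vecOp κ h D y' * vecOp κ h D y := by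
  -- `[vecOp y, vecOp y']` commutes with the multiplication operators and vanishes on `1 ⊗ X ⊗ 1`.
  rw [← sub_eq_zero]
  refine polyTensor_end_eq_zero (fun i => mulOp R X (coord i)) (fun i => ?_) (fun u => ?_)
  · have key : ∀ y y' : V n, vecOp κ h D y * vecOp κ h D y' * mulOp R X (coord i) =
        mulOp R X (coord i) * (vecOp κ h D y * vecOp κ h D y') +
        (vecOp κ h D y * commOp κ h D y' (coord i) +
          commOp κ h D y (coord i) * vecOp κ h D y') := by
      intro y y'
      rw [mul_assoc, vecOp_mul_mulOp, mul_add, ← mul_assoc, vecOp_mul_mulOp]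
      noncomm_ring
    rw [sub_mul, key, key, vecOp_commOp_symm, mul_sub]
    abel
  · simp only [LinearMap.sub_apply, Module.End.mul_apply, vecOp_mk_one, D.act_comm y y', sub_self]

/-- The Dunkl operators satisfy the defining relations of the Cherednik algebra. -/
theorem exists_toEnd :
    ∃ F : Cherednik n κ h →ₐ[R] Module.End R (PolyTensor R n X),
      (∀ y, F (Cherednik.vec κ h y) = vecOp κ h D y) ∧
      (∀ ξ, F (Cherednik.cov κ h ξ) = mulOp R X ξ) ∧
      ∀ w, F (Cherednik.grp κ h w) = grpOp R D w :=
  Cherednik.exists_lift κ h _ _ _ (vecOp_add κ h D) (vecOp_smul κ h D) mulOp_add mulOp_smul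
    (grpOp_one D) (grpOp_mul D) (grpOp_mul_vecOp κ h D) (grpOp_mul_mulOp D)
    (vecOp_comm κ h D) mulOp_comm (vecOp_mul_mulOp κ h D)

end
end RationalCherednik

namespace RationalCherednik
noncomputable section

open TensorProduct PolyTensor

/-! ### Induced modules and their universal property -/

/-- Commuting elements `a i` of a noncommutative algebra can be substituted for the variables of
a polynomial ring. -/
theorem exists_ringHom_of_commute {R A : Type*} [CommRing R] [Algebra ℂ R] [Ring A] [Algebra R A]
    {n : ℕ} (a : Fin n → A) (ha : ∀ i j, a i * a j = a j * a i) :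
    ∃ F : Poly n →+* A, (∀ c, F (MvPolynomial.C c) = algebraMap R A (algebraMap ℂ R c)) ∧
      ∀ i, F (MvPolynomial.X i) = a i := by
  have := Algebra.isMulCommutative_adjoin R (s := Set.range a) (by
    rintro _ ⟨i, rfl⟩ _ ⟨j, rfl⟩; exact ha i j)
  let : CommRing (Algebra.adjoin R (Set.range a)) :=
    { (inferInstance : Ring (Algebra.adjoin R (Set.range a))) with
      mul_comm := this.is_comm.comm }
  refine ⟨((Algebra.adjoin R (Set.range a)).subtype : _ →+* A).comp (MvPolynomial.eval₂Hom
    ((algebraMap R (Algebra.adjoin R (Set.range a))).comp (algebraMap ℂ R))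
    (fun i => ⟨a i, Algebra.subset_adjoin ⟨i, rfl⟩⟩)), fun c => ?_, fun i => ?_⟩
  · rw [RingHom.comp_apply, MvPolynomial.coe_eval₂Hom, MvPolynomial.eval₂_C]
    rfl
  · rw [RingHom.comp_apply, MvPolynomial.coe_eval₂Hom, MvPolynomial.eval₂_X]
    rfl

variable {R : Type u} [CommRing R] [Algebra ℂ R]
variable {n d : ℕ} [NeZero d] (κ : Fin (d - 1) → R) (h : R)
variable {X : Type} [AddCommGroup X] [Module ℂ X] (D : BorelRep n d X)

/-- The `H_R(κ, h)`-module induced from the `S(V) ♯ W ⊗ R`-module `R ⊗ X`, realized on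
`R ⊗ X ⊗ S(V*)` by Dunkl operators. -/
def Ind (_κ : Fin (d - 1) → R) (_h : R) (_D : BorelRep n d X) : Type u := PolyTensor R n X

namespace Ind

instance : AddCommGroup (Ind κ h D) := inferInstanceAs (AddCommGroup (PolyTensor R n X))

instance : Module R (Ind κ h D) := inferInstanceAs (Module R (PolyTensor R n X))

/-- The action of the Cherednik algebra on an induced module. -/
def toEnd : Cherednik n κ h →ₐ[R] Module.End R (PolyTensor R n X) := (exists_toEnd κ h D).choose

instance : Module (Cherednik n κ h) (Ind κ h D) :=
  Module.compHom (PolyTensor R n X) (toEnd κ h D).toRingHom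

theorem smul_def (a : Cherednik n κ h) (m : Ind κ h D) : a • m = toEnd κ h D a m := rfl

instance : IsScalarTower R (Cherednik n κ h) (Ind κ h D) where
  smul_assoc r a m := by
    rw [smul_def, smul_def, map_smul]; rfl

theorem vec_smul (y : V n) (m : Ind κ h D) : Cherednik.vec κ h y • m = vecOp κ h D y m := by
  rw [smul_def, toEnd, (exists_toEnd κ h D).choose_spec.1]

theorem cov_smul (ξ : VDual n) (m : Ind κ h D) : Cherednik.cov κ h ξ • m = mulOp R X ξ m := by
  rw [smul_def, toEnd, (exists_toEnd κ h D).choose_spec.2.1]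

theorem grp_smul (w : W n d) (m : Ind κ h D) : Cherednik.grp κ h w • m = grpOp R D w m := by
  rw [smul_def, toEnd, (exists_toEnd κ h D).choose_spec.2.2]

/-- The inclusion of `X` in the induced module. -/
def gen : X →+ Ind κ h D :=
  AddMonoidHom.mk' (fun u => (mk 1 u 1 : PolyTensor R n X)) fun u u' => mk_add_left 1 u u' 1

theorem gen_smul (c : ℂ) (u : X) :
    gen κ h D (c • u) = algebraMap R (Cherednik n κ h) (algebraMap ℂ R c) • gen κ h D u := by
  rw [algebraMap_smul]
  exact mk_smul_left c 1 u 1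

theorem vec_smul_gen (y : V n) (u : X) :
    Cherednik.vec κ h y • gen κ h D u = gen κ h D (D.act y u) :=
  (vec_smul κ h D y _).trans (vecOp_mk_one κ h D y 1 u)

theorem grp_smul_gen (w : W n d) (u : X) :
    Cherednik.grp κ h w • gen κ h D u = gen κ h D (D.ρ w u) :=
  (grp_smul κ h D w _).trans (grpOp_mk_one D w 1 u)

variable {κ h D}

/-- `H_R(κ, h)`-linear maps out of an induced module are determined on `X`. -/
theorem hom_ext {M : Type*} [AddCommGroup M] [Module (Cherednik n κ h) M]
    {F G : Ind κ h D →ₗ[Cherednik n κ h] M} (hFG : ∀ u, F (gen κ h D u) = G (gen κ h D u)) :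
    F = G := by
  let : Module R M := Module.compHom M (algebraMap R (Cherednik n κ h))
  have hlin : ∀ (F : Ind κ h D →ₗ[Cherednik n κ h] M) (r : R) (m : Ind κ h D),
      F (r • m) = r • F m := by
    intro F r m
    rw [← algebraMap_smul (Cherednik n κ h) r m, map_smul]
    rfl
  let toLin : (Ind κ h D →ₗ[Cherednik n κ h] M) → (PolyTensor R n X →ₗ[R] M) := fun F =>
    { toFun := F, map_add' := F.map_add, map_smul' := hlin F }
  have key : toLin F = toLin G := by
    refine polyTensor_hom_ext (fun i m => Cherednik.cov κ h (coord i) • m) ?_ ?_ hFG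
    · intro i m
      exact (congrArg F (cov_smul κ h D (coord i) m).symm).trans (map_smul F _ _)
    · intro i m
      exact (congrArg G (cov_smul κ h D (coord i) m).symm).trans (map_smul G _ _)
  exact LinearMap.ext fun m => LinearMap.congr_fun key m

/-- The universal property of induced modules: maps on `X` compatible with `ℂ`, `V` and `W`
extend to `H_R(κ, h)`-linear maps. -/
theorem exists_lift {M : Type*} [AddCommGroup M] [Module (Cherednik n κ h) M] (φ : X →+ M)
    (hs : ∀ c u, φ (c • u) = algebraMap R (Cherednik n κ h) (algebraMap ℂ R c) • φ u)
    (hv : ∀ y u, φ (D.act y u) = Cherednik.vec κ h y • φ u)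
    (hg : ∀ w u, φ (D.ρ w u) = Cherednik.grp κ h w • φ u) :
    ∃ F : Ind κ h D →ₗ[Cherednik n κ h] M, ∀ u, F (gen κ h D u) = φ u := by
  let : Module R M := Module.compHom M (algebraMap R (Cherednik n κ h))
  let : Module ℂ M := Module.compHom M (algebraMap ℂ R)
  have hR : ∀ (r : R) (m : M), r • m = algebraMap R (Cherednik n κ h) r • m := fun _ _ => rfl
  have hC : ∀ (c : ℂ) (m : M), c • m = algebraMap ℂ R c • m := fun _ _ => rfl
  have : IsScalarTower R (Cherednik n κ h) M :=
    ⟨fun r a m => by rw [hR, Algebra.smul_def, mul_smul]⟩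
  have : IsScalarTower ℂ R M := ⟨fun c r m => by rw [hC, Algebra.smul_def, mul_smul]⟩
  obtain ⟨σ, hσC, hσX⟩ := exists_ringHom_of_commute (R := R)
    (fun i : Fin n => Cherednik.cov (d := d) κ h (coord i))
    (fun i j => Cherednik.cov_comm κ h _ _)
  have hσ : ∀ ξ, σ (covPoly ξ) = Cherednik.cov κ h ξ := by
    intro ξ
    rw [covPoly_apply, map_sum, Cherednik.cov_eq_sum]
    refine Finset.sum_congr rfl fun i _ => ?_
    rw [MvPolynomial.smul_eq_C_mul, map_mul, hσC, hσX, ← Algebra.smul_def]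
  let B : X →ₗ[ℂ] Poly n →ₗ[ℂ] M := LinearMap.mk₂ ℂ (fun u f => σ f • φ u)
    (fun u u' f => by rw [map_add, smul_add])
    (fun c u f => by rw [hs, hC, hR, ← mul_smul, ← mul_smul, Algebra.commutes])
    (fun u f f' => by rw [map_add, add_smul])
    (fun c u f => by rw [MvPolynomial.smul_eq_C_mul, map_mul, hσC, mul_smul, hC, hR])
  let F : PolyTensor R n X →ₗ[R] M := LinearMap.liftBaseChange R (TensorProduct.lift B)
  have hF : ∀ r u f, F (mk r u f) = r • (σ f • φ u) := by
    intro r u f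
    change LinearMap.liftBaseChange R (TensorProduct.lift B) (r ⊗ₜ (u ⊗ₜ f)) = _
    rw [LinearMap.liftBaseChange_tmul, TensorProduct.lift.tmul]
    rfl
  have hF1 : ∀ u, F (mk 1 u 1) = φ u := by
    intro u
    rw [hF, map_one, one_smul, one_smul]
  let lact : Cherednik n κ h → Module.End R M := fun a => Algebra.lsmul R R M a
  have hlact : ∀ a m, lact a m = a • m := fun _ _ => rfl
  have hFcov : ∀ ξ m, F (mulOp R X ξ m) = Cherednik.cov κ h ξ • F m := by
    intro ξ m
    have : F ∘ₗ mulOp R X ξ = lact (Cherednik.cov κ h ξ) ∘ₗ F := by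
      refine hom_ext_mk fun r u f => ?_
      rw [LinearMap.comp_apply, LinearMap.comp_apply, mulOp_mk, hF, hF, hlact, map_mul, hσ,
        mul_smul, smul_comm]
    exact LinearMap.congr_fun this m
  have hFgrp : ∀ w m, F (grpOp R D w m) = Cherednik.grp κ h w • F m := by
    intro w m
    have : F ∘ₗ grpOp R D w = lact (Cherednik.grp κ h w) ∘ₗ F := by
      refine polyTensor_hom_ext (fun i m => Cherednik.cov κ h (dualAct w (coord i)) • m)
        (fun i m => ?_) (fun i m => ?_) fun u => ?_
      · rw [LinearMap.comp_apply, LinearMap.comp_apply, ← hFcov, ← Module.End.mul_apply,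
          grpOp_mul_mulOp, Module.End.mul_apply]
      · rw [LinearMap.comp_apply, LinearMap.comp_apply, hlact, hlact, hFcov, ← mul_smul, ← mul_smul,
          Cherednik.grp_mul_cov]
      · rw [LinearMap.comp_apply, LinearMap.comp_apply, grpOp_mk_one, hF1, hF1, hlact, hg]
    exact LinearMap.congr_fun this m
  have hFcomm : ∀ y ξ m, F (commOp κ h D y ξ m) =
      (algebraMap R (Cherednik n κ h) (algebraMap ℂ R (ξ y)) +
      ∑ w : W n d, (reflCoeff κ h w *
        algebraMap ℂ R (ξ (y - ((w⁻¹ : W n d) : V n ≃ₗ[ℂ] V n) y))) •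
          Cherednik.grp κ h w) • F m := by
    intro y ξ m
    simp only [commOp, LinearMap.add_apply, map_add F, LinearMap.sum_apply, map_sum F,
      LinearMap.smul_apply, map_smul F, Module.algebraMap_end_apply, hFgrp, add_smul,
      Finset.sum_smul, smul_assoc, hR (algebraMap ℂ R (ξ y))]
  have hFvec : ∀ y m, F (vecOp κ h D y m) = Cherednik.vec κ h y • F m := by
    intro y m
    have : F ∘ₗ vecOp κ h D y - lact (Cherednik.vec κ h y) ∘ₗ F = 0 := by
      refine polyTensor_hom_ext (fun i m => Cherednik.cov κ h (coord i) • m)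
        (fun i m => ?_) (fun i m => ?_) fun u => ?_
      · rw [LinearMap.sub_apply, LinearMap.sub_apply, LinearMap.comp_apply, LinearMap.comp_apply,
          LinearMap.comp_apply, LinearMap.comp_apply, hlact, hlact, ← Module.End.mul_apply,
          vecOp_mul_mulOp, LinearMap.add_apply, Module.End.mul_apply, map_add, hFcomm, hFcov, hFcov,
          ← mul_smul, Cherednik.vec_mul_cov, add_smul (_ * _), add_sub_add_right_eq_sub, smul_sub,
          mul_smul]
      · simp
      · rw [LinearMap.sub_apply, LinearMap.comp_apply, LinearMap.comp_apply, vecOp_mk_one, hF1,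
          hF1, hlact, hv, sub_self, LinearMap.zero_apply]
    exact sub_eq_zero.1 (LinearMap.congr_fun this m)
  refine ⟨{ toFun := F, map_add' := F.map_add, map_smul' := fun a => ?_ }, hF1⟩
  change ∀ m : Ind κ h D, F (a • m) = a • F m
  induction a using Cherednik.induction with
  | hR r =>
    intro m
    rw [algebraMap_smul]
    exact map_smul F r m
  | hvec y => intro m; exact (congrArg F (vec_smul κ h D y m)).trans (hFvec y m)
  | hcov ξ => intro m; exact (congrArg F (cov_smul κ h D ξ m)).trans (hFcov ξ m)
  | hgrp w => intro m; exact (congrArg F (grp_smul κ h D w m)).trans (hFgrp w m)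
  | hadd a b ha hb =>
    intro m
    rw [add_smul, add_smul, ← ha, ← hb]
    exact map_add F _ _
  | hmul a b ha hb => intro m; rw [mul_smul, ha, hb, mul_smul]

/-- If `V` acts by zero on `X`, then the induced module is the standard module. -/
theorem nonempty_equiv_delta (hD : ∀ y u, D.act y u = 0) :
    Nonempty (Ind κ h D ≃ₗ[Cherednik n κ h] Delta κ h D.ρ) := by
  let φ : X →+ Delta κ h D.ρ := AddMonoidHom.mk'
    (fun u => (deltaRel κ h D.ρ).mkQ (1 ⊗ₜ[R] ((1 : R) ⊗ₜ[ℂ] u)))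
    (fun u u' => by rw [tmul_add, tmul_add, map_add])
  have hφ : ∀ u, φ u = (deltaRel κ h D.ρ).mkQ (1 ⊗ₜ[R] ((1 : R) ⊗ₜ[ℂ] u)) := fun _ => rfl
  obtain ⟨F, hF⟩ := exists_lift (D := D) (κ := κ) (h := h) φ
    (by
      intro c u
      have h1 : (1 : R) ⊗ₜ[ℂ] (c • u) = algebraMap ℂ R c • ((1 : R) ⊗ₜ[ℂ] u) := by
        rw [tmul_smul, algebraMap_smul]
      rw [hφ, hφ, ← map_smul, h1, tmul_smul,
        ← algebraMap_smul (Cherednik n κ h) (algebraMap ℂ R c)])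
    (by
      intro y u
      rw [hD, map_zero, hφ, ← map_smul, smul_tmul', smul_eq_mul, eq_comm]
      exact (Submodule.Quotient.mk_eq_zero _).2 (Submodule.subset_span
        (Or.inr ⟨1, y, 1 ⊗ₜ u, by simp⟩)))
    (by
      intro w u
      rw [hφ, hφ, ← map_smul, smul_tmul', smul_eq_mul, eq_comm, ← sub_eq_zero, ← map_sub]
      exact (Submodule.Quotient.mk_eq_zero _).2 (Submodule.subset_span
        (Or.inl ⟨1, w, 1 ⊗ₜ u, by simp⟩)))
  let ι : R ⊗[ℂ] X →ₗ[R] Ind κ h D :=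
    LinearMap.baseChange R ((TensorProduct.mk ℂ X (Poly n)).flip 1)
  have hι : ∀ r u, ι (r ⊗ₜ u) = r • gen κ h D u := by
    intro r u
    change mk r u 1 = r • mk (1 : R) u (1 : Poly n)
    rw [smul_mk, mul_one]
  have hιρ : ∀ w m, ι ((D.ρ w).baseChange R m) = Cherednik.grp κ h w • ι m := by
    intro w m
    induction m using TensorProduct.induction_on with
    | zero => simp
    | add x y hx hy => simp only [map_add, smul_add, hx, hy]
    | tmul r u => rw [LinearMap.baseChange_tmul, hι, hι, smul_comm, grp_smul_gen]
  have hιy : ∀ (y : V n) m, Cherednik.vec (d := d) κ h y • ι m = 0 := by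
    intro y m
    induction m using TensorProduct.induction_on with
    | zero => simp
    | add x y hx hy => simp only [map_add, smul_add, hx, hy, add_zero]
    | tmul r u => rw [hι, smul_comm, vec_smul_gen, hD, map_zero, smul_zero]
  let B : Cherednik n κ h ⊗[R] (R ⊗[ℂ] X) →ₗ[Cherednik n κ h] Ind κ h D :=
    TensorProduct.AlgebraTensorModule.lift
      { toFun := fun a => (Algebra.lsmul R R (Ind κ h D) a) ∘ₗ ι
        map_add' := fun a b => by ext; simp
        map_smul' := fun a b => by ext; simp }
  have hB : ∀ (a : Cherednik n κ h) m, B (a ⊗ₜ m) = a • ι m := fun _ _ => rfl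
  have hker : deltaRel κ h D.ρ ≤ LinearMap.ker B := by
    refine Submodule.span_le.2 ?_
    rintro z (⟨a, w, m, rfl⟩ | ⟨a, y, m, rfl⟩)
    · rw [SetLike.mem_coe, LinearMap.mem_ker, map_sub, hB, hB, hιρ, mul_smul, sub_self]
    · rw [SetLike.mem_coe, LinearMap.mem_ker, hB, mul_smul, hιy, smul_zero]
  let G : Delta κ h D.ρ →ₗ[Cherednik n κ h] Ind κ h D := (deltaRel κ h D.ρ).liftQ B hker
  have hG : ∀ (a : Cherednik n κ h) m, G ((deltaRel κ h D.ρ).mkQ (a ⊗ₜ m)) = a • ι m :=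
    fun _ _ => rfl
  refine ⟨LinearEquiv.ofLinearMap F G ?_ ?_⟩
  · refine Submodule.linearMap_qext _ (LinearMap.ext fun z => ?_)
    induction z using TensorProduct.induction_on with
    | zero => simp
    | add x y hx hy => rw [map_add, hx, hy, map_add]
    | tmul a m =>
      induction m using TensorProduct.induction_on with
      | zero => simp
      | add x y hx hy => rw [tmul_add, map_add, hx, hy, map_add]
      | tmul r u =>
        have h1 : a ⊗ₜ[R] (r ⊗ₜ[ℂ] u) =
            (a * algebraMap R _ r) • ((1 : Cherednik n κ h) ⊗ₜ[R] ((1 : R) ⊗ₜ[ℂ] u)) := by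
          rw [smul_tmul', smul_eq_mul, mul_one, ← Algebra.commutes, ← Algebra.smul_def, smul_tmul,
            smul_tmul', smul_eq_mul, mul_one]
        rw [h1, map_smul, map_smul]
        congr 1
        simp only [LinearMap.comp_apply, hG, hι, one_smul, hF, hφ, LinearMap.id_apply]
  · refine hom_ext fun u => ?_
    rw [LinearMap.comp_apply, hF, hφ, hG, hι, one_smul, one_smul, LinearMap.id_apply]

end Ind

end
end RationalCherednik

namespace RationalCherednik
noncomputable section

open TensorProduct PolyTensor

/-! ### Irreducible subrepresentations -/

namespace BorelRep

variable {n d : ℕ} {X : Type} [AddCommGroup X] [Module ℂ X] (D : BorelRep n d X)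

/-- The restriction of the structure to an invariant subspace. -/
def sub (E : Submodule ℂ X) (hρ : ∀ w, ∀ u ∈ E, D.ρ w u ∈ E) (hact : ∀ y, ∀ u ∈ E, D.act y u ∈ E)
    (hdeg : ∀ u ∈ E, D.deg u ∈ E) : BorelRep n d E where
  ρ :=
    { toFun := fun w => (D.ρ w).restrict (hρ w)
      map_one' := by ext; simp
      map_mul' := fun w w' => by ext; simp }
  act :=
    { toFun := fun y => (D.act y).restrict (hact y)
      map_add' := fun y y' => by ext; simp
      map_smul' := fun c y => by ext; simp }
  deg := D.deg.restrict hdeg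
  act_comm y y' u := Subtype.ext (D.act_comm y y' u)
  ρ_act w y u := Subtype.ext (D.ρ_act w y u)
  ρ_deg w u := Subtype.ext (D.ρ_deg w u)
  deg_act y u := Subtype.ext (D.deg_act y u)

/-- The structure induced on the quotient by an invariant subspace. -/
def quot (E : Submodule ℂ X) (hρ : ∀ w, ∀ u ∈ E, D.ρ w u ∈ E) (hact : ∀ y, ∀ u ∈ E, D.act y u ∈ E)
    (hdeg : ∀ u ∈ E, D.deg u ∈ E) : BorelRep n d (X ⧸ E) where
  ρ :=
    { toFun := fun w => E.mapQ E (D.ρ w) (hρ w)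
      map_one' := by ext; simp
      map_mul' := fun w w' => by ext; simp }
  act :=
    { toFun := fun y => E.mapQ E (D.act y) (hact y)
      map_add' := fun y y' => by ext; simp
      map_smul' := fun c y => by ext; simp }
  deg := E.mapQ E D.deg hdeg
  act_comm y y' u := by
    induction u using Submodule.Quotient.induction_on with
    | _ u => exact congrArg E.mkQ (D.act_comm y y' u)
  ρ_act w y u := by
    induction u using Submodule.Quotient.induction_on with
    | _ u => exact congrArg E.mkQ (D.ρ_act w y u)
  ρ_deg w u := by
    induction u using Submodule.Quotient.induction_on with
    | _ u => exact congrArg E.mkQ (D.ρ_deg w u)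
  deg_act y u := by
    induction u using Submodule.Quotient.induction_on with
    | _ u => exact congrArg E.mkQ (D.deg_act y u)

/-- An eigenspace of the degree operator for an eigenvalue `c` such that `c + 1` is not an
eigenvalue is annihilated by `V`; it contains an irreducible representation of `W`. -/
theorem exists_irreducible_submodule [FiniteDimensional ℂ X] [Nontrivial X] :
    ∃ (E : Submodule ℂ X) (c : ℂ), E ≠ ⊥ ∧ (∀ w, ∀ u ∈ E, D.ρ w u ∈ E) ∧
      (∀ y, ∀ u ∈ E, D.act y u = 0) ∧ (∀ u ∈ E, D.deg u = c • u) ∧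
      ∀ F ≤ E, F ≠ ⊥ → (∀ w, ∀ u ∈ F, D.ρ w u ∈ F) → F = E := by
  obtain ⟨c, hc, hmax⟩ : ∃ c, D.deg.HasEigenvalue c ∧ ¬ D.deg.HasEigenvalue (c + 1) := by
    obtain ⟨c0, hc0⟩ := Module.End.exists_eigenvalue D.deg
    obtain ⟨c, hc, hmax⟩ := Set.exists_max_image {c | D.deg.HasEigenvalue c} Complex.re
      (Module.End.finite_hasEigenvalue D.deg) ⟨c0, hc0⟩
    refine ⟨c, hc, fun h1 => ?_⟩
    have := hmax _ h1
    rw [Complex.add_re, Complex.one_re] at this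
    linarith
  have hE0 : ∀ u, u ∈ D.deg.eigenspace c ↔ D.deg u = c • u := fun u => Module.End.mem_eigenspace_iff
  obtain ⟨E, ⟨hE1, hE2, hE3⟩, hmin⟩ := IsArtinian.set_has_minimal
    {F : Submodule ℂ X | F ≤ D.deg.eigenspace c ∧ F ≠ ⊥ ∧ ∀ w, ∀ u ∈ F, D.ρ w u ∈ F}
    ⟨_, le_rfl, hc, fun w u hu => by rw [hE0, ← D.ρ_deg, (hE0 u).1 hu, map_smul]⟩
  refine ⟨E, c, hE2, hE3, fun y u hu => ?_, fun u hu => (hE0 u).1 (hE1 hu),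
    fun F hF hF0 hFw => ?_⟩
  · by_contra hne
    refine hmax (Module.End.hasEigenvalue_of_hasEigenvector
      (x := D.act y u) ⟨Module.End.mem_eigenspace_iff.2 ?_, hne⟩)
    rw [D.deg_act, (hE0 u).1 (hE1 hu), map_smul, add_smul, one_smul]
  · by_contra hne
    exact hmin F ⟨hF.trans hE1, hF0, hFw⟩ (lt_of_le_of_ne hF hne)

theorem sub_isIrreducible {E : Submodule ℂ X} (hE : E ≠ ⊥) (hρ : ∀ w, ∀ u ∈ E, D.ρ w u ∈ E)
    (hact : ∀ y, ∀ u ∈ E, D.act y u ∈ E) (hdeg : ∀ u ∈ E, D.deg u ∈ E)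
    (hmin : ∀ F ≤ E, F ≠ ⊥ → (∀ w, ∀ u ∈ F, D.ρ w u ∈ F) → F = E) :
    (D.sub E hρ hact hdeg).ρ.IsIrreducible := by
  have : Nontrivial (Subrepresentation (D.sub E hρ hact hdeg).ρ) := by
    refine ⟨⊥, ⊤, fun h => hE ?_⟩
    have h1 := congrArg Subrepresentation.toSubmodule h
    rw [Submodule.eq_bot_iff]
    intro u hu
    have h2 : (⟨u, hu⟩ : E) ∈ (⊥ : Subrepresentation (D.sub E hρ hact hdeg).ρ).toSubmodule := by
      rw [h1]; exact Submodule.mem_top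
    exact congrArg Subtype.val ((Submodule.mem_bot ℂ).1 h2)
  refine ⟨fun σ => ?_⟩
  by_cases h0 : σ.toSubmodule = ⊥
  · exact Or.inl (Subrepresentation.toSubmodule_injective h0)
  · refine Or.inr (Subrepresentation.toSubmodule_injective ?_)
    have h1 := hmin (σ.toSubmodule.map E.subtype) (Submodule.map_subtype_le E _)
      (fun h => h0 (Submodule.map_injective_of_injective E.subtype_injective
        (by rw [h, Submodule.map_bot])))
      (by
        rintro w _ ⟨u, hu, rfl⟩
        exact ⟨_, σ.apply_mem_toSubmodule w hu, rfl⟩)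
    have h2 : σ.toSubmodule = ⊤ := by
      refine Submodule.map_injective_of_injective E.subtype_injective ?_
      rw [h1, Submodule.map_subtype_top]
    exact h2

end BorelRep

/-- Schur's lemma. -/
theorem exists_eq_smul_of_isIrreducible {G X : Type*} [Group G] [AddCommGroup X] [Module ℂ X]
    [FiniteDimensional ℂ X] [Nontrivial X] (ρ : Representation ℂ G X) (hρ : ρ.IsIrreducible)
    (f : Module.End ℂ X) (hf : ∀ g u, f (ρ g u) = ρ g (f u)) : ∃ c : ℂ, ∀ u, f u = c • u := by
  obtain ⟨c, hc⟩ := Module.End.exists_eigenvalue f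
  let σ : Subrepresentation ρ := ⟨f.eigenspace c, fun g u hu => by
    rw [Module.End.mem_eigenspace_iff] at hu ⊢
    rw [hf, hu, map_smul]⟩
  refine ⟨c, fun u => ?_⟩
  rcases hρ.eq_bot_or_eq_top σ with h | h
  · exact absurd (congrArg Subrepresentation.toSubmodule h) hc
  · have : u ∈ σ.toSubmodule := by rw [h]; exact Submodule.mem_top
    exact Module.End.mem_eigenspace_iff.1 this

/-! ### Modules with a finite filtration by standard modules -/

section Filtration

variable {R : Type u} [CommRing R] [Algebra ℂ R]
variable {n d : ℕ} [NeZero d] {κ : Fin (d - 1) → R} {h : R}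

theorem hasFiniteDeltaFiltration_of_subsingleton (P : Type u) [AddCommGroup P]
    [Module (Cherednik n κ h) P] [Subsingleton P] : HasFiniteDeltaFiltration n κ h P :=
  ⟨0, fun _ => ⊥, rfl, Subsingleton.elim _ _, fun i => i.elim0⟩

/-- The subquotients of a chain do not change under pullback along a surjection. -/
theorem nonempty_quotient_comap_equiv {A : Type*} [Ring A] {P P' : Type*} [AddCommGroup P]
    [Module A P] [AddCommGroup P'] [Module A P'] (π : P →ₗ[A] P') (hπ : Function.Surjective π)
    (F G : Submodule A P') :
    Nonempty ((F.comap π ⧸ (G.comap π).submoduleOf (F.comap π)) ≃ₗ[A] F ⧸ G.submoduleOf F) := by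
  let f : F.comap π →ₗ[A] F ⧸ G.submoduleOf F :=
    (G.submoduleOf F).mkQ ∘ₗ π.restrict fun x hx => hx
  have hf : Function.Surjective f := by
    refine (Submodule.mkQ_surjective _).comp ?_
    rintro ⟨x, hx⟩
    obtain ⟨y, rfl⟩ := hπ x
    exact ⟨⟨y, hx⟩, rfl⟩
  have hker : (G.comap π).submoduleOf (F.comap π) = LinearMap.ker f := by
    rw [LinearMap.ker_comp, Submodule.ker_mkQ]
    rfl
  exact ⟨(Submodule.quotEquivOfEq _ _ hker).trans (f.quotKerEquivOfSurjective hf)⟩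

theorem HasFiniteDeltaFiltration.of_equiv {P P' : Type u} [AddCommGroup P]
    [Module (Cherednik n κ h) P] [AddCommGroup P'] [Module (Cherednik n κ h) P']
    (hP' : HasFiniteDeltaFiltration n κ h P') (π : P ≃ₗ[Cherednik n κ h] P') :
    HasFiniteDeltaFiltration n κ h P := by
  obtain ⟨r, F, hF0, hF1, hF⟩ := hP'
  refine ⟨r, fun i => (F i).comap π.toLinearMap, ?_, ?_, fun i => ⟨?_, ?_⟩⟩
  · beta_reduce; rw [hF0]; exact π.ker
  · beta_reduce; rw [hF1]; rfl
  · exact Submodule.comap_mono (hF i).1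
  · obtain ⟨-, E, iE, mE, ρ, hρ, ⟨e⟩⟩ := hF i
    obtain ⟨e'⟩ := nonempty_quotient_comap_equiv π.toLinearMap π.surjective (F i.succ)
      (F i.castSucc)
    exact ⟨E, iE, mE, ρ, hρ, ⟨e'.trans e⟩⟩

/-- An extension of a module with a finite `Δ`-filtration by a standard module has one. -/
theorem HasFiniteDeltaFiltration.of_exact {K P P' : Type u} [AddCommGroup K]
    [Module (Cherednik n κ h) K] [AddCommGroup P]
    [Module (Cherednik n κ h) P] [AddCommGroup P'] [Module (Cherednik n κ h) P']
    (hP' : HasFiniteDeltaFiltration n κ h P') (ι : K →ₗ[Cherednik n κ h] P)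
    (π : P →ₗ[Cherednik n κ h] P') (hι : Function.Injective ι) (hπ : Function.Surjective π)
    (hex : Function.Exact ι π) {E : Type} [AddCommGroup E] [Module ℂ E]
    {ρ : Representation ℂ (W n d) E} (hρ : ρ.IsIrreducible)
    (hK : Nonempty (K ≃ₗ[Cherednik n κ h] Delta κ h ρ)) : HasFiniteDeltaFiltration n κ h P := by
  obtain ⟨r, F, hF0, hF1, hF⟩ := hP'
  let F' : Fin (r + 2) → Submodule (Cherednik n κ h) P :=
    Fin.cons ⊥ fun i => (F i).comap π
  have hs : ∀ i : Fin (r + 1), F' i.succ = (F i).comap π := fun i => Fin.cons_succ _ _ _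
  have h0 : F' 0 = ⊥ := Fin.cons_zero _ _
  refine ⟨r + 1, F', h0, ?_, fun i => ?_⟩
  · rw [← Fin.succ_last, hs, hF1]; rfl
  · rw [hs]
    induction i using Fin.cases with
    | zero =>
      rw [Fin.castSucc_zero, h0, hF0]
      refine ⟨bot_le, E, _, _, ρ, hρ, ?_⟩
      obtain ⟨e⟩ := hK
      have hbot : (⊥ : Submodule (Cherednik n κ h) P).submoduleOf (Submodule.comap π ⊥) = ⊥ :=
        Submodule.ker_subtype _
      have hr : LinearMap.range ι = Submodule.comap π ⊥ := (LinearMap.exact_iff.1 hex).symm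
      exact ⟨(Submodule.quotEquivOfEqBot _ hbot).trans
        ((LinearEquiv.ofEq _ _ hr.symm).trans ((LinearEquiv.ofInjective ι hι).symm.trans e))⟩
    | succ j =>
      rw [← Fin.succ_castSucc, hs]
      obtain ⟨hle, E', iE, mE, ρ', hρ', ⟨e⟩⟩ := hF j
      obtain ⟨e'⟩ := nonempty_quotient_comap_equiv π hπ (F j.succ) (F j.castSucc)
      exact ⟨Submodule.comap_mono hle, E', iE, mE, ρ', hρ', ⟨e'.trans e⟩⟩

end Filtration

/-! ### The Euler endomorphism of an induced module -/

namespace Ind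

variable {R : Type u} [CommRing R] [Algebra ℂ R]
variable {n d : ℕ} [NeZero d] (κ : Fin (d - 1) → R) (h : R)
variable {X : Type} [AddCommGroup X] [Module ℂ X] (D : BorelRep n d X)
variable {X' : Type} [AddCommGroup X'] [Module ℂ X'] (D' : BorelRep n d X')

/-- The failure of `eu` to commute with `V` is compensated by the degree operator on `X`, so that
`u ↦ eu u + deg u` satisfies the conditions of the universal property. -/
theorem exists_eulerEnd : ∃ T : Ind κ h D →ₗ[Cherednik n κ h] Ind κ h D,
    ∀ u, T (gen κ h D u) = Cherednik.euler n κ h • gen κ h D u + gen κ h D (D.deg u) := by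
  refine exists_lift (AddMonoidHom.mk' (fun u => Cherednik.euler n κ h • gen κ h D u +
    gen κ h D (D.deg u)) fun u u' => ?_) (fun c u => ?_) (fun y u => ?_) (fun w u => ?_)
  · simp only [map_add, smul_add]
    abel
  · simp only [AddMonoidHom.mk'_apply, map_smul, gen_smul, smul_add, ← mul_smul, Algebra.commutes]
  · simp only [AddMonoidHom.mk'_apply, D.deg_act, map_add, smul_add, ← vec_smul_gen, ← mul_smul,
      ← Cherednik.euler_mul_vec, add_mul, one_mul, add_smul]
    abel
  · simp only [AddMonoidHom.mk'_apply, ← D.ρ_deg, smul_add, ← grp_smul_gen, ← mul_smul,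
      Cherednik.euler_mul_grp]

/-- The endomorphism of an induced module given on `X` by `eu + deg`. -/
def eulerEnd : Module.End (Cherednik n κ h) (Ind κ h D) := (exists_eulerEnd κ h D).choose

theorem eulerEnd_gen (u : X) : eulerEnd κ h D (gen κ h D u) =
    Cherednik.euler n κ h • gen κ h D u + gen κ h D (D.deg u) :=
  (exists_eulerEnd κ h D).choose_spec u

variable {D D'} in
theorem exists_map (f : X →ₗ[ℂ] X') (hρ : ∀ w u, f (D.ρ w u) = D'.ρ w (f u))
    (hact : ∀ y u, f (D.act y u) = D'.act y (f u)) (hdeg : ∀ u, f (D.deg u) = D'.deg (f u)) :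
    ∃ F : Ind κ h D →ₗ[Cherednik n κ h] Ind κ h D',
      ⇑F = LinearMap.lTensor R (LinearMap.rTensor (Poly n) f) ∧
      (∀ u, F (gen κ h D u) = gen κ h D' (f u)) ∧
      ∀ m, F (eulerEnd κ h D m) = eulerEnd κ h D' (F m) := by
  obtain ⟨F, hF⟩ := exists_lift (D := D) (κ := κ) (h := h) ((gen κ h D').comp f.toAddMonoidHom)
    (fun c u => by simp [gen_smul]) (fun y u => by simp [hact, vec_smul_gen])
    (fun w u => by simp [hρ, grp_smul_gen])
  have hF' : ∀ u, F (gen κ h D u) = gen κ h D' (f u) := hF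
  refine ⟨F, ?_, hF', ?_⟩
  · let G : PolyTensor R n X →ₗ[R] PolyTensor R n X' :=
      LinearMap.baseChange R (LinearMap.rTensor (Poly n) f)
    let F0 : PolyTensor R n X →ₗ[R] PolyTensor R n X' :=
      { toFun := F
        map_add' := F.map_add
        map_smul' := fun r m => by
          have : ∀ m : Ind κ h D, F (r • m) = r • F m := fun m => by
            rw [← algebraMap_smul (Cherednik n κ h) r m, map_smul, algebraMap_smul]
          exact this m }
    have : F0 = G := by
      refine polyTensor_hom_ext (fun i m => mulOp R X' (coord i) m) (fun i m => ?_)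
        (fun i m => ?_) hF'
      · exact (congrArg F (cov_smul κ h D (coord i) m).symm).trans
          ((map_smul F _ _).trans (cov_smul κ h D' (coord i) _))
      · have : G ∘ₗ mulOp R X (coord i) = mulOp R X' (coord i) ∘ₗ G :=
          hom_ext_mk fun r u p => rfl
        exact LinearMap.congr_fun this m
    funext m
    exact LinearMap.congr_fun this m
  · have : F ∘ₗ eulerEnd κ h D = eulerEnd κ h D' ∘ₗ F := by
      refine hom_ext fun u => ?_
      rw [LinearMap.comp_apply, LinearMap.comp_apply, eulerEnd_gen, hF', eulerEnd_gen, map_add,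
        map_smul, hF', hF', hdeg]
    exact fun m => LinearMap.congr_fun this m

/-- On the standard module of an irreducible representation, the Euler endomorphism is a scalar.
The class function `b` enters through averages over conjugacy classes, on which Schur's lemma
applies over `ℂ`. -/
theorem exists_eulerEnd_eq_smul [FiniteDimensional ℂ X] [Nontrivial X]
    (hρ : D.ρ.IsIrreducible) (hact : ∀ y u, D.act y u = 0) (c : ℂ)
    (hdeg : ∀ u, D.deg u = c • u) : ∃ r : R, ∀ m, eulerEnd κ h D m = r • m := by
  have hschur : ∀ w : W n d, ∃ c : ℂ, ∀ u, (∑ g : W n d, D.ρ (g * w * g⁻¹)) u = c • u := by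
    intro w
    refine exists_eq_smul_of_isIrreducible D.ρ hρ _ fun g u => ?_
    rw [LinearMap.sum_apply, LinearMap.sum_apply, map_sum]
    refine (Fintype.sum_equiv (Equiv.mulLeft g) _ _ fun k => ?_).symm
    rw [Equiv.coe_mulLeft, ← Module.End.mul_apply, ← Module.End.mul_apply, ← map_mul, ← map_mul]
    congr 2
    group
  choose lam hlam using hschur
  have hcard : (Fintype.card (W n d) : ℂ) ≠ 0 := Nat.cast_ne_zero.2 Fintype.card_ne_zero
  have hz : ∀ u, (Fintype.card (W n d) : R) • ∑ w : W n d, reflCoeff κ h w • gen κ h D (D.ρ w u) =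
      (∑ w : W n d, reflCoeff κ h w * algebraMap ℂ R (lam w)) • gen κ h D u := by
    intro u
    have h1 : ∀ g : W n d, ∑ w : W n d, reflCoeff κ h w • gen κ h D (D.ρ w u) =
        ∑ w : W n d, reflCoeff κ h w • gen κ h D (D.ρ (g * w * g⁻¹) u) := by
      intro g
      refine (Fintype.sum_equiv (MulAut.conj g).toEquiv _ _ fun w => ?_).symm
      have hc : (MulAut.conj g).toEquiv w = g * w * g⁻¹ := rfl
      rw [hc, reflCoeff_conj]
    have h2 : (Fintype.card (W n d) : R) • ∑ w : W n d, reflCoeff κ h w • gen κ h D (D.ρ w u) =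
        ∑ _g : W n d, ∑ w : W n d, reflCoeff κ h w • gen κ h D (D.ρ w u) := by
      rw [Finset.sum_const, Finset.card_univ, Nat.cast_smul_eq_nsmul]
    rw [h2, Finset.sum_congr rfl fun g _ => h1 g, Finset.sum_comm, Finset.sum_smul]
    refine Finset.sum_congr rfl fun w _ => ?_
    rw [← Finset.smul_sum, ← map_sum, ← LinearMap.sum_apply, hlam, gen_smul, algebraMap_smul,
      mul_smul]
  refine ⟨algebraMap ℂ R (Fintype.card (W n d) : ℂ)⁻¹ *
    (∑ w : W n d, reflCoeff κ h w * algebraMap ℂ R (lam w)) + algebraMap ℂ R c, ?_⟩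
  have key : ∀ u, eulerEnd κ h D (gen κ h D u) = (algebraMap ℂ R (Fintype.card (W n d) : ℂ)⁻¹ *
      (∑ w : W n d, reflCoeff κ h w * algebraMap ℂ R (lam w)) + algebraMap ℂ R c) •
        gen κ h D u := by
    intro u
    have hinv : algebraMap ℂ R (Fintype.card (W n d) : ℂ)⁻¹ * (Fintype.card (W n d) : R) = 1 := by
      rw [← map_natCast (algebraMap ℂ R), ← map_mul, inv_mul_cancel₀ hcard, map_one]
    rw [eulerEnd_gen, hdeg, gen_smul, algebraMap_smul, add_smul, mul_smul, ← hz, ← mul_smul, hinv,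
      one_smul, Cherednik.euler, add_smul, Finset.sum_smul, Finset.sum_smul]
    simp only [mul_smul, vec_smul_gen, hact, map_zero, smul_zero, Finset.sum_const_zero, zero_add,
      smul_assoc, grp_smul_gen]
  intro m
  let S : Module.End (Cherednik n κ h) (Ind κ h D) := algebraMap R _
    (algebraMap ℂ R (Fintype.card (W n d) : ℂ)⁻¹ *
      (∑ w : W n d, reflCoeff κ h w * algebraMap ℂ R (lam w)) + algebraMap ℂ R c)
  have : eulerEnd κ h D = S := hom_ext key
  rw [this]
  rfl

end Ind

end
end RationalCherednik

namespace RationalCherednik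
noncomputable section

open TensorProduct PolyTensor Polynomial

/-! ### The filtration of the spectral summands of an induced module -/

section

variable {R A M M' : Type*} [CommRing R] [Ring A] [Algebra R A]
  [AddCommGroup M] [Module R M] [Module A M] [IsScalarTower R A M]
  [AddCommGroup M'] [Module R M'] [Module A M'] [IsScalarTower R A M']

/-- Linear maps that intertwine two endomorphisms intertwine all polynomials in them. -/
theorem map_aeval_apply (f : M →ₗ[A] M') {T : Module.End A M} {T' : Module.End A M'}
    (hf : ∀ m, f (T m) = T' (f m)) (p : R[X]) (m : M) :
    f (aeval T p m) = aeval T' p (f m) := by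
  induction p using Polynomial.induction_on generalizing m with
  | C r =>
    rw [aeval_C, aeval_C, Module.algebraMap_end_apply, Module.algebraMap_end_apply,
      ← algebraMap_smul A r m, map_smul, algebraMap_smul]
  | add p q hp hq => simp only [map_add, LinearMap.add_apply, hp, hq]
  | monomial k r ih =>
    rw [pow_succ, ← mul_assoc, map_mul (aeval T) (C r * X ^ k) X,
      map_mul (aeval T') (C r * X ^ k) X,
      Module.End.mul_apply, Module.End.mul_apply, ih, aeval_X, aeval_X, hf]

theorem aeval_apply_of_eq_smul {T : Module.End A M} {r : R} (hT : ∀ m, T m = r • m) (p : R[X])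
    (m : M) : aeval T p m = p.eval r • m := by
  have : T = algebraMap R (Module.End A M) r := LinearMap.ext hT
  rw [this, aeval_algebraMap_apply, Module.algebraMap_end_apply, coe_aeval_eq_eval]

end

/-- The product `∏ (t - c)` over a multiset of scalars. -/
def splitPoly {R : Type*} [CommRing R] (s : Multiset R) : R[X] := (s.map fun c => X - C c).prod

theorem splitPoly_cons {R : Type*} [CommRing R] (c : R) (s : Multiset R) :
    splitPoly (c ::ₘ s) = (X - C c) * splitPoly s := by
  simp [splitPoly]

theorem splitPoly_add {R : Type*} [CommRing R] (s s' : Multiset R) :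
    splitPoly (s + s') = splitPoly s * splitPoly s' := by
  simp [splitPoly]

namespace Ind

variable {R : Type u} [CommRing R] [Algebra ℂ R] [IsLocalRing R]
variable {n d : ℕ} [NeZero d] (κ : Fin (d - 1) → R) (h : R)

/-- The two properties of the Euler endomorphism `T` of an induced module that are proved by
induction along a composition series of `X`: it is annihilated by a product of linear factors
`T - c`, and the image of every idempotent `p(T)` has a finite `Δ`-filtration. On the standard
module `Δ(E)` of a composition factor, `T` is a scalar `c`, and an idempotent `p(c)` of the local
ring `R` is `0` or `1`, so that `p(T)` keeps or discards `Δ(E)` as a whole. -/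
theorem eulerEnd_induction (k : ℕ) : ∀ (X : Type) [AddCommGroup X] [Module ℂ X]
    [FiniteDimensional ℂ X], Module.finrank ℂ X = k → ∀ D : BorelRep n d X,
    (∃ s : Multiset R, aeval (eulerEnd κ h D) (splitPoly s) = 0) ∧
    ∀ p : R[X], IsIdempotentElem (aeval (eulerEnd κ h D) p) →
      HasFiniteDeltaFiltration n κ h (LinearMap.range (aeval (eulerEnd κ h D) p)) := by
  induction k using Nat.strong_induction_on with
  | _ k ih =>
  intro X _ _ _ hk D
  rcases subsingleton_or_nontrivial X with hX | hX
  · have : Subsingleton (Ind κ h D) := by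
      refine ⟨fun m m' => ?_⟩
      have : ∀ m : PolyTensor R n X, m = 0 := fun m =>
        PolyTensor.induction (p := fun m => m = 0) rfl (fun x y hx hy => by rw [hx, hy, add_zero])
          (fun r u f => by
            rw [Subsingleton.elim u ((0 : ℂ) • u), mk_smul_left, map_zero, zero_smul]) m
      exact (this m).trans (this m').symm
    exact ⟨⟨0, LinearMap.ext fun m => Subsingleton.elim _ _⟩,
      fun p _ => hasFiniteDeltaFiltration_of_subsingleton _⟩
  obtain ⟨E, c, hE, hρ, hact0, hdegc, hmin⟩ := D.exists_irreducible_submodule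
  have hact : ∀ y, ∀ u ∈ E, D.act y u ∈ E := fun y u hu => by
    rw [hact0 y u hu]; exact E.zero_mem
  have hdeg : ∀ u ∈ E, D.deg u ∈ E := fun u hu => by
    rw [hdegc u hu]; exact E.smul_mem c hu
  have hirr := D.sub_isIrreducible hE hρ hact hdeg hmin
  have hEnt : Nontrivial E := Submodule.nontrivial_iff_ne_bot.2 hE
  obtain ⟨r, hr⟩ := exists_eulerEnd_eq_smul κ h (D.sub E hρ hact hdeg) hirr
    (fun y u => Subtype.ext (hact0 y u u.2)) c (fun u => Subtype.ext (hdegc u u.2))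
  obtain ⟨i, hi, -, hiT⟩ := exists_map κ h (D := D.sub E hρ hact hdeg) (D' := D) E.subtype
    (fun w u => rfl) (fun y u => rfl) (fun u => rfl)
  obtain ⟨q, hq, -, hqT⟩ := exists_map κ h (D := D) (D' := D.quot E hρ hact hdeg) E.mkQ
    (fun w u => rfl) (fun y u => rfl) (fun u => rfl)
  -- Induction is exact, because the induced module is `R ⊗ X ⊗ S(V*)` as an `R`-module.
  have hinj : Function.Injective i := by
    rw [hi]
    exact Module.Flat.lTensor_preserves_injective_linearMap _
      (Module.Flat.rTensor_preserves_injective_linearMap _ E.subtype_injective)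
  have hsurj : Function.Surjective q := by
    rw [hq]
    exact LinearMap.lTensor_surjective _ (LinearMap.rTensor_surjective _ E.mkQ_surjective)
  have hexact : Function.Exact i q := by
    rw [hi, hq]
    exact lTensor_exact R (rTensor_exact _ (LinearMap.exact_subtype_mkQ E) E.mkQ_surjective)
      (LinearMap.rTensor_surjective _ E.mkQ_surjective)
  have hlt : Module.finrank ℂ (X ⧸ E) < k := by
    have h1 := E.finrank_quotient_add_finrank
    have h2 : 0 < Module.finrank ℂ E := Module.finrank_pos
    omega
  obtain ⟨⟨s, hs⟩, hfil⟩ := ih _ hlt (X ⧸ E) rfl (D.quot E hρ hact hdeg)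
  have hei : ∀ (p : R[X]) m, aeval (eulerEnd κ h D) p (i m) = i (p.eval r • m) := by
    intro p m
    rw [← map_aeval_apply i hiT, aeval_apply_of_eq_smul hr]
  refine ⟨⟨r ::ₘ s, LinearMap.ext fun m => ?_⟩, fun p hp => ?_⟩
  -- `∏ (T - c)` over `s` maps to the submodule induced from `E`, on which `T = r`.
  · rw [splitPoly_cons, map_mul, Module.End.mul_apply]
    obtain ⟨m', hm'⟩ := (hexact (aeval (eulerEnd κ h D) (splitPoly s) m)).1 (by
      rw [map_aeval_apply q hqT, hs, LinearMap.zero_apply])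
    rw [← hm', hei, eval_sub, eval_X, eval_C, sub_self, zero_smul, map_zero, LinearMap.zero_apply]
  · have hpp : ∀ m, aeval (eulerEnd κ h D) p (aeval (eulerEnd κ h D) p m) =
        aeval (eulerEnd κ h D) p m := fun m => LinearMap.congr_fun hp m
    have hpq : IsIdempotentElem (aeval (eulerEnd κ h (D.quot E hρ hact hdeg)) p) := by
      refine LinearMap.ext fun m => ?_
      obtain ⟨m, rfl⟩ := hsurj m
      rw [Module.End.mul_apply, ← map_aeval_apply q hqT, ← map_aeval_apply q hqT, hpp]
    have hP' := hfil p hpq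
    let π : LinearMap.range (aeval (eulerEnd κ h D) p) →ₗ[Cherednik n κ h]
        LinearMap.range (aeval (eulerEnd κ h (D.quot E hρ hact hdeg)) p) :=
      q.restrict (by
        rintro _ ⟨m, rfl⟩
        exact ⟨q m, (map_aeval_apply q hqT p m).symm⟩)
    have hπ : Function.Surjective π := by
      rintro ⟨_, m, rfl⟩
      obtain ⟨m, rfl⟩ := hsurj m
      exact ⟨⟨_, m, rfl⟩, Subtype.ext (map_aeval_apply q hqT p m)⟩
    have hidem : ∀ m : Ind κ h (D.sub E hρ hact hdeg),
        p.eval r • p.eval r • m = p.eval r • m := by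
      intro m
      refine hinj ?_
      rw [← hei, ← hei, hpp]
    -- `p(r)` acts as an idempotent on the submodule induced from `E`: by the identity if `p(r)` is
    -- a unit, and by zero otherwise.
    rcases IsLocalRing.isUnit_or_isUnit_one_sub_self (p.eval r) with hu | hu
    · have hid : ∀ m : Ind κ h (D.sub E hρ hact hdeg), p.eval r • m = m := fun m =>
        hu.smul_left_cancel.1 (hidem m)
      let ι : Ind κ h (D.sub E hρ hact hdeg) →ₗ[Cherednik n κ h]
          LinearMap.range (aeval (eulerEnd κ h D) p) :=
        i.codRestrict _ fun m => ⟨i m, by rw [hei, hid]⟩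
      refine hP'.of_exact ι π (fun a b hab => hinj (congrArg Subtype.val hab)) hπ ?_ hirr
        (nonempty_equiv_delta (fun y u => Subtype.ext (hact0 y u u.2)))
      rintro ⟨m, hm⟩
      constructor
      · intro h0
        obtain ⟨a, ha⟩ := (hexact m).1 (congrArg Subtype.val h0)
        exact ⟨a, Subtype.ext ha⟩
      · rintro ⟨a, ha⟩
        exact Subtype.ext ((hexact m).2 ⟨a, congrArg Subtype.val ha⟩)
    · have hzero : ∀ m : Ind κ h (D.sub E hρ hact hdeg), p.eval r • m = 0 := fun m => by
        refine hu.smul_left_cancel.1 ?_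
        rw [sub_smul, one_smul, hidem, sub_self, smul_zero]
      have hπi : Function.Injective π := by
        rw [injective_iff_map_eq_zero]
        rintro ⟨_, m, rfl⟩ h0
        obtain ⟨a, ha⟩ := (hexact _).1 (congrArg Subtype.val h0)
        refine Subtype.ext ?_
        change aeval (eulerEnd κ h D) p m = 0
        have ha' : i a = aeval (eulerEnd κ h D) p m := ha
        rw [← hpp, ← ha', hei, hzero, map_zero]
      exact hP'.of_equiv (LinearEquiv.ofBijective π ⟨hπi, hπ⟩)

end Ind

end
end RationalCherednik

namespace RationalCherednik
noncomputable section

open MvPolynomial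

/-! ### The representations `S(V)/I^N ⊗ ℂW` -/

/-- The inclusion `V ⊆ S(V)`, where `S(V)` is the polynomial algebra with the variable `X i` for
`e_i`. -/
def vecPoly {n : ℕ} : V n →ₗ[ℂ] MvPolynomial (Fin n) ℂ := Fintype.linearCombination ℂ X

theorem vecPoly_single {n : ℕ} (i : Fin n) : vecPoly (Pi.single i 1 : V n) = X i := by
  simp [vecPoly]

theorem map_eq_of_map_single {n : ℕ} {M : Type*} [AddCommGroup M] [Module ℂ M]
    {f g : V n →ₗ[ℂ] M} (hfg : ∀ i, f (Pi.single i 1) = g (Pi.single i 1)) (y : V n) :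
    f y = g y :=
  LinearMap.congr_fun (LinearMap.pi_ext' fun i => LinearMap.ext_ring (hfg i)) y

/-- The action of `W` on `S(V)` by algebra automorphisms. -/
def symAct {n d : ℕ} (w : W n d) : MvPolynomial (Fin n) ℂ →ₐ[ℂ] MvPolynomial (Fin n) ℂ :=
  aeval fun i => vecPoly ((w : V n ≃ₗ[ℂ] V n) (Pi.single i 1))

theorem symAct_vecPoly {n d : ℕ} (w : W n d) (y : V n) :
    symAct w (vecPoly y) = vecPoly ((w : V n ≃ₗ[ℂ] V n) y) :=
  map_eq_of_map_single (f := (symAct w).toLinearMap ∘ₗ vecPoly)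
    (g := vecPoly ∘ₗ (w : V n ≃ₗ[ℂ] V n).toLinearMap)
    (fun i => by simp [vecPoly_single, symAct]) y

theorem symAct_one {n d : ℕ} (f : MvPolynomial (Fin n) ℂ) : symAct (1 : W n d) f = f := by
  have : symAct (1 : W n d) = AlgHom.id ℂ _ := by
    refine algHom_ext fun i => ?_
    rw [← vecPoly_single, symAct_vecPoly, W.coe_one_apply]; rfl
  rw [this]; rfl

theorem symAct_mul {n d : ℕ} (w w' : W n d) (f : MvPolynomial (Fin n) ℂ) :
    symAct (w * w') f = symAct w (symAct w' f) := by
  have : symAct (w * w') = (symAct w).comp (symAct w') := by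
    refine algHom_ext fun i => ?_
    rw [AlgHom.comp_apply, ← vecPoly_single, symAct_vecPoly, symAct_vecPoly, symAct_vecPoly,
      W.coe_mul_apply]
  rw [this]; rfl

/-- The degree derivation of a polynomial algebra, with `X i ↦ X i`. -/
def degDer (n : ℕ) : Derivation ℂ (MvPolynomial (Fin n) ℂ) (MvPolynomial (Fin n) ℂ) :=
  mkDerivation ℂ X

theorem degDer_vecPoly {n : ℕ} (y : V n) : degDer n (vecPoly y) = vecPoly y :=
  map_eq_of_map_single (f := (degDer n).toLinearMap ∘ₗ vecPoly) (g := vecPoly)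
    (fun i => by simp [vecPoly_single, degDer, mkDerivation_X]) y

theorem symAct_degDer {n d : ℕ} (w : W n d) (f : MvPolynomial (Fin n) ℂ) :
    symAct w (degDer n f) = degDer n (symAct w f) := by
  induction f using MvPolynomial.induction_on with
  | C c => simp [degDer, symAct]
  | add p q hp hq => simp only [map_add, hp, hq]
  | mul_X p i hp =>
    rw [← vecPoly_single, Derivation.leibniz, map_mul, Derivation.leibniz, symAct_vecPoly,
      degDer_vecPoly, degDer_vecPoly]
    simp only [smul_eq_mul, map_add, map_mul, symAct_vecPoly, hp]

theorem vecPoly_mem_idealOfVars {n : ℕ} (y : V n) : vecPoly y ∈ idealOfVars (Fin n) ℂ := by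
  rw [vecPoly, Fintype.linearCombination_apply]
  refine sum_mem fun i _ => ?_
  rw [smul_eq_C_mul]
  exact Ideal.mul_mem_left _ _ (Ideal.subset_span ⟨i, rfl⟩)

theorem symAct_mem_pow {n d : ℕ} (w : W n d) {N : ℕ} {f : MvPolynomial (Fin n) ℂ}
    (hf : f ∈ idealOfVars (Fin n) ℂ ^ N) : symAct w f ∈ idealOfVars (Fin n) ℂ ^ N := by
  have h1 : (idealOfVars (Fin n) ℂ).map (symAct w) ≤ idealOfVars (Fin n) ℂ := by
    rw [idealOfVars, Ideal.map_span, Ideal.span_le]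
    rintro _ ⟨_, ⟨i, rfl⟩, rfl⟩
    rw [SetLike.mem_coe, ← vecPoly_single, symAct_vecPoly]
    exact vecPoly_mem_idealOfVars _
  have h2 := Ideal.mem_map_of_mem (symAct w) hf
  rw [Ideal.map_pow] at h2
  exact Ideal.pow_right_mono h1 N h2

theorem degDer_mem {n : ℕ} (f : MvPolynomial (Fin n) ℂ) : degDer n f ∈ idealOfVars (Fin n) ℂ := by
  induction f using MvPolynomial.induction_on with
  | C c => simp [degDer]
  | add p q hp hq => rw [map_add]; exact add_mem hp hq
  | mul_X p i hp =>
    rw [← vecPoly_single, Derivation.leibniz, degDer_vecPoly]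
    exact add_mem (Ideal.mul_mem_left _ _ (vecPoly_mem_idealOfVars _)) (Ideal.mul_mem_left _ _ hp)

theorem degDer_mem_pow {n N : ℕ} {f : MvPolynomial (Fin n) ℂ}
    (hf : f ∈ idealOfVars (Fin n) ℂ ^ N) : degDer n f ∈ idealOfVars (Fin n) ℂ ^ N := by
  induction N generalizing f with
  | zero => simp
  | succ N ih =>
    rw [pow_succ] at hf ⊢
    refine Submodule.mul_induction_on hf (fun a ha b hb => ?_) (fun a b ha hb => ?_)
    · rw [Derivation.leibniz, smul_eq_mul, smul_eq_mul, mul_comm b]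
      exact add_mem (Ideal.mul_mem_mul ha (degDer_mem b)) (Ideal.mul_mem_mul (ih ha) hb)
    · rw [map_add]; exact add_mem ha hb

theorem degDer_vecPoly_mul {n : ℕ} (y : V n) (f : MvPolynomial (Fin n) ℂ) :
    degDer n (vecPoly y * f) = vecPoly y * degDer n f + vecPoly y * f := by
  rw [Derivation.leibniz, degDer_vecPoly, smul_eq_mul, smul_eq_mul, mul_comm f]

variable (n d : ℕ)

/-- The structure on `S(V) ⊗ ℂW = S(V) ♯ W`, the regular representation of `S(V) ♯ W`. The element
`∑ f_w ⊗ w` is encoded as the function `w ↦ f_w`. -/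
def regRep : BorelRep n d (W n d → MvPolynomial (Fin n) ℂ) where
  ρ :=
    { toFun := fun w => LinearMap.pi fun v => (symAct w).toLinearMap ∘ₗ LinearMap.proj (w⁻¹ * v)
      map_one' := by
        refine LinearMap.ext fun f => funext fun v => ?_
        simp [symAct_one]
      map_mul' := fun w w' => by
        refine LinearMap.ext fun f => funext fun v => ?_
        simp [symAct_mul, mul_assoc] }
  act :=
    { toFun := fun y => LinearMap.pi fun v => LinearMap.mulLeft ℂ (vecPoly y) ∘ₗ LinearMap.proj v
      map_add' := fun y y' => by
        refine LinearMap.ext fun f => funext fun v => ?_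
        simp [add_mul]
      map_smul' := fun c y => by
        refine LinearMap.ext fun f => funext fun v => ?_
        simp }
  deg := LinearMap.pi fun v => (degDer n).toLinearMap ∘ₗ LinearMap.proj v
  act_comm y y' f := funext fun v => mul_left_comm (vecPoly y) (vecPoly y') (f v)
  ρ_act w y f := funext fun v => by
    change symAct w (vecPoly y * f (w⁻¹ * v)) = _ * symAct w (f (w⁻¹ * v))
    rw [map_mul, symAct_vecPoly]
  ρ_deg w f := funext fun v => symAct_degDer w (f (w⁻¹ * v))
  deg_act y f := funext fun v => degDer_vecPoly_mul y (f v)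

/-- The subspace `I^N ⊗ ℂW`, with `I` the augmentation ideal of `S(V)`. -/
def augPow (N : ℕ) : Submodule ℂ (W n d → MvPolynomial (Fin n) ℂ) :=
  Submodule.pi Set.univ fun _ => (idealOfVars (Fin n) ℂ ^ N).restrictScalars ℂ

variable {n d} in
theorem mem_augPow {N : ℕ} {f : W n d → MvPolynomial (Fin n) ℂ} :
    f ∈ augPow n d N ↔ ∀ v, f v ∈ idealOfVars (Fin n) ℂ ^ N := by
  simp [augPow, Submodule.mem_pi]

/-- The structure on `S(V)/I^N ⊗ ℂW`. -/
def jetRep (N : ℕ) : BorelRep n d ((W n d → MvPolynomial (Fin n) ℂ) ⧸ augPow n d N) :=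
  (regRep n d).quot (augPow n d N)
    (fun w _ hf => mem_augPow.2 fun v => symAct_mem_pow w (mem_augPow.1 hf (w⁻¹ * v)))
    (fun _ _ hf => mem_augPow.2 fun v => Ideal.mul_mem_left _ _ (mem_augPow.1 hf v))
    (fun _ hf => mem_augPow.2 fun v => degDer_mem_pow (mem_augPow.1 hf v))

instance [NeZero d] (N : ℕ) :
    FiniteDimensional ℂ ((W n d → MvPolynomial (Fin n) ℂ) ⧸ augPow n d N) := by
  have hfin : {x : Fin n →₀ ℕ | x.degree < N}.Finite :=
    Finsupp.finite_of_degree_lt N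
  have := hfin.to_subtype
  let f : (W n d → MvPolynomial (Fin n) ℂ) →ₗ[ℂ] W n d × {x : Fin n →₀ ℕ | x.degree < N} → ℂ :=
    LinearMap.pi fun p => lcoeff ℂ p.2.1 ∘ₗ LinearMap.proj p.1
  have hf : LinearMap.ker f = augPow n d N := by
    ext g
    rw [mem_augPow, LinearMap.mem_ker, funext_iff]
    simp only [mem_pow_idealOfVars_iff']
    exact ⟨fun hg v x hx => hg ⟨v, x, hx⟩, fun hg p => hg p.1 p.2.1 p.2.2⟩
  exact Module.Finite.of_injective ((augPow n d N).liftQ f hf.ge)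
    (LinearMap.ker_eq_bot.1 (Submodule.ker_liftQ_eq_bot _ _ _ hf.le))

end
end RationalCherednik

namespace RationalCherednik
noncomputable section

open MvPolynomial

/-! ### The universal module with a vector killed by `I^N` -/

variable {R : Type u} [CommRing R] [Algebra ℂ R]
variable {n d : ℕ} [NeZero d] (κ : Fin (d - 1) → R) (h : R)

/-- The homomorphism `S(V) → H_R(κ, h)`. -/
def symHom : MvPolynomial (Fin n) ℂ →+* Cherednik n κ h :=
  (exists_ringHom_of_commute (R := R) (fun i => Cherednik.vec κ h (Pi.single i 1))
    fun _ _ => Cherednik.vec_comm κ h _ _).choose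

theorem symHom_C (c : ℂ) :
    symHom (n := n) κ h (C c) = algebraMap R (Cherednik n κ h) (algebraMap ℂ R c) :=
  (exists_ringHom_of_commute (R := R) (fun i => Cherednik.vec κ h (Pi.single i 1))
    fun _ _ => Cherednik.vec_comm κ h _ _).choose_spec.1 c

theorem symHom_X (i : Fin n) : symHom κ h (X i) = Cherednik.vec κ h (Pi.single i 1) :=
  (exists_ringHom_of_commute (R := R) (fun i => Cherednik.vec κ h (Pi.single i 1))
    fun _ _ => Cherednik.vec_comm κ h _ _).choose_spec.2 i

theorem symHom_vecPoly (y : V n) : symHom κ h (vecPoly y) = Cherednik.vec κ h y := by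
  rw [vecPoly, Fintype.linearCombination_apply, map_sum, Cherednik.vec_eq_sum κ h y]
  refine Finset.sum_congr rfl fun i _ => ?_
  rw [smul_eq_C_mul, map_mul, symHom_C, symHom_X, ← Algebra.smul_def]

theorem grp_mul_symHom (w : W n d) (f : MvPolynomial (Fin n) ℂ) :
    Cherednik.grp κ h w * symHom κ h f = symHom κ h (symAct w f) * Cherednik.grp κ h w := by
  induction f using MvPolynomial.induction_on with
  | C c =>
    rw [← algebraMap_eq, AlgHom.commutes, algebraMap_eq, symHom_C, Algebra.commutes]
  | add p q hp hq => rw [map_add, map_add, map_add, mul_add, add_mul, hp, hq]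
  | mul_X p i hp =>
    rw [← vecPoly_single, map_mul, map_mul, map_mul, symAct_vecPoly, symHom_vecPoly,
      symHom_vecPoly, ← mul_assoc, hp, mul_assoc, Cherednik.grp_mul_vec, mul_assoc]

section

variable {M : Type*} [AddCommGroup M] [Module (Cherednik n κ h) M]

variable (n) in
/-- The element `m` is annihilated by `I^N`, that is, by all products of `N` vectors. -/
def KilledByAugPow (N : ℕ) (m : M) : Prop :=
  ∀ l : List (V n), l.length = N → (l.map (Cherednik.vec κ h)).prod • m = 0

variable {κ h} in
theorem KilledByAugPow.symHom_smul {N : ℕ} {m : M} (hm : KilledByAugPow n κ h N m)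
    {f : MvPolynomial (Fin n) ℂ} (hf : f ∈ idealOfVars (Fin n) ℂ ^ N) :
    symHom κ h f • m = 0 := by
  have hle : idealOfVars (Fin n) ℂ ^ N ≤
      Ideal.comap (symHom κ h)
        (LinearMap.ker (LinearMap.toSpanSingleton (Cherednik n κ h) M m)) := by
    rw [idealOfVars, Ideal.span, Submodule.span_pow, Submodule.span_le]
    intro f hf
    obtain ⟨g, rfl⟩ := Set.mem_pow.1 hf
    choose i hi using fun k => (g k).2
    rw [SetLike.mem_coe, Ideal.mem_comap, LinearMap.mem_ker, LinearMap.toSpanSingleton_apply]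
    have := hm (List.ofFn fun k => Pi.single (i k) 1) (by simp)
    rw [List.map_ofFn] at this
    rw [map_list_prod, List.map_ofFn]
    have hcomp : (symHom κ h ∘ fun k => ((g k : _) : MvPolynomial (Fin n) ℂ)) =
        Cherednik.vec κ h ∘ fun k => Pi.single (i k) 1 :=
      funext fun k => by rw [Function.comp_apply, ← hi, symHom_X, Function.comp_apply]
    rwa [hcomp]
  exact hle hf

theorem KilledByAugPow.vec_smul {N : ℕ} {m : M} (hm : KilledByAugPow n κ h (N + 1) m) (y : V n) :
    KilledByAugPow n κ h N (Cherednik.vec κ h y • m) := by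
  intro l hl
  have := hm (l ++ [y]) (by simp [hl])
  simpa [mul_smul] using this

theorem killedByAugPow_succ_iff {N : ℕ} {m : M} :
    KilledByAugPow n κ h (N + 1) m ↔
      ∀ y : V n, KilledByAugPow n κ h N (Cherednik.vec κ h y • m) := by
  refine ⟨fun hm y => hm.vec_smul κ h y, fun hm l hl => ?_⟩
  obtain ⟨l', y, rfl⟩ : ∃ l' y, l = l' ++ [y] := by
    rcases List.eq_nil_or_concat l with rfl | ⟨l', y, rfl⟩
    · simp at hl
    · exact ⟨l', y, by simp⟩
  have := hm y l' (by simpa using hl)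
  simpa [mul_smul] using this

theorem killedByAugPow_zero_iff {m : M} : KilledByAugPow n κ h 0 m ↔ m = 0 := by
  refine ⟨fun hm => by simpa using hm [] rfl, ?_⟩
  rintro rfl l -
  exact smul_zero _

variable {κ h} in
theorem KilledByAugPow.add {N : ℕ} {m m' : M} (hm : KilledByAugPow n κ h N m)
    (hm' : KilledByAugPow n κ h N m') : KilledByAugPow n κ h N (m + m') := fun l hl => by
  rw [smul_add, hm l hl, hm' l hl, add_zero]

theorem killedByAugPow_zero_right (N : ℕ) : KilledByAugPow n κ h N (0 : M) :=
  fun _ _ => smul_zero _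

variable {κ h} in
theorem KilledByAugPow.algebraMap_smul {N : ℕ} {m : M} (hm : KilledByAugPow n κ h N m) (r : R) :
    KilledByAugPow n κ h N (algebraMap R (Cherednik n κ h) r • m) := fun l hl => by
  rw [← mul_smul, ← Algebra.commutes, mul_smul, hm l hl, smul_zero]

variable {κ h} in
theorem KilledByAugPow.grp_smul {N : ℕ} {m : M} (hm : KilledByAugPow n κ h N m) (w : W n d) :
    KilledByAugPow n κ h N (Cherednik.grp κ h w • m) := by
  induction N generalizing m with
  | zero =>
    rw [killedByAugPow_zero_iff] at hm ⊢
    rw [hm, smul_zero]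
  | succ N ih =>
    rw [killedByAugPow_succ_iff] at hm ⊢
    intro y
    have := ih (hm (((w⁻¹ : W n d) : V n ≃ₗ[ℂ] V n) y))
    rwa [← mul_smul, Cherednik.grp_mul_vec, W.apply_inv_apply, mul_smul] at this

variable {κ h} in
theorem KilledByAugPow.mono {N N' : ℕ} (hN : N ≤ N') {m : M} (hm : KilledByAugPow n κ h N m) :
    KilledByAugPow n κ h N' m := by
  intro l hl
  rw [← List.take_append_drop (N' - N) l, List.map_append, List.prod_append, mul_smul,
    hm (l.drop (N' - N)) (by rw [List.length_drop]; omega), smul_zero]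

variable {κ h} in
theorem KilledByAugPow.sum {ι : Type*} {s : Finset ι} {N : ℕ} {f : ι → M}
    (hf : ∀ i ∈ s, KilledByAugPow n κ h N (f i)) : KilledByAugPow n κ h N (∑ i ∈ s, f i) :=
  Finset.sum_induction f (KilledByAugPow n κ h N) (fun _ _ => KilledByAugPow.add)
    (killedByAugPow_zero_right κ h N) hf

variable {κ h} in
theorem KilledByAugPow.cov_smul {N : ℕ} {m : M} (hm : KilledByAugPow n κ h N m) (ξ : VDual n) :
    KilledByAugPow n κ h (N + 1) (Cherednik.cov κ h ξ • m) := by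
  induction N generalizing m with
  | zero =>
    rw [killedByAugPow_zero_iff] at hm
    rw [hm, smul_zero]
    exact killedByAugPow_zero_right κ h _
  | succ N ih =>
    rw [killedByAugPow_succ_iff]
    intro y
    rw [← mul_smul, Cherednik.vec_mul_cov, add_smul, add_smul, mul_smul, Finset.sum_smul]
    refine (ih (hm.vec_smul κ h y)).add
      ((hm.algebraMap_smul _).add (KilledByAugPow.sum fun w _ => ?_))
    rw [Algebra.smul_def, mul_smul]
    exact (hm.grp_smul w).algebraMap_smul _

variable (n M) in
/-- The submodule of the elements that are locally nilpotent over `S(V)`. -/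
def nilpotentPart : Submodule (Cherednik n κ h) M where
  carrier := {m | ∃ N, KilledByAugPow n κ h N m}
  zero_mem' := ⟨0, killedByAugPow_zero_right κ h 0⟩
  add_mem' := by
    rintro m m' ⟨N, hm⟩ ⟨N', hm'⟩
    exact ⟨max N N', (hm.mono (le_max_left _ _)).add (hm'.mono (le_max_right _ _))⟩
  smul_mem' := by
    intro a
    induction a using Cherednik.induction with
    | hR r => rintro m ⟨N, hm⟩; exact ⟨N, hm.algebraMap_smul r⟩
    | hvec y => rintro m ⟨N, hm⟩; exact ⟨N, (hm.mono N.le_succ).vec_smul κ h y⟩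
    | hcov ξ => rintro m ⟨N, hm⟩; exact ⟨N + 1, hm.cov_smul ξ⟩
    | hgrp w => rintro m ⟨N, hm⟩; exact ⟨N, hm.grp_smul w⟩
    | hadd a b ha hb =>
      intro m hm
      obtain ⟨N, hN⟩ := ha hm
      obtain ⟨N', hN'⟩ := hb hm
      rw [add_smul]
      exact ⟨max N N', (hN.mono (le_max_left _ _)).add (hN'.mono (le_max_right _ _))⟩
    | hmul a b ha hb => intro m hm; rw [mul_smul]; exact ha (hb hm)

/-- A module with a nonzero locally nilpotent element has a nonzero singular vector, that is, a
vector annihilated by `V`. -/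
theorem exists_singular {m : M} (hm : m ∈ nilpotentPart n κ h M) (h0 : m ≠ 0) :
    ∃ m' : M, m' ≠ 0 ∧ KilledByAugPow n κ h 1 m' := by
  obtain ⟨N, hN⟩ := hm
  induction N generalizing m with
  | zero => exact absurd ((killedByAugPow_zero_iff κ h).1 hN) h0
  | succ N ih =>
    by_cases hy : ∃ y : V n, Cherednik.vec κ h y • m ≠ 0
    · obtain ⟨y, hy⟩ := hy
      exact ih hy (hN.vec_smul κ h y)
    · push Not at hy
      refine ⟨m, h0, (killedByAugPow_succ_iff κ h).2 fun y => ?_⟩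
      rw [hy]
      exact killedByAugPow_zero_right κ h 0

theorem KilledByAugPow.map {M' : Type*} [AddCommGroup M'] [Module (Cherednik n κ h) M']
    (f : M →ₗ[Cherednik n κ h] M') {N : ℕ} {m : M} (hm : KilledByAugPow n κ h N m) :
    KilledByAugPow n κ h N (f m) := fun l hl => by
  rw [← map_smul, hm l hl, map_zero]

end

/-- The module `H_R(κ, h) ⊗_{S(V)} (S(V)/I^N ⊗ R)`, as an induced module. -/
abbrev Jet (n : ℕ) {d : ℕ} [NeZero d] (κ : Fin (d - 1) → R) (h : R) (N : ℕ) : Type u :=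
  Ind κ h (jetRep n d N)

namespace Jet

variable (n) in
open Classical in
/-- The canonical generator of `H_R(κ, h) ⊗_{S(V)} (S(V)/I^N ⊗ R)`. -/
def one (N : ℕ) : Jet n κ h N :=
  Ind.gen κ h (jetRep n d N) ((augPow n d N).mkQ (Pi.single 1 1))

theorem symHom_smul_gen (N : ℕ) (f : MvPolynomial (Fin n) ℂ) (u : W n d → MvPolynomial (Fin n) ℂ) :
    symHom κ h f • Ind.gen κ h (jetRep n d N) ((augPow n d N).mkQ u) =
      Ind.gen κ h (jetRep n d N) ((augPow n d N).mkQ (f • u)) := by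
  induction f using MvPolynomial.induction_on generalizing u with
  | C c =>
    rw [symHom_C, ← Ind.gen_smul, ← map_smul]
    congr 2
    ext1 v
    simp [smul_eq_C_mul]
  | add p q hp hq => rw [map_add, add_smul, add_smul, map_add, map_add, hp, hq]
  | mul_X p i hp =>
    rw [map_mul, mul_smul, ← vecPoly_single, symHom_vecPoly, Ind.vec_smul_gen, mul_smul, ← hp]
    rfl

open Classical in
theorem killedByAugPow_one (N : ℕ) : KilledByAugPow n κ h N (one n κ h N : Jet n κ h N) := by
  intro l hl
  have h1 : (l.map (Cherednik.vec κ h)).prod = symHom κ h (l.map vecPoly).prod := by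
    rw [map_list_prod, List.map_map]
    congr 2
    ext1 y
    exact (symHom_vecPoly κ h y).symm
  have h2 : (l.map vecPoly).prod ∈ idealOfVars (Fin n) ℂ ^ N := by
    rw [← hl]
    clear hl h1
    induction l with
    | nil => simp
    | cons y l ih =>
      rw [List.map_cons, List.prod_cons, List.length_cons, pow_succ']
      exact Ideal.mul_mem_mul (vecPoly_mem_idealOfVars y) ih
  rw [h1, one, symHom_smul_gen]
  have h3 : (augPow n d N).mkQ ((l.map vecPoly).prod • Pi.single 1 1) = 0 :=
    (Submodule.Quotient.mk_eq_zero _).2 (mem_augPow.2 fun v => Ideal.mul_mem_right _ _ h2)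
  rw [h3, map_zero]

/-- Maps out of the jet module are determined on its generator. -/
theorem hom_ext {M : Type*} [AddCommGroup M] [Module (Cherednik n κ h) M] {N : ℕ}
    {F G : Jet n κ h N →ₗ[Cherednik n κ h] M}
    (hFG : F (one n κ h N) = G (one n κ h N)) : F = G := by
  classical
  refine Ind.hom_ext fun u => ?_
  obtain ⟨u, rfl⟩ := (augPow n d N).mkQ_surjective u
  have hu : u = ∑ w : W n d, u w • (regRep n d).ρ w (Pi.single 1 1) := by
    funext v
    have : ∀ w : W n d, (u w • (regRep n d).ρ w (Pi.single 1 1)) v = if w = v then u w else 0 := by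
      intro w
      change u w * symAct w ((Pi.single 1 1 : W n d → MvPolynomial (Fin n) ℂ) (w⁻¹ * v)) = _
      by_cases hw : w = v
      · subst hw; simp
      · rw [Pi.single_eq_of_ne (by rwa [ne_eq, inv_mul_eq_one]), if_neg hw, map_zero, mul_zero]
    rw [Finset.sum_apply, Finset.sum_congr rfl fun w _ => this w]
    simp
  rw [hu, map_sum, map_sum, map_sum, map_sum]
  refine Finset.sum_congr rfl fun w _ => ?_
  have : Ind.gen κ h (jetRep n d N) ((augPow n d N).mkQ ((regRep n d).ρ w (Pi.single 1 1))) =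
      Cherednik.grp κ h w • one n κ h N := (Ind.grp_smul_gen κ h (jetRep n d N) w
      ((augPow n d N).mkQ (Pi.single 1 1))).symm
  rw [← symHom_smul_gen, this, map_smul, map_smul, map_smul, map_smul, hFG]

/-- The generator has degree zero, so that the Euler endomorphism is given on it by `eu` alone. -/
theorem eulerEnd_one (N : ℕ) :
    Ind.eulerEnd κ h (jetRep n d N) (one n κ h N) = Cherednik.euler n κ h • one n κ h N := by
  classical
  have h0 : (jetRep n d N).deg ((augPow n d N).mkQ (Pi.single 1 1)) = 0 := by
    refine (Submodule.Quotient.mk_eq_zero _).2 (mem_augPow.2 fun v => ?_)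
    have : degDer n ((Pi.single 1 1 : W n d → MvPolynomial (Fin n) ℂ) v) = 0 := by
      by_cases hv : v = 1
      · subst hv; simp
      · simp [hv]
    change degDer n ((Pi.single 1 1 : W n d → MvPolynomial (Fin n) ℂ) v) ∈ _
    rw [this]
    exact zero_mem _
  rw [one, Ind.eulerEnd_gen, h0, map_zero, add_zero]

/-- The universal property: `one` is the universal element annihilated by `I^N`. -/
theorem exists_lift {M : Type*} [AddCommGroup M] [Module (Cherednik n κ h) M] {N : ℕ} {m : M}
    (hm : KilledByAugPow n κ h N m) :
    ∃ F : Jet n κ h N →ₗ[Cherednik n κ h] M, F (one n κ h N) = m := by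
  classical
  let φ₀ : (W n d → MvPolynomial (Fin n) ℂ) →+ M := AddMonoidHom.mk'
    (fun u => ∑ w, symHom κ h (u w) • Cherednik.grp κ h w • m)
    (fun u u' => by simp only [Pi.add_apply, map_add, add_smul, Finset.sum_add_distrib])
  have hφ₀ : ∀ u, φ₀ u = ∑ w, symHom κ h (u w) • Cherednik.grp κ h w • m := fun _ => rfl
  let φ : ((W n d → MvPolynomial (Fin n) ℂ) ⧸ augPow n d N) →+ M :=
    QuotientAddGroup.lift (augPow n d N).toAddSubgroup φ₀ fun u hu => by
      rw [AddMonoidHom.mem_ker, hφ₀]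
      exact Finset.sum_eq_zero fun w _ => (hm.grp_smul w).symHom_smul (mem_augPow.1 hu w)
  have hφ : ∀ u, φ ((augPow n d N).mkQ u) = φ₀ u := fun _ => rfl
  obtain ⟨F, hF⟩ := Ind.exists_lift (κ := κ) (h := h) (D := jetRep n d N) φ
    (by
      intro c u
      obtain ⟨u, rfl⟩ := (augPow n d N).mkQ_surjective u
      rw [← map_smul, hφ, hφ, hφ₀, hφ₀, Finset.smul_sum]
      refine Finset.sum_congr rfl fun w _ => ?_
      rw [Pi.smul_apply, smul_eq_C_mul, map_mul, symHom_C, mul_smul])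
    (by
      intro y u
      obtain ⟨u, rfl⟩ := (augPow n d N).mkQ_surjective u
      change φ ((augPow n d N).mkQ ((regRep n d).act y u)) = _
      rw [hφ, hφ, hφ₀, hφ₀, Finset.smul_sum]
      refine Finset.sum_congr rfl fun w _ => ?_
      change symHom κ h (vecPoly y * u w) • _ = _
      rw [map_mul, symHom_vecPoly, mul_smul])
    (by
      intro g u
      obtain ⟨u, rfl⟩ := (augPow n d N).mkQ_surjective u
      change φ ((augPow n d N).mkQ ((regRep n d).ρ g u)) = _
      rw [hφ, hφ, hφ₀, hφ₀, Finset.smul_sum]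
      refine (Fintype.sum_equiv (Equiv.mulLeft g) _ _ fun w => ?_).symm
      change _ = symHom κ h (symAct g (u (g⁻¹ * (g * w)))) • Cherednik.grp κ h (g * w) • m
      rw [inv_mul_cancel_left, Cherednik.grp_mul, ← mul_smul, ← mul_smul, ← mul_smul, ← mul_assoc,
        grp_mul_symHom, mul_assoc])
  refine ⟨F, ?_⟩
  rw [one, hF, hφ, hφ₀, Finset.sum_eq_single 1]
  · simp [Cherednik.grp_one]
  · intro w _ hw
    simp [hw]
  · simp

theorem span_one (N : ℕ) :
    Submodule.span (Cherednik n κ h) {one n κ h N} = (⊤ : Submodule _ (Jet n κ h N)) := by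
  rw [← Submodule.ker_mkQ (Submodule.span _ _), LinearMap.ker_eq_top]
  refine hom_ext κ h ?_
  rw [LinearMap.zero_apply]
  exact (Submodule.Quotient.mk_eq_zero _).2 (Submodule.mem_span_singleton_self _)

theorem exists_smul_one {N : ℕ} (m : Jet n κ h N) : ∃ a : Cherednik n κ h, a • one n κ h N = m :=
  Submodule.mem_span_singleton.1 (by rw [span_one]; trivial)

end Jet

end
end RationalCherednik

namespace RationalCherednik
noncomputable section

open Polynomial

/-! ### Generalized eigenspaces of the Euler element -/

section

variable {R : Type*} [CommRing R] [IsLocalRing R]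

open IsLocalRing

/-- Over a local ring, `t - a` and `t - b` are coprime if `a` and `b` have distinct residue
classes. -/
theorem isCoprime_splitPoly {S : Set (ResidueField R)} {s s' : Multiset R}
    (hs : ∀ r ∈ s, residue R r ∈ S) (hs' : ∀ r ∈ s', residue R r ∈ Sᶜ) :
    IsCoprime (splitPoly s) (splitPoly s') := by
  induction s using Multiset.induction_on with
  | empty => simpa [splitPoly] using isCoprime_one_left
  | cons a s ih =>
    rw [splitPoly_cons]
    refine IsCoprime.mul_left ?_ (ih fun r hr => hs r (Multiset.mem_cons_of_mem hr))
    clear ih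
    induction s' using Multiset.induction_on with
    | empty => simpa [splitPoly] using isCoprime_one_right
    | cons b s' ih' =>
      rw [splitPoly_cons]
      refine IsCoprime.mul_right (isCoprime_X_sub_C_of_isUnit_sub ?_)
        (ih' fun r hr => hs' r (Multiset.mem_cons_of_mem hr))
      rw [← residue_ne_zero_iff_isUnit, map_sub, sub_ne_zero]
      intro hab
      exact hs' b (Multiset.mem_cons_self b s') (hab ▸ hs a (Multiset.mem_cons_self a s))

open Classical in
theorem exists_splitPoly_eq_mul (S : Set (ResidueField R)) (s : Multiset R) :
    ∃ s₁ s₂ : Multiset R, (∀ r ∈ s₁, residue R r ∈ S) ∧ (∀ r ∈ s₂, residue R r ∈ Sᶜ) ∧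
      splitPoly s = splitPoly s₁ * splitPoly s₂ :=
  ⟨s.filter fun r => residue R r ∈ S, s.filter fun r => residue R r ∉ S,
    fun _ hr => (Multiset.mem_filter.1 hr).2, fun _ hr => (Multiset.mem_filter.1 hr).2, by
      rw [← splitPoly_add, Multiset.filter_add_not]⟩

end

variable {R : Type u} [CommRing R] [Algebra ℂ R]
variable {n d : ℕ} [NeZero d] (κ : Fin (d - 1) → R) (h : R)

/-- Elements of `V` lower the eigenvalues of the Euler element by one. -/
theorem aeval_euler_mul_vec (s : Multiset R) (y : V n) :
    aeval (Cherednik.euler n κ h) (splitPoly (s.map fun c => c - 1)) * Cherednik.vec κ h y =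
      Cherednik.vec κ h y * aeval (Cherednik.euler n κ h) (splitPoly s) := by
  induction s using Multiset.induction_on with
  | empty => simp [splitPoly]
  | cons c s ih =>
    have h1 : aeval (Cherednik.euler n κ h) (X - C (c - 1)) * Cherednik.vec κ h y =
        Cherednik.vec κ h y * aeval (Cherednik.euler n κ h) (X - C c) := by
      simp only [map_sub, aeval_X, aeval_C, map_one]
      rw [mul_sub, ← Cherednik.euler_mul_vec, ← Algebra.commutes, ← sub_mul]
      congr 1
      abel
    rw [Multiset.map_cons, splitPoly_cons, splitPoly_cons, map_mul, map_mul, mul_assoc, ih,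
      ← mul_assoc, h1, mul_assoc]

variable {M : Type*} [AddCommGroup M] [Module (Cherednik n κ h) M]

variable (n) in
/-- The element `m` lies in the sum of the generalized eigenspaces of the Euler element for the
eigenvalues with residue class in `S`: it is annihilated by a product of factors `eu - c` with
`c` in the preimage of `S`. -/
def HasSpectrumIn [IsLocalRing R] (S : Set (IsLocalRing.ResidueField R)) (m : M) : Prop :=
  ∃ s : Multiset R, (∀ r ∈ s, IsLocalRing.residue R r ∈ S) ∧
    aeval (Cherednik.euler n κ h) (splitPoly s) • m = 0

variable {κ h} {m m' : M}

theorem Jet.aeval_eulerEnd_one (N : ℕ) (p : R[X]) :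
    aeval (Ind.eulerEnd κ h (jetRep n d N)) p (Jet.one n κ h N) =
      aeval (Cherednik.euler n κ h) p • Jet.one n κ h N := by
  induction p using Polynomial.induction_on' with
  | add p q hp hq => rw [map_add, map_add, LinearMap.add_apply, hp, hq, add_smul]
  | monomial k r =>
    rw [← C_mul_X_pow_eq_monomial, map_mul, map_mul, aeval_C, aeval_C, Module.End.mul_apply,
      Module.algebraMap_end_apply, mul_smul, algebraMap_smul]
    congr 1
    induction k with
    | zero => simp
    | succ k ih =>
      rw [pow_succ, map_mul, map_mul, Module.End.mul_apply, aeval_X, aeval_X, Jet.eulerEnd_one,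
        map_smul, ih, ← mul_smul, map_pow, aeval_X, ← pow_succ, ← pow_succ']

/-- A polynomial that annihilates the Euler endomorphism of the jet module annihilates, as a
polynomial in `eu`, all elements killed by `I^N`. -/
theorem Jet.aeval_smul_eq_zero {N : ℕ} {p : R[X]}
    (hp : aeval (Ind.eulerEnd κ h (jetRep n d N)) p = 0) (hm : KilledByAugPow n κ h N m) :
    aeval (Cherednik.euler n κ h) p • m = 0 := by
  obtain ⟨F, rfl⟩ := Jet.exists_lift κ h hm
  rw [← map_smul, ← Jet.aeval_eulerEnd_one, hp, LinearMap.zero_apply, map_zero]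

variable [IsLocalRing R] {S : Set (IsLocalRing.ResidueField R)}

namespace HasSpectrumIn

theorem mono {S' : Set (IsLocalRing.ResidueField R)} (hm : HasSpectrumIn n κ h S m) (hS : S ⊆ S') :
    HasSpectrumIn n κ h S' m :=
  let ⟨s, hs, h0⟩ := hm
  ⟨s, fun r hr => hS (hs r hr), h0⟩

theorem sub (hm : HasSpectrumIn n κ h S m) (hm' : HasSpectrumIn n κ h S m') :
    HasSpectrumIn n κ h S (m - m') := by
  obtain ⟨s, hs, h0⟩ := hm
  obtain ⟨s', hs', h0'⟩ := hm'
  refine ⟨s + s', fun r hr => (Multiset.mem_add.1 hr).elim (hs r) (hs' r), ?_⟩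
  rw [smul_sub, splitPoly_add, map_mul, mul_smul _ _ m', h0', smul_zero, sub_zero, ← map_mul,
    mul_comm, map_mul, mul_smul, h0, smul_zero]

theorem aeval_smul (hm : HasSpectrumIn n κ h S m) (p : R[X]) :
    HasSpectrumIn n κ h S (aeval (Cherednik.euler n κ h) p • m) := by
  obtain ⟨s, hs, h0⟩ := hm
  refine ⟨s, hs, ?_⟩
  rw [← mul_smul, ← map_mul, mul_comm, map_mul, mul_smul, h0, smul_zero]

theorem map {M' : Type*} [AddCommGroup M'] [Module (Cherednik n κ h) M']
    (f : M →ₗ[Cherednik n κ h] M') (hm : HasSpectrumIn n κ h S m) : HasSpectrumIn n κ h S (f m) :=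
  let ⟨s, hs, h0⟩ := hm
  ⟨s, hs, by rw [← map_smul, h0, map_zero]⟩

theorem eq_zero (hm : HasSpectrumIn n κ h S m) (hm' : HasSpectrumIn n κ h Sᶜ m) : m = 0 := by
  obtain ⟨s, hs, h0⟩ := hm
  obtain ⟨s', hs', h0'⟩ := hm'
  obtain ⟨a, b, hab⟩ := isCoprime_splitPoly hs hs'
  have := congrArg (fun p => aeval (Cherednik.euler n κ h) p • m) hab
  simpa [add_smul, mul_smul, h0, h0'] using this.symm

theorem vec_smul (hm : HasSpectrumIn n κ h S m) (y : V n) :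
    HasSpectrumIn n κ h {x | x + 1 ∈ S} (Cherednik.vec κ h y • m) := by
  obtain ⟨s, hs, h0⟩ := hm
  refine ⟨s.map fun c => c - 1, fun r hr => ?_, ?_⟩
  · obtain ⟨c, hc, rfl⟩ := Multiset.mem_map.1 hr
    simpa using hs c hc
  · rw [← mul_smul, aeval_euler_mul_vec, mul_smul, h0, smul_zero]

theorem list_smul (hm : HasSpectrumIn n κ h S m) (l : List (V n)) :
    HasSpectrumIn n κ h {x | x + l.length ∈ S} ((l.map (Cherednik.vec κ h)).prod • m) := by
  induction l with
  | nil => simpa using hm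
  | cons y l ih =>
    rw [List.map_cons, List.prod_cons, mul_smul]
    refine (ih.vec_smul y).mono fun x hx => ?_
    simpa [add_assoc, add_comm] using hx

end HasSpectrumIn

/-- The decomposition of an element along its spectrum, for a set `S` of residue classes and its
complement. -/
theorem exists_add_hasSpectrumIn {s : Multiset R}
    (hm : aeval (Cherednik.euler n κ h) (splitPoly s) • m = 0)
    (S : Set (IsLocalRing.ResidueField R)) :
    ∃ m₁ m₂, m = m₁ + m₂ ∧ HasSpectrumIn n κ h S m₁ ∧ HasSpectrumIn n κ h Sᶜ m₂ := by
  obtain ⟨s₁, s₂, h1, h2, he⟩ := exists_splitPoly_eq_mul S s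
  obtain ⟨a, b, hab⟩ := isCoprime_splitPoly h1 h2
  refine ⟨aeval (Cherednik.euler n κ h) (b * splitPoly s₂) • m,
    aeval (Cherednik.euler n κ h) (a * splitPoly s₁) • m, ?_, ⟨s₁, h1, ?_⟩, ⟨s₂, h2, ?_⟩⟩
  · rw [← add_smul, ← map_add, add_comm, hab, map_one, one_smul]
  · rw [← mul_smul, ← map_mul, mul_left_comm, ← he, map_mul, mul_smul, hm, smul_zero]
  · rw [← mul_smul, ← map_mul, mul_left_comm, mul_comm (splitPoly s₂), ← he, map_mul, mul_smul, hm,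
      smul_zero]

namespace Jet

variable (n κ h) in
theorem exists_splitPoly (N : ℕ) :
    ∃ s : Multiset R, aeval (Ind.eulerEnd κ h (jetRep n d N)) (splitPoly s) = 0 :=
  (Ind.eulerEnd_induction κ h _ _ rfl (jetRep n d N)).1

end Jet

variable (n κ h) in
/-- The Euler element has finitely many eigenvalues modulo the maximal ideal on the singular
vectors, the vectors annihilated by `V`. -/
theorem exists_finite_singular_spectrum :
    ∃ S : Set (IsLocalRing.ResidueField R), S.Finite ∧
      ∀ {M : Type u} [AddCommGroup M] [Module (Cherednik n κ h) M] (m : M),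
        KilledByAugPow n κ h 1 m → HasSpectrumIn n κ h S m := by
  classical
  obtain ⟨s, hs⟩ := Jet.exists_splitPoly n κ h 1
  refine ⟨{x | x ∈ s.map (IsLocalRing.residue R)}, ?_, fun m hm =>
    ⟨s, fun r hr => Multiset.mem_map_of_mem _ hr, Jet.aeval_smul_eq_zero hs hm⟩⟩
  exact (s.map (IsLocalRing.residue R)).toFinset.finite_toSet.subset fun x hx => by simpa using hx

variable (R) in
/-- The residue field contains `ℂ`, so that only finitely many integers are differences of elements
of a finite subset. -/
theorem exists_forall_add_natCast_notMem {S : Set (IsLocalRing.ResidueField R)} (hS : S.Finite) :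
    ∃ N : ℕ, ∀ k ≥ N, ∀ x ∈ S, x + k ∉ S := by
  have : CharZero (IsLocalRing.ResidueField R) :=
    charZero_of_injective_algebraMap (algebraMap ℂ (IsLocalRing.ResidueField R)).injective
  have hfin :
      {k : ℕ | (k : IsLocalRing.ResidueField R) ∈ Set.image2 (fun x y => x - y) S S}.Finite :=
    (hS.image2 _ hS).preimage Nat.cast_injective.injOn
  obtain ⟨N, hN⟩ := hfin.bddAbove
  refine ⟨N + 1, fun k hk x hx hxk => ?_⟩
  have : k ≤ N := hN ⟨x + k, hxk, x, hx, by simp⟩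
  omega

/-- If the residue classes in `S` do not differ by integers `≥ N`, then a locally nilpotent element
with spectrum in `S` is annihilated by `I^N`: a nonzero product of `k ≥ N` vectors applied to it
would yield a singular vector with spectrum in `S - k`, outside of `S`. -/
theorem HasSpectrumIn.killedByAugPow {M : Type u} [AddCommGroup M] [Module (Cherednik n κ h) M]
    {m : M} {N : ℕ} (hS : ∀ {M : Type u} [AddCommGroup M] [Module (Cherednik n κ h) M] (m : M),
      KilledByAugPow n κ h 1 m → HasSpectrumIn n κ h S m)
    (hN : ∀ k ≥ N, ∀ x ∈ S, x + (k : ℕ) ∉ S) (hm : HasSpectrumIn n κ h S m)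
    (hnil : m ∈ nilpotentPart n κ h M) : KilledByAugPow n κ h N m := by
  have hstep : ∀ k ≥ N, KilledByAugPow n κ h (k + 1) m → KilledByAugPow n κ h k m := by
    intro k hk hk1 l hl
    refine (hS _ ?_).eq_zero ((hm.list_smul l).mono fun x hx hxS => hN k hk x hxS (hl ▸ hx))
    intro l' hl'
    rw [← mul_smul, ← List.prod_append, ← List.map_append]
    exact hk1 _ (by rw [List.length_append, hl, hl', add_comm])
  obtain ⟨j, hj⟩ := hnil
  rcases le_total j N with hjN | hjN
  · exact hj.mono hjN
  · induction j, hjN using Nat.le_induction with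
    | base => exact hj
    | succ k hk ih => exact ih (hstep k hk hj)

/-- A locally nilpotent module is generated by its elements with spectrum in `S`, if `S` contains
the spectrum of all singular vectors. -/
theorem span_hasSpectrumIn {M : Type u} [AddCommGroup M] [Module (Cherednik n κ h) M]
    (hS : ∀ {M : Type u} [AddCommGroup M] [Module (Cherednik n κ h) M] (m : M),
      KilledByAugPow n κ h 1 m → HasSpectrumIn n κ h S m)
    (hM : ∀ m : M, m ∈ nilpotentPart n κ h M) :
    Submodule.span (Cherednik n κ h) {m : M | HasSpectrumIn n κ h S m} = ⊤ := by
  set M' := Submodule.span (Cherednik n κ h) {m : M | HasSpectrumIn n κ h S m}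
  refine eq_top_iff.2 fun x _ => ?_
  by_contra hx
  -- A singular vector of the quotient has spectrum in `S`, but it lifts to an element with spectrum
  -- outside of `S`, as the complementary part of the lift lies in `M'`.
  have hx0 : M'.mkQ x ≠ 0 := fun h0 => hx ((Submodule.Quotient.mk_eq_zero _).1 h0)
  obtain ⟨N, hN⟩ := hM x
  obtain ⟨v, hv0, hv⟩ := exists_singular (κ := κ) (h := h) ⟨N, hN.map κ h M'.mkQ⟩ hx0
  obtain ⟨m, rfl⟩ := M'.mkQ_surjective v
  obtain ⟨N', hN'⟩ := hM m
  obtain ⟨s, hs⟩ := Jet.exists_splitPoly n κ h N'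
  obtain ⟨m₁, m₂, rfl, hm₁, hm₂⟩ := exists_add_hasSpectrumIn (Jet.aeval_smul_eq_zero hs hN') S
  have h1 : M'.mkQ m₁ = 0 := (Submodule.Quotient.mk_eq_zero _).2 (Submodule.subset_span hm₁)
  refine hv0 ((hS _ hv).eq_zero ?_)
  rw [map_add, h1, zero_add]
  exact hm₂.map _

end
end RationalCherednik

namespace RationalCherednik
noncomputable section

open Polynomial CategoryTheory

/-! ### The progenerator -/

theorem exists_surjective_of_span {A X M : Type*} [Ring A] [AddCommGroup X] [Module A X]
    [AddCommGroup M] [Module A M] [Module.Finite A M] (q : X) {t : Set M}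
    (ht : Submodule.span A t = ⊤) (hF : ∀ m ∈ t, ∃ F : X →ₗ[A] M, F q = m) :
    ∃ (N : ℕ) (f : (Fin N → X) →ₗ[A] M), Function.Surjective f := by
  classical
  have hfg := Module.Finite.fg_top (R := A) (M := M)
  rw [← ht, Submodule.fg_span_iff_fg_span_finset_subset] at hfg
  obtain ⟨t', ht', hspan⟩ := hfg
  choose F hF using fun m : t' => hF m (ht' m.2)
  let ε := t'.equivFin
  refine ⟨t'.card, ∑ i, F (ε.symm i) ∘ₗ LinearMap.proj i, ?_⟩
  rw [← LinearMap.range_eq_top, eq_top_iff, ← ht, hspan, Submodule.span_le]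
  intro m hm
  refine ⟨Pi.single (ε ⟨m, hm⟩) q, ?_⟩
  rw [LinearMap.sum_apply, Finset.sum_eq_single (ε ⟨m, hm⟩)]
  · rw [LinearMap.comp_apply, LinearMap.proj_apply, Pi.single_eq_same, Equiv.symm_apply_apply, hF]
  · intro i _ hi
    rw [LinearMap.comp_apply, LinearMap.proj_apply, Pi.single_eq_of_ne hi, map_zero]
  · simp

variable {R : Type u} [CommRing R] [Algebra ℂ R]
variable {n d : ℕ} [NeZero d] (κ : Fin (d - 1) → R) (h : R)

/-- Epimorphisms of `𝒪` are surjective, since `𝒪` contains their cokernels. -/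
theorem surjective_of_epi {M M' : (categoryO n κ h).FullSubcategory} (g : M ⟶ M') [Epi g] :
    Function.Surjective g.hom.hom := by
  let Q := LinearMap.range g.hom.hom
  have hQ : categoryO n κ h (ModuleCat.of _ (M'.obj ⧸ Q)) := by
    have := M'.property.1
    refine ⟨inferInstanceAs (Module.Finite _ (M'.obj ⧸ Q)), fun m => ?_⟩
    obtain ⟨m, rfl⟩ := Q.mkQ_surjective m
    obtain ⟨N, hN⟩ := M'.property.2 m
    exact ⟨N, KilledByAugPow.map κ h Q.mkQ hN⟩
  let π : M' ⟶ (⟨_, hQ⟩ : (categoryO n κ h).FullSubcategory) :=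
    ObjectProperty.homMk (ModuleCat.ofHom Q.mkQ)
  let z : M' ⟶ (⟨_, hQ⟩ : (categoryO n κ h).FullSubcategory) :=
    ObjectProperty.homMk (ModuleCat.ofHom 0)
  have hπ : π = z := by
    rw [← cancel_epi g]
    refine ObjectProperty.hom_ext _ (ModuleCat.hom_ext (LinearMap.ext fun m => ?_))
    exact (Submodule.Quotient.mk_eq_zero _).2 (LinearMap.mem_range_self _ m)
  intro m
  have h1 : Q.mkQ m = 0 := congrArg (fun f : M' ⟶ _ => f.hom.hom m) hπ
  exact (Submodule.Quotient.mk_eq_zero _).1 h1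

variable {κ h}

theorem Jet.mem_nilpotentPart {N : ℕ} (m : Jet n κ h N) :
    m ∈ nilpotentPart n κ h (Jet n κ h N) := by
  obtain ⟨a, rfl⟩ := Jet.exists_smul_one κ h m
  exact Submodule.smul_mem _ a ⟨N, Jet.killedByAugPow_one κ h N⟩

variable [IsLocalRing R]

variable (n κ h) in
/-- The image of a projection `e` of some `H_R(κ, h) ⊗_{S(V)} (S(V)/I^N ⊗ R)` whose element
`e(one)` is universal among the locally nilpotent elements with spectrum in `S`, where `S` is a set
of residue classes that contains the spectrum of all singular vectors. The projection is a
polynomial in the Euler endomorphism. -/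
theorem exists_universal_summand :
    ∃ (S : Set (IsLocalRing.ResidueField R)) (N : ℕ)
      (e : Module.End (Cherednik n κ h) (Jet n κ h N)),
      (∀ {M : Type u} [AddCommGroup M] [Module (Cherednik n κ h) M] (m : M),
        KilledByAugPow n κ h 1 m → HasSpectrumIn n κ h S m) ∧
      IsIdempotentElem e ∧
      HasFiniteDeltaFiltration n κ h (LinearMap.range e) ∧
      HasSpectrumIn n κ h S (e (Jet.one n κ h N)) ∧
      ∀ {M : Type u} [AddCommGroup M] [Module (Cherednik n κ h) M] (m : M),
        m ∈ nilpotentPart n κ h M → HasSpectrumIn n κ h S m →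
        ∃ F : Jet n κ h N →ₗ[Cherednik n κ h] M,
          F (Jet.one n κ h N) = m ∧ F (e (Jet.one n κ h N)) = m := by
  obtain ⟨S, hfin, hS⟩ := exists_finite_singular_spectrum n κ h
  obtain ⟨N, hN⟩ := exists_forall_add_natCast_notMem R hfin
  obtain ⟨s, hs⟩ := Jet.exists_splitPoly n κ h N
  obtain ⟨s₁, s₂, h1, h2, he⟩ := exists_splitPoly_eq_mul S s
  obtain ⟨a, b, hab⟩ := isCoprime_splitPoly h1 h2
  rw [he] at hs
  set T := Ind.eulerEnd κ h (jetRep n d N)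
  have hid : IsIdempotentElem (aeval T (b * splitPoly s₂)) := by
    have h3 : b * splitPoly s₂ * (b * splitPoly s₂) =
        b * splitPoly s₂ - a * b * (splitPoly s₁ * splitPoly s₂) := by
      linear_combination (b * splitPoly s₂) * hab
    rw [IsIdempotentElem, ← map_mul, h3, map_sub, map_mul _ (a * b), hs, mul_zero, sub_zero]
  refine ⟨S, N, aeval T (b * splitPoly s₂), hS, hid,
    (Ind.eulerEnd_induction κ h _ _ rfl (jetRep n d N)).2 _ hid, ⟨s₁, h1, ?_⟩, fun m hnil hm => ?_⟩
  · rw [Jet.aeval_eulerEnd_one, ← mul_smul, ← map_mul, mul_left_comm, map_mul, mul_smul,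
      Jet.aeval_smul_eq_zero hs (Jet.killedByAugPow_one κ h N), smul_zero]
  · have hk := hm.killedByAugPow hS hN hnil
    obtain ⟨F, hF⟩ := Jet.exists_lift κ h hk
    refine ⟨F, hF, ?_⟩
    rw [Jet.aeval_eulerEnd_one, map_smul, hF]
    -- `a (∏ over s₁)` kills `m`: the result has spectrum both in `S` and outside of `S`.
    have h3 : aeval (Cherednik.euler n κ h) (a * splitPoly s₁) • m = 0 := by
      refine (hm.aeval_smul _).eq_zero ⟨s₂, h2, ?_⟩
      rw [← mul_smul, ← map_mul, mul_left_comm, mul_comm (splitPoly s₂), map_mul, mul_smul,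
        Jet.aeval_smul_eq_zero hs hk, smul_zero]
    have h4 := congrArg (fun p => aeval (Cherednik.euler n κ h) p • m) hab
    simpa only [map_add, add_smul, h3, zero_add, map_one, one_smul] using h4

variable (n κ h) in
/-- The summand of `exists_universal_summand` is a progenerator of `𝒪`. -/
theorem exists_isProgenerator_hasFiniteDeltaFiltration :
    ∃ P : (categoryO n κ h).FullSubcategory,
      IsProgenerator κ h P ∧ HasFiniteDeltaFiltration n κ h P.obj := by
  obtain ⟨S, N, e, hS, hid, hfilt, hq, huniv⟩ := exists_universal_summand n κ h
  have hidm : ∀ x : LinearMap.range e, e x = x := by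
    rintro ⟨_, x, rfl⟩
    exact LinearMap.congr_fun hid x
  have hfg : Module.Finite (Cherednik n κ h) (Jet n κ h N) :=
    ⟨⟨{Jet.one n κ h N}, by rw [Finset.coe_singleton, Jet.span_one]⟩⟩
  have hP : categoryO n κ h (ModuleCat.of _ (LinearMap.range e)) := by
    refine ⟨inferInstanceAs (Module.Finite _ (LinearMap.range e)), fun x => ?_⟩
    obtain ⟨k, hk⟩ := Jet.mem_nilpotentPart (κ := κ) (h := h) (x : LinearMap.range e).1
    exact ⟨k, fun l hl => Subtype.ext (hk l hl)⟩
  let q : LinearMap.range e := ⟨e (Jet.one n κ h N), LinearMap.mem_range_self _ _⟩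
  have hqS : HasSpectrumIn n κ h S q := by
    obtain ⟨s, hs, h0⟩ := hq
    exact ⟨s, hs, Subtype.ext h0⟩
  refine ⟨⟨_, hP⟩, ⟨⟨fun {M' M''} f g _ => ?_⟩, fun M => ?_⟩, hfilt⟩
  · obtain ⟨m₀, hm₀⟩ := surjective_of_epi κ h g (f.hom.hom q)
    obtain ⟨k, hk⟩ := M'.property.2 m₀
    obtain ⟨s, hs⟩ := Jet.exists_splitPoly n κ h k
    -- Of a lift `m₀` of `f(q)`, only the part with spectrum in `S` matters: `g` maps the other part
    -- to an element with spectrum both in `S` and outside of `S`.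
    obtain ⟨m₁, m₂, rfl, hm₁, hm₂⟩ := exists_add_hasSpectrumIn (Jet.aeval_smul_eq_zero hs hk) S
    have hm : g.hom.hom m₁ + g.hom.hom m₂ = f.hom.hom q := by rw [← map_add, hm₀]
    have hgm₂ : g.hom.hom m₂ = 0 := by
      refine HasSpectrumIn.eq_zero ?_ (hm₂.map g.hom.hom)
      rw [← sub_eq_of_eq_add' hm.symm]
      exact (hqS.map f.hom.hom).sub (hm₁.map g.hom.hom)
    rw [hgm₂, add_zero] at hm
    obtain ⟨F, hF, -⟩ := huniv m₁ (M'.property.2 m₁) hm₁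
    have hcomp : g.hom.hom ∘ₗ F = f.hom.hom ∘ₗ e.rangeRestrict := by
      refine Jet.hom_ext κ h ?_
      rw [LinearMap.comp_apply, hF, hm]
      rfl
    refine ⟨ObjectProperty.homMk (ModuleCat.ofHom (F ∘ₗ (LinearMap.range e).subtype)),
      ObjectProperty.hom_ext _ (ModuleCat.hom_ext (LinearMap.ext fun x => ?_))⟩
    refine (LinearMap.congr_fun hcomp (x : LinearMap.range e).1).trans ?_
    exact congrArg f.hom.hom (Subtype.ext (hidm x))
  · have hspan := span_hasSpectrumIn (κ := κ) (h := h) hS M.property.2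
    have := M.property.1
    refine exists_surjective_of_span q hspan fun m hm => ?_
    exact (huniv m (M.property.2 m) hm).elim fun F hF =>
      ⟨F ∘ₗ (LinearMap.range e).subtype, hF.2⟩

end
end RationalCherednik

theorem mainTheorem4 (n d : ℕ) [NeZero d] (R : Type u) [CommRing R] [Algebra ℂ R]
    [IsNoetherianRing R] [IsLocalRing R] (κ : Fin (d - 1) → R) (h : R) :
    ∃ P : (RationalCherednik.categoryO n κ h).FullSubcategory,
      RationalCherednik.IsProgenerator κ h P ∧
      RationalCherednik.HasFiniteDeltaFiltration n κ h P.obj :=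
  RationalCherednik.exists_isProgenerator_hasFiniteDeltaFiltration n κ h
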